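/- **Setting.** A Young function is a convex, left-continuous function $\Phi:[0,\infty)\to[0,\infty]$ with $\lim_{r\to0+}\Phi(r)=\Phi(0)=0$ and $\lim_{r\to\infty}\Phi(r)=\infty$. For a non-decreasing function $A:[0,\infty)\to[0,\infty]$ put $A^{-1}(s)=\inf\{r\ge 0: A(r)>s\}$ ($\inf\emptyset=\infty$); for a Young function $\Phi$ put $\widetilde\Phi(r)=\sup_{s\ge0}(rs-\Phi(s))$. For measurable $f$ on $\mathbb R^n$ let $$\|f\|_{L_\Phi}=\inf\Big\{\lambda>0:\int_{\mathbb R^n}\Phi\Big(\frac{|f(x)|}{\lambda}\Big)dx\le1\Big\},\qquad \|f\|_{WL_\Phi}=\inf\Big\{\lambda>0:\sup_{t>0}\Phi(t)\,\Big|\Big\{x:\frac{|f(x)|}{\lambda}>t\Big\}\Big|\le1\Big\}.$$ $L_\Phi(\mathbb R^n)$ is the set of $f\in L_1^{\rm loc}(\mathbb R^n)$ with $\int_{\mathbb R^n}\Phi(k|f(x)|)\,dx<\infty$ for some $k>0$, and $WL_\Phi(\mathbb R^n)$ is the set of $f\in L_1^{\rm loc}(\mathbb R^n)$ with $\|f\|_{WL_\Phi}<\infty$;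 $f\in L_\Phi^{\rm loc}$ (resp. $WL_\Phi^{\rm loc}$) means $f\chi_B\in L_\Phi$ (resp. $WL_\Phi$) for every ball $B$. For a positive measurable function $\varphi$ on $\mathbb R^n\times(0,\infty)$, $M_{\Phi,\varphi}(\mathbb R^n)$ is the space of $f\in L_\Phi^{\rm loc}(\mathbb R^n)$ with $$\|f\|_{M_{\Phi,\varphi}}=\sup_{x\in\mathbb R^n,\,r>0}\varphi(x,r)^{-1}\,\Phi^{-1}\big(|B(x,r)|^{-1}\big)\,\|f\chi_{B(x,r)}\|_{L_\Phi}<\infty,$$ and $WM_{\Phi,\varphi}(\mathbb R^n)$ is the space of $f\in WL_\Phi^{\rm loc}(\mathbb R^n)$ for which the same expression with $WL_\Phi$ in place of $L_\Phi$, denoted $\|f\|_{WM_{\Phi,\varphi}}$, is finite. For $0<\alpha<n$ let $I_\alpha f(x)=\int_{\mathbb R^n}\frac{f(y)}{|x-y|^{n-\alpha}}\,dy$. For $1<p<\infty$, $p'=p/(p-1)$, and Young functions $\Phi,\Psi$, let $$\Phi_p(s)=\int_0^s r^{p'-1}\big(\mathcal A_p^{-1}(r^{p'})\big)^{p'}dr,\qquad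 \mathcal A_p(s)=\int_0^s\frac{\widetilde\Phi(t)}{t^{1+p'}}\,dt,$$ and let $\Psi_p$ be the Young function whose complementary function is $$\widetilde{\Psi_p}(s)=\int_0^s r^{p'-1}\big(\mathcal B_p^{-1}(r^{p'})\big)^{p'}dr,\qquad \mathcal B_p(s)=\int_0^s\frac{\Psi(t)}{t^{1+p'}}\,dt.$$ One says that $G$ dominates $F$ globally if there is $c>0$ with $F(s)\le G(cs)$ for all $s\ge0$. **Theorem.** Let $0<\alpha<n$, let $\Phi,\Psi$ be Young functions, let $\varphi_1,\varphi_2$ be positive measurable functions on $\mathbb R^n\times(0,\infty)$, and suppose that there is a constant $C$ such that for all $x\in\mathbb R^n$ and $r>0$ $$\int_r^\infty\Big(\operatorname*{ess\,inf}_{t<s<\infty}\frac{\varphi_1(x,s)}{\Phi^{-1}(s^{-n})}\Big)\Psi^{-1}(t^{-n})\,\frac{dt}{t}\le C\,\varphi_2(x,r).$$ (i) If $\int_0^1\widetilde\Phi(t)\,t^{-1-n/(n-\alpha)}dt<\infty$, $\int_0^1\Psi(t)\,t^{-1-n/(n-\alpha)}dt<\infty$, $\Phi$ dominates $\Psi_{n/\alpha}$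 globally and $\Phi_{n/\alpha}$ dominates $\Psi$ globally, then $I_\alpha$ is bounded from $M_{\Phi,\varphi_1}(\mathbb R^n)$ to $M_{\Psi,\varphi_2}(\mathbb R^n)$. (ii) If $\int_0^1\widetilde\Phi(t)\,t^{-1-n/(n-\alpha)}dt<\infty$ and $\Phi_{n/\alpha}$ dominates $\Psi$ globally, then $I_\alpha$ is bounded from $M_{\Phi,\varphi_1}(\mathbb R^n)$ to $WM_{\Psi,\varphi_2}(\mathbb R^n)$. Here bounded means: for every $f\in M_{\Phi,\varphi_1}(\mathbb R^n)$ the integral defining $I_\alpha f(x)$ converges absolutely for almost every $x$, $I_\alpha f$ belongs to the target space, and its quasinorm there is at most $C'\|f\|_{M_{\Phi,\varphi_1}}$ with $C'$ independent of $f$. -/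

import Mathlib

open MeasureTheory Filter Topology Set
open scoped NNReal ENNReal

noncomputable section

namespace OrliczMorrey

/-- Young functions `Φ : [0,∞) → [0,∞]`. -/
structure IsYoung (Φ : ℝ≥0 → ℝ≥0∞) : Prop where
  convex : ConvexOn ℝ≥0 univ Φ
  left_continuous : ∀ r, ContinuousWithinAt Φ (Iic r) r
  map_zero : Φ 0 = 0
  tendsto_zero : Tendsto Φ (𝓝[>] 0) (𝓝 0)
  tendsto_top : Tendsto Φ atTop (𝓝 ∞)

/-- The generalized inverse `s ↦ inf {r ≥ 0 : Φ r > s}`, with `inf ∅ = ∞`. -/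
def genInv (Φ : ℝ≥0 → ℝ≥0∞) (s : ℝ≥0∞) : ℝ≥0∞ :=
  ⨅ (r : ℝ≥0) (_ : s < Φ r), (r : ℝ≥0∞)

/-- The complementary function `r ↦ sup {r s - Φ s : s ≥ 0}`. The subtraction is truncated at `0`,
which does not change the supremum since `s = 0` contributes the value `0` when `Φ 0 = 0`. -/
def compl (Φ : ℝ≥0 → ℝ≥0∞) (r : ℝ≥0) : ℝ≥0∞ :=
  ⨆ s : ℝ≥0, (((r * s : ℝ≥0) : ℝ≥0∞) - Φ s)

/-- `s ↦ ∫₀ˢ A(t) / t^(1 + q) dt`. -/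
def primitiveDiv (A : ℝ≥0 → ℝ≥0∞) (q : ℝ) (s : ℝ≥0) : ℝ≥0∞ :=
  ∫⁻ t in Ioc (0 : ℝ) s, A t.toNNReal / ENNReal.ofReal (t ^ (1 + q))

/-- `s ↦ ∫₀ˢ r^(q - 1) (𝒜⁻¹(r^q))^q dr`, where `𝒜(s) = ∫₀ˢ A(t) / t^(1 + q) dt`. -/
def cianchiTransform (A : ℝ≥0 → ℝ≥0∞) (q : ℝ) (s : ℝ≥0) : ℝ≥0∞ :=
  ∫⁻ r in Ioc (0 : ℝ) s,
    ENNReal.ofReal (r ^ (q - 1)) * genInv (primitiveDiv A q) (ENNReal.ofReal (r ^ q)) ^ q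

/-- The Young function `Φ_p`, built from the complementary function of `Φ` with `p' = p / (p - 1)`. -/
def upperConj (Φ : ℝ≥0 → ℝ≥0∞) (p : ℝ) : ℝ≥0 → ℝ≥0∞ :=
  cianchiTransform (compl Φ) (p / (p - 1))

/-- The Young function `Ψ_p`: the one whose complementary function is the transform of `Ψ`
with `p' = p / (p - 1)`, that is, the complementary function of that transform. -/
def lowerConj (Ψ : ℝ≥0 → ℝ≥0∞) (p : ℝ) : ℝ≥0 → ℝ≥0∞ :=
  compl (cianchiTransform Ψ (p / (p - 1)))

/-- `Ψ` dominates `Φ` globally. -/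
def Dominates (Ψ Φ : ℝ≥0 → ℝ≥0∞) : Prop :=
  ∃ c : ℝ≥0, 0 < c ∧ ∀ s, Φ s ≤ Ψ (c * s)

/-- Cianchi's conditions for the weak type boundedness of the Riesz potential. -/
def CondWeak (n : ℕ) (α : ℝ) (Φ Ψ : ℝ≥0 → ℝ≥0∞) : Prop :=
  primitiveDiv (compl Φ) (n / (n - α)) 1 < ∞ ∧ Dominates (upperConj Φ (n / α)) Ψ

/-- Cianchi's conditions for the strong type boundedness of the Riesz potential. -/
def CondStrong (n : ℕ) (α : ℝ) (Φ Ψ : ℝ≥0 → ℝ≥0∞) : Prop :=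
  primitiveDiv (compl Φ) (n / (n - α)) 1 < ∞ ∧ primitiveDiv Ψ (n / (n - α)) 1 < ∞ ∧
    Dominates Φ (lowerConj Ψ (n / α)) ∧ Dominates (upperConj Φ (n / α)) Ψ

section Spaces

variable {n : ℕ} {𝕜 : Type*} [RCLike 𝕜]

/-- The Luxemburg norm of `L_Φ(ℝⁿ)`, with values in `[0,∞]`. -/
def orliczNorm (Φ : ℝ≥0 → ℝ≥0∞) (f : EuclideanSpace ℝ (Fin n) → 𝕜) : ℝ≥0∞ :=
  ⨅ (l : ℝ≥0) (_ : 0 < l) (_ : ∫⁻ x, Φ (‖f x‖₊ / l) ≤ 1), (l : ℝ≥0∞)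

/-- The quasinorm of the weak space `WL_Φ(ℝⁿ)`, with values in `[0,∞]`. -/
def weakOrliczNorm (Φ : ℝ≥0 → ℝ≥0∞) (f : EuclideanSpace ℝ (Fin n) → 𝕜) : ℝ≥0∞ :=
  ⨅ (l : ℝ≥0) (_ : 0 < l)
    (_ : ⨆ (t : ℝ≥0) (_ : 0 < t), Φ t * volume {x | t < ‖f x‖₊ / l} ≤ 1), (l : ℝ≥0∞)

/-- `f ∈ L_Φ(ℝⁿ)`. -/
def MemOrlicz (Φ : ℝ≥0 → ℝ≥0∞) (f : EuclideanSpace ℝ (Fin n) → 𝕜) : Prop :=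
  LocallyIntegrable f volume ∧ ∃ k : ℝ≥0, 0 < k ∧ ∫⁻ x, Φ (k * ‖f x‖₊) < ∞

/-- `f ∈ WL_Φ(ℝⁿ)`. -/
def MemWeakOrlicz (Φ : ℝ≥0 → ℝ≥0∞) (f : EuclideanSpace ℝ (Fin n) → 𝕜) : Prop :=
  LocallyIntegrable f volume ∧ weakOrliczNorm Φ f < ∞

/-- A positive (Lebesgue) measurable function on `ℝⁿ × (0,∞)`; its values at `r ≤ 0` play no
role. -/
def IsMorreyWeight (φ : EuclideanSpace ℝ (Fin n) → ℝ → ℝ) : Prop :=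
  (∀ x, ∀ r > 0, 0 < φ x r) ∧
    AEMeasurable (fun p : EuclideanSpace ℝ (Fin n) × ℝ => φ p.1 p.2)
      (volume.restrict (univ ×ˢ Ioi (0 : ℝ)))

/-- `sup_{x, r > 0} φ(x,r)⁻¹ Φ⁻¹(|B(x,r)|⁻¹) ‖f‖_{L_Φ(B(x,r))}`. -/
def morreyNorm (Φ : ℝ≥0 → ℝ≥0∞) (φ : EuclideanSpace ℝ (Fin n) → ℝ → ℝ)
    (f : EuclideanSpace ℝ (Fin n) → 𝕜) : ℝ≥0∞ :=
  ⨆ (x : EuclideanSpace ℝ (Fin n)) (r : ℝ) (_ : 0 < r),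
    (ENNReal.ofReal (φ x r))⁻¹ * genInv Φ ((volume (Metric.ball x r))⁻¹) *
      orliczNorm Φ ((Metric.ball x r).indicator f)

/-- `sup_{x, r > 0} φ(x,r)⁻¹ Φ⁻¹(|B(x,r)|⁻¹) ‖f‖_{WL_Φ(B(x,r))}`. -/
def weakMorreyNorm (Φ : ℝ≥0 → ℝ≥0∞) (φ : EuclideanSpace ℝ (Fin n) → ℝ → ℝ)
    (f : EuclideanSpace ℝ (Fin n) → 𝕜) : ℝ≥0∞ :=
  ⨆ (x : EuclideanSpace ℝ (Fin n)) (r : ℝ) (_ : 0 < r),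
    (ENNReal.ofReal (φ x r))⁻¹ * genInv Φ ((volume (Metric.ball x r))⁻¹) *
      weakOrliczNorm Φ ((Metric.ball x r).indicator f)

/-- `f ∈ M_{Φ,φ}(ℝⁿ)`: `f` is locally in `L_Φ` and has finite quasinorm. -/
def MemMorrey (Φ : ℝ≥0 → ℝ≥0∞) (φ : EuclideanSpace ℝ (Fin n) → ℝ → ℝ)
    (f : EuclideanSpace ℝ (Fin n) → 𝕜) : Prop :=
  (∀ x, ∀ r > 0, MemOrlicz Φ ((Metric.ball x r).indicator f)) ∧ morreyNorm Φ φ f < ∞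

/-- `f ∈ WM_{Φ,φ}(ℝⁿ)`: `f` is locally in `WL_Φ` and has finite weak quasinorm. -/
def MemWeakMorrey (Φ : ℝ≥0 → ℝ≥0∞) (φ : EuclideanSpace ℝ (Fin n) → ℝ → ℝ)
    (f : EuclideanSpace ℝ (Fin n) → 𝕜) : Prop :=
  (∀ x, ∀ r > 0, MemWeakOrlicz Φ ((Metric.ball x r).indicator f)) ∧ weakMorreyNorm Φ φ f < ∞

/-- The integrand `y ↦ f(y) / |x - y|^(n - α)` of the Riesz potential at `x`. -/
def rieszIntegrand (α : ℝ) (f : EuclideanSpace ℝ (Fin n) → 𝕜) (x y : EuclideanSpace ℝ (Fin n)) :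
    𝕜 :=
  (‖x - y‖ ^ ((n : ℝ) - α))⁻¹ • f y

/-- The Riesz potential `I_α f`. -/
def rieszPotential (α : ℝ) (f : EuclideanSpace ℝ (Fin n) → 𝕜) (x : EuclideanSpace ℝ (Fin n)) : 𝕜 :=
  ∫ y, rieszIntegrand α f x y

/-- The Zygmund-type condition
`∫_r^∞ (ess inf_{t<s<∞} φ₁(x,s) / Φ⁻¹(s⁻ⁿ)) Ψ⁻¹(t⁻ⁿ) dt/t ≤ C φ₂(x,r)`
with `C` independent of `x` and `r`. -/
def ZygmundCond (φ₁ φ₂ : EuclideanSpace ℝ (Fin n) → ℝ → ℝ) (Φ Ψ : ℝ≥0 → ℝ≥0∞) : Prop :=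
  ∃ C : ℝ≥0, ∀ x, ∀ r > 0,
    ∫⁻ t in Ioi r,
      essInf (fun s : ℝ => ENNReal.ofReal (φ₁ x s) / genInv Φ (ENNReal.ofReal ((s ^ n)⁻¹)))
          (volume.restrict (Ioi t)) *
        genInv Ψ (ENNReal.ofReal ((t ^ n)⁻¹)) / ENNReal.ofReal t
      ≤ C * ENNReal.ofReal (φ₂ x r)

end Spaces

end OrliczMorrey

end

/-!
The potential of `f` on a ball `B` is split into the potential of `f` restricted to `2B`, estimated
in the norm of `L_Ψ` or `WL_Ψ` over `B`, and the potential of the rest, estimated pointwise.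

For the first part, put `H(T)^q = ∫₀ᵀ (t/Φ(t))^(q-1) dt` with `q = n/(n-α)`. Cianchi's conditions
say that `Ψ(c H(T)) ≤ Φ(T)`, and dually for the complementary functions. If `∫ Φ(F) ≤ 1`, Hölder's
inequality gives `∫₀ᵀ |{F > t}|^(α/n) dt ≤ H(T)`. Integrals of this kind control the mean of `I_α F`
over a set, which yields the weak type inequality, and the integral of `I_α F` against a function
`G`, which yields the strong one by duality.

For the second part, a layer-cake decomposition of the kernel bounds the potential by the tail
integral `∫_r^∞ ‖f‖_{L_Φ(B(x,t))} Ψ⁻¹(t⁻ⁿ) dt/t`. Since `‖f‖_{L_Φ(B(x,t))}` is non-decreasing in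
`t`, it is at most the essential infimum in the Zygmund condition times the Morrey norm of `f`.
-/

noncomputable section

namespace OrliczMorrey

theorem lintegral_setLIntegral_swap {X Y : Type*} [MeasurableSpace X] [MeasurableSpace Y]
    {μ : Measure X} {ν : Measure Y} [SFinite μ] [SFinite ν] {R : X → Y → Prop}
    (hR : MeasurableSet {p : X × Y | R p.1 p.2}) {f : X → Y → ℝ≥0∞}
    (hf : Measurable (Function.uncurry f)) :
    ∫⁻ x, ∫⁻ y in {y | R x y}, f x y ∂ν ∂μ = ∫⁻ y, ∫⁻ x in {x | R x y}, f x y ∂μ ∂ν := by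
  have hleft (x : X) : ∫⁻ y in {y | R x y}, f x y ∂ν =
      ∫⁻ y, {p : X × Y | R p.1 p.2}.indicator (Function.uncurry f) (x, y) ∂ν := by
    have hx : MeasurableSet {y | R x y} := measurable_prodMk_left hR
    rw [← lintegral_indicator hx]
    rfl
  have hright (y : Y) : ∫⁻ x in {x | R x y}, f x y ∂μ =
      ∫⁻ x, {p : X × Y | R p.1 p.2}.indicator (Function.uncurry f) (x, y) ∂μ := by
    have hy : MeasurableSet {x | R x y} := measurable_prodMk_right hR
    rw [← lintegral_indicator hy]
    rfl
  simp_rw [hleft, hright]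
  exact lintegral_lintegral_swap (hf.indicator hR).aemeasurable

theorem volume_setOf_ofReal_lt (x : ℝ≥0∞) :
    volume ({t : ℝ | ENNReal.ofReal t < x} ∩ Ioi 0) = x := by
  rcases eq_or_ne x ∞ with rfl | hx
  · simp
  · have hIoo : {t : ℝ | ENNReal.ofReal t < x} ∩ Ioi 0 = Ioo 0 x.toReal := by
      ext t
      rw [mem_inter_iff, and_comm]
      exact and_congr_right fun ht => ENNReal.ofReal_lt_iff_lt_toReal (le_of_lt ht) hx
    rw [hIoo, Real.volume_Ioo, sub_zero, ENNReal.ofReal_toReal hx]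

theorem le_of_forall_coe_gt {x y : ℝ≥0∞} (h : ∀ a : ℝ≥0, y < a → x ≤ a) : x ≤ y :=
  le_of_forall_gt_imp_ge_of_dense fun _ hb =>
    let ⟨a, hya, hab⟩ := ENNReal.lt_iff_exists_nnreal_btwn.1 hb
    (h a hya).trans hab.le

theorem rpow_one_sub_anti {q : ℝ} (hq : 1 ≤ q) : Antitone fun x : ℝ≥0∞ => x ^ (1 - q) := by
  intro x y hxy
  simp only [← neg_sub q 1, ENNReal.rpow_neg]
  gcongr

theorem exists_coe_rpow_eq {p : ℝ} (hp : 0 < p) {x : ℝ≥0∞} (hx : x ≠ ∞) :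
    ∃ s : ℝ≥0, (s : ℝ≥0∞) ^ p = x := by
  lift x to ℝ≥0 using hx
  refine ⟨x ^ p⁻¹, ?_⟩
  rw [← ENNReal.coe_rpow_of_nonneg _ hp.le, NNReal.rpow_inv_rpow hp.ne']

/-! ### Star-shaped functions and their complements -/

/-- Star-shapedness at the origin: `s ↦ Φ s / s` is non-decreasing, stated without division. It
takes the place of convexity in the estimates. -/
def StarShaped (Φ : ℝ≥0 → ℝ≥0∞) : Prop :=
  ∀ a : ℝ≥0, a ≤ 1 → ∀ s, Φ (a * s) ≤ a * Φ s

/-- Young functions with convexity relaxed to star-shapedness, and without left continuity. -/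
structure IsStarYoung (Φ : ℝ≥0 → ℝ≥0∞) : Prop where
  starShaped : StarShaped Φ
  tendsto_zero : Tendsto Φ (𝓝[>] 0) (𝓝 0)
  tendsto_top : Tendsto Φ atTop (𝓝 ∞)

section Young

variable {Φ Ψ : ℝ≥0 → ℝ≥0∞}

theorem IsYoung.isStarYoung (h : IsYoung Φ) : IsStarYoung Φ where
  starShaped a ha s := by
    have hconv := h.convex.2 (mem_univ s) (mem_univ 0) (zero_le (a := a)) (zero_le (a := 1 - a))
      (add_tsub_cancel_of_le ha)
    simpa [h.map_zero, ENNReal.smul_def] using hconv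
  tendsto_zero := h.tendsto_zero
  tendsto_top := h.tendsto_top

namespace StarShaped

theorem mul_apply_le (h : StarShaped Φ) {s t : ℝ≥0} (hst : s ≤ t) :
    (t : ℝ≥0∞) * Φ s ≤ s * Φ t := by
  rcases eq_or_ne t 0 with rfl | ht
  · simp
  have hs : Φ s ≤ (s / t : ℝ≥0) * Φ t := by
    simpa only [div_mul_cancel₀ _ ht] using h (s / t) (div_le_one_of_le₀ hst zero_le) t
  calc (t : ℝ≥0∞) * Φ s ≤ t * ((s / t : ℝ≥0) * Φ t) := by gcongr
    _ = s * Φ t := by rw [← mul_assoc, ← ENNReal.coe_mul, mul_div_cancel₀ _ ht]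

theorem map_zero (h : StarShaped Φ) : Φ 0 = 0 := by
  simpa using h 0 zero_le_one 0

theorem monotone (h : StarShaped Φ) : Monotone Φ := by
  intro s t hst
  rcases eq_or_ne t 0 with rfl | ht
  · simp [le_antisymm hst zero_le]
  · rw [← ENNReal.mul_le_mul_iff_right (a := (t : ℝ≥0∞)) (by simpa using ht) (by simp)]
    exact (h.mul_apply_le hst).trans (by gcongr)

theorem measurable (h : StarShaped Φ) : Measurable Φ := h.monotone.measurable

theorem apply_div_le (h : StarShaped Φ) {K : ℝ≥0} (hK : 1 ≤ K) (s : ℝ≥0) :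
    Φ (s / K) ≤ Φ s / K := by
  have hinv := h K⁻¹ (inv_le_one_of_one_le₀ hK) s
  rw [ENNReal.coe_inv (by positivity), mul_comm, mul_comm (_⁻¹)] at hinv
  simpa [div_eq_mul_inv] using hinv

theorem apply_div_le_of_le_mul (h : StarShaped Φ) {K : ℝ≥0} (hK : 1 ≤ K) {s : ℝ≥0} {b : ℝ≥0∞}
    (hb : Φ s ≤ K * b) : Φ (s / K) ≤ b :=
  (h.apply_div_le hK s).trans (ENNReal.div_le_of_le_mul' hb)

end StarShaped

theorem coe_mul_le_compl_add (Φ : ℝ≥0 → ℝ≥0∞) (r s : ℝ≥0) :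
    (r : ℝ≥0∞) * s ≤ compl Φ r + Φ s := by
  rw [← tsub_le_iff_right, ← ENNReal.coe_mul]
  exact le_iSup (fun s : ℝ≥0 => ((r * s : ℝ≥0) : ℝ≥0∞) - Φ s) s

theorem starShaped_compl (Φ : ℝ≥0 → ℝ≥0∞) : StarShaped (compl Φ) := by
  intro a ha s
  refine iSup_le fun r => ?_
  rw [tsub_le_iff_right]
  calc ((a * s * r : ℝ≥0) : ℝ≥0∞) = a * (s * r) := by push_cast; ring
    _ ≤ a * (compl Φ s + Φ r) := by gcongr; exact coe_mul_le_compl_add Φ s r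
    _ ≤ a * compl Φ s + Φ r := by
        rw [mul_add]
        gcongr
        exact mul_le_of_le_one_left' (by exact_mod_cast ha)

theorem compl_compl_le (Φ : ℝ≥0 → ℝ≥0∞) (s : ℝ≥0) : compl (compl Φ) s ≤ Φ s := by
  refine iSup_le fun r => ?_
  rw [tsub_le_iff_left, mul_comm, ENNReal.coe_mul]
  exact coe_mul_le_compl_add Φ r s

theorem compl_anti (h : ∀ s, Φ s ≤ Ψ s) (r : ℝ≥0) : compl Ψ r ≤ compl Φ r :=
  iSup_mono fun s => tsub_le_tsub_left (h s) _

theorem StarShaped.compl_le_apply (h : StarShaped Φ) {a g : ℝ≥0} (hg : (g : ℝ≥0∞) * a ≤ Φ a)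
    (ha : a ≠ 0) : compl Φ g ≤ Φ a := by
  refine iSup_le fun s => ?_
  rcases le_total s a with hs | hs
  · refine tsub_le_self.trans (le_trans ?_ hg)
    rw [ENNReal.coe_mul]
    gcongr
  · have hline : (a : ℝ≥0∞) * (g * s : ℝ≥0) ≤ a * Φ s :=
      calc (a : ℝ≥0∞) * (g * s : ℝ≥0) = s * (g * a) := by push_cast; ring
        _ ≤ s * Φ a := by gcongr
        _ ≤ a * Φ s := h.mul_apply_le hs
    rw [ENNReal.mul_le_mul_iff_right (by simpa using ha) (by simp)] at hline
    rw [tsub_eq_zero_of_le hline]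
    exact zero_le

/-! ### Generalized inverses -/

theorem genInv_le {s : ℝ≥0∞} {r : ℝ≥0} (h : s < Φ r) : genInv Φ s ≤ r :=
  iInf₂_le r h

theorem apply_le_of_lt_genInv {s : ℝ≥0∞} {r : ℝ≥0} (h : (r : ℝ≥0∞) < genInv Φ s) : Φ r ≤ s :=
  not_lt.1 fun hlt => h.not_ge (genInv_le hlt)

theorem lt_apply_of_genInv_lt (hΦ : Monotone Φ) {s : ℝ≥0∞} {r : ℝ≥0} (h : genInv Φ s < r) :
    s < Φ r := by
  simp only [genInv, iInf_lt_iff] at h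
  obtain ⟨r', hs, hr⟩ := h
  exact hs.trans_le (hΦ (by exact_mod_cast hr.le))

theorem le_genInv (hΦ : Monotone Φ) {s : ℝ≥0∞} {r : ℝ≥0} (h : Φ r ≤ s) :
    (r : ℝ≥0∞) ≤ genInv Φ s :=
  not_lt.1 fun hlt => h.not_gt (lt_apply_of_genInv_lt hΦ hlt)

theorem genInv_mono (Φ : ℝ≥0 → ℝ≥0∞) : Monotone (genInv Φ) := fun _ _ h =>
  le_iInf₂ fun _ hr => genInv_le (h.trans_lt hr)

theorem genInv_anti (h : ∀ s, Φ s ≤ Ψ s) (x : ℝ≥0∞) : genInv Ψ x ≤ genInv Φ x :=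
  le_iInf₂ fun r hr => genInv_le (hr.trans_le (h r))

theorem StarShaped.genInv_mul_le (h : StarShaped Φ) {K : ℝ≥0} (hK : 1 ≤ K) (x : ℝ≥0∞) :
    genInv Φ (K * x) ≤ K * genInv Φ x := by
  have hK0 : (K : ℝ≥0∞) ≠ 0 := by
    simpa using (zero_lt_one.trans_le hK).ne'
  rw [mul_comm (K : ℝ≥0∞) (genInv Φ x), ← ENNReal.div_le_iff hK0 (by simp)]
  refine le_iInf₂ fun r hr => ?_
  rw [ENNReal.div_le_iff hK0 (by simp), ← ENNReal.coe_mul]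
  refine genInv_le ?_
  have hdiv := h.apply_div_le hK (r * K)
  rw [mul_div_cancel_right₀ _ (by positivity)] at hdiv
  rw [mul_comm, ← ENNReal.lt_div_iff_mul_lt (Or.inl hK0) (Or.inl (by simp))]
  exact hr.trans_le hdiv

theorem IsStarYoung.genInv_ne_zero (h : IsStarYoung Φ) {x : ℝ≥0∞} (hx : x ≠ 0) :
    genInv Φ x ≠ 0 := by
  have hsmall : ∀ᶠ r in 𝓝[>] (0 : ℝ≥0), Φ r < x :=
    h.tendsto_zero.eventually (gt_mem_nhds (pos_iff_ne_zero.2 hx))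
  obtain ⟨r, hr, hr0⟩ := (hsmall.and self_mem_nhdsWithin).exists
  have hr0' : (0 : ℝ≥0∞) < r := by simpa using hr0
  exact (hr0'.trans_le (le_genInv h.starShaped.monotone hr.le)).ne'

theorem IsStarYoung.genInv_ne_top (h : IsStarYoung Φ) {x : ℝ≥0∞} (hx : x ≠ ∞) :
    genInv Φ x ≠ ∞ := by
  obtain ⟨r, hr⟩ := (h.tendsto_top.eventually (lt_mem_nhds (lt_top_iff_ne_top.2 hx))).exists
  exact ((genInv_le hr).trans_lt ENNReal.coe_lt_top).ne

end Young

/-! ### The Sobolev conjugate in terms of chord slopes -/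

/-- The slope `Φ(t)/t` of the chord from the origin; it vanishes for `t ≤ 0` when `Φ 0 = 0`. -/
def chordSlope (Φ : ℝ≥0 → ℝ≥0∞) (t : ℝ) : ℝ≥0∞ := Φ t.toNNReal / ENNReal.ofReal t

/-- `H(T)^q = ∫₀ᵀ (t / Φ(t))^(q - 1) dt`, where `H` is the function of Cianchi for which
`Φ ∘ H⁻¹` is equivalent to the conjugate `Φ_p`, `1/p + 1/q = 1`. -/
def sobolevInt (Φ : ℝ≥0 → ℝ≥0∞) (q : ℝ) (T : ℝ≥0) : ℝ≥0∞ :=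
  ∫⁻ t in Ioc (0 : ℝ) T, chordSlope Φ t ^ (1 - q)

/-- `Ψ(c H(T)) ≤ Φ(T)` with `H` as in `sobolevInt`, that is, `Φ ∘ H⁻¹` dominates `Ψ`. Stated with
`z ≤ H(T)` in place of `H(T)`, which may be infinite. -/
def SobolevDominated (q : ℝ) (c : ℝ≥0) (Φ Ψ : ℝ≥0 → ℝ≥0∞) : Prop :=
  ∀ T z : ℝ≥0, (z : ℝ≥0∞) ^ q ≤ sobolevInt Φ q T → Ψ (c * z) ≤ Φ T

section Sobolev

variable {Φ Ψ : ℝ≥0 → ℝ≥0∞} {q : ℝ}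

theorem chordSlope_mul_self (Φ : ℝ≥0 → ℝ≥0∞) {t : ℝ} (ht : 0 < t) :
    chordSlope Φ t * ENNReal.ofReal t = Φ t.toNNReal :=
  ENNReal.div_mul_cancel (by simpa using ht) (by simp)

theorem chordSlope_coe_mul_self (Φ : ℝ≥0 → ℝ≥0∞) {T : ℝ≥0} (hT : T ≠ 0) :
    chordSlope Φ T * T = Φ T := by
  simpa using chordSlope_mul_self Φ (NNReal.coe_pos.2 (pos_iff_ne_zero.2 hT))

theorem StarShaped.measurable_chordSlope (h : StarShaped Φ) : Measurable (chordSlope Φ) :=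
  (h.measurable.comp measurable_real_toNNReal).div ENNReal.measurable_ofReal

theorem StarShaped.chordSlope_mono (h : StarShaped Φ) {s t : ℝ} (hs : 0 < s) (hst : s ≤ t) :
    chordSlope Φ s ≤ chordSlope Φ t := by
  have ht : 0 < t := hs.trans_le hst
  rw [chordSlope, chordSlope, ENNReal.le_div_iff_mul_le (Or.inl (by simpa using ht))
    (Or.inl (by simp)), ← ENNReal.mul_div_right_comm, ENNReal.div_le_iff_le_mul
    (Or.inl (by simpa using hs)) (Or.inl (by simp)), mul_comm, mul_comm (Φ t.toNNReal)]
  exact h.mul_apply_le (Real.toNNReal_le_toNNReal hst)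

theorem volume_setOf_two_mul_chordSlope_lt_le (Φ : ℝ≥0 → ℝ≥0∞) {t : ℝ} (ht : 0 < t) :
    volume ({τ : ℝ | 2 * chordSlope Φ τ < ENNReal.ofReal t} ∩ Ioi 0) ≤
      2 * (compl Φ t.toNNReal / ENNReal.ofReal t) := by
  refine le_trans (measure_mono ?_) (volume_setOf_ofReal_lt _).le
  rintro τ ⟨hslope, hτ⟩
  refine ⟨?_, hτ⟩
  have hτ0 : ENNReal.ofReal τ ≠ 0 := by simpa using hτ
  have hΦ : Φ τ.toNNReal + Φ τ.toNNReal < ENNReal.ofReal t * ENNReal.ofReal τ := by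
    rw [← two_mul, ← chordSlope_mul_self Φ hτ, ← mul_assoc]
    exact ENNReal.mul_lt_mul_left hτ0 (by simp) hslope
  rw [mem_ofPred_eq, ← mul_div_assoc,
    ENNReal.lt_div_iff_mul_lt (Or.inl (by simpa using ht)) (Or.inl (by simp)), mul_comm]
  by_contra! hcompl
  have hYoung := coe_mul_le_compl_add Φ t.toNNReal τ.toNNReal
  refine lt_irrefl (ENNReal.ofReal t * ENNReal.ofReal τ + ENNReal.ofReal t * ENNReal.ofReal τ) ?_
  calc ENNReal.ofReal t * ENNReal.ofReal τ + ENNReal.ofReal t * ENNReal.ofReal τ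
      ≤ (compl Φ t.toNNReal + Φ τ.toNNReal) + (compl Φ t.toNNReal + Φ τ.toNNReal) :=
        add_le_add hYoung hYoung
    _ = 2 * compl Φ t.toNNReal + (Φ τ.toNNReal + Φ τ.toNNReal) := by ring
    _ < _ := ENNReal.add_lt_add_of_le_of_lt (hcompl.trans_lt (by finiteness)).ne hcompl hΦ

theorem StarShaped.lintegral_two_mul_chordSlope_lt_le (h : StarShaped Φ) (q : ℝ) (s : ℝ≥0) :
    ∫⁻ τ in Ioi (0 : ℝ), ∫⁻ t in {t | 2 * chordSlope Φ τ < ENNReal.ofReal t},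
      ENNReal.ofReal (t ^ (-q)) ∂volume.restrict (Ioc (0 : ℝ) s) ≤
        2 * primitiveDiv (compl Φ) q s := by
  have hm : MeasurableSet {p : ℝ × ℝ | 2 * chordSlope Φ p.1 < ENNReal.ofReal p.2} :=
    measurableSet_lt ((h.measurable_chordSlope.comp measurable_fst).const_mul 2)
      (ENNReal.measurable_ofReal.comp measurable_snd)
  rw [lintegral_setLIntegral_swap hm (by unfold Function.uncurry; fun_prop), primitiveDiv,
    ← lintegral_const_mul' _ _ (by simp)]
  refine setLIntegral_mono' measurableSet_Ioc fun t ht => ?_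
  have ht0 : 0 < t := ht.1
  have hmt : MeasurableSet {τ | 2 * chordSlope Φ τ < ENNReal.ofReal t} := measurable_prodMk_right hm
  rw [setLIntegral_const, Measure.restrict_apply hmt]
  refine (mul_le_mul_right (volume_setOf_two_mul_chordSlope_lt_le Φ ht0) _).trans_eq ?_
  rw [Real.rpow_add ht0, Real.rpow_one, ENNReal.ofReal_mul ht0.le, div_eq_mul_inv,
    div_eq_mul_inv, ENNReal.mul_inv (by simp [ht0]) (by simp), Real.rpow_neg ht0.le,
    ENNReal.ofReal_inv_of_pos (by positivity)]
  ring

theorem rpow_one_sub_le_lintegral {a : ℝ} (ha : 0 < a) (hq : 1 < q) :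
    ENNReal.ofReal a ^ (1 - q) ≤
      ENNReal.ofReal (4 ^ q / 2) * ∫⁻ t in Ioc (2 * a) (4 * a), ENNReal.ofReal (t ^ (-q)) := by
  have hlower : ENNReal.ofReal ((4 * a) ^ (-q)) * ENNReal.ofReal (2 * a) ≤
      ∫⁻ t in Ioc (2 * a) (4 * a), ENNReal.ofReal (t ^ (-q)) := by
    calc _ = ∫⁻ _ in Ioc (2 * a) (4 * a), ENNReal.ofReal ((4 * a) ^ (-q)) := by
          rw [setLIntegral_const, Real.volume_Ioc]
          ring_nf
      _ ≤ _ := by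
          refine setLIntegral_mono' measurableSet_Ioc fun t ht => ENNReal.ofReal_le_ofReal ?_
          exact Real.rpow_le_rpow_of_nonpos (by linarith [ht.1]) ht.2 (by linarith)
  calc ENNReal.ofReal a ^ (1 - q) = ENNReal.ofReal (4 ^ q / 2) *
        (ENNReal.ofReal ((4 * a) ^ (-q)) * ENNReal.ofReal (2 * a)) := by
        rw [← ENNReal.ofReal_mul (by positivity), ← ENNReal.ofReal_mul (by positivity),
          ENNReal.ofReal_rpow_of_pos ha, Real.mul_rpow (by norm_num) ha.le,
          Real.rpow_neg (by norm_num), sub_eq_add_neg, Real.rpow_add ha, Real.rpow_one]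
        congr 1
        have : (4 : ℝ) ^ q ≠ 0 := by positivity
        field_simp
    _ ≤ _ := by gcongr

theorem rpow_one_sub_le_lintegral_add {a : ℝ≥0∞} (ha : a ≠ 0) (hq : 1 < q) (s : ℝ≥0) :
    a ^ (1 - q) ≤ ENNReal.ofReal (4 ^ q / 2) *
      ∫⁻ t in {t | 2 * a < ENNReal.ofReal t}, ENNReal.ofReal (t ^ (-q))
        ∂volume.restrict (Ioc (0 : ℝ) (4 * s)) + (s : ℝ≥0∞) ^ (1 - q) := by
  rcases le_total (s : ℝ≥0∞) a with hsa | has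
  · exact le_add_left (rpow_one_sub_anti hq.le hsa)
  refine le_add_right ?_
  lift a to ℝ≥0 using (has.trans_lt ENNReal.coe_lt_top).ne
  have ha0 : (0 : ℝ) < a := by simpa [pos_iff_ne_zero] using ha
  have has' : (a : ℝ) ≤ s := by exact_mod_cast has
  have hm : MeasurableSet {t | 2 * (a : ℝ≥0∞) < ENNReal.ofReal t} :=
    measurableSet_lt measurable_const ENNReal.measurable_ofReal
  rw [Measure.restrict_restrict hm]
  refine (ENNReal.ofReal_coe_nnreal (p := a) ▸ rpow_one_sub_le_lintegral ha0 hq).trans ?_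
  gcongr
  intro t ht
  refine ⟨?_, by linarith [ht.1], by linarith [ht.2]⟩
  have h2a : 2 * (a : ℝ≥0∞) = ENNReal.ofReal (2 * a) := by
    rw [ENNReal.ofReal_mul zero_le_two, ENNReal.ofReal_coe_nnreal, ENNReal.ofReal_ofNat]
  rw [mem_ofPred_eq, h2a]
  exact (ENNReal.ofReal_lt_ofReal_iff (by linarith [ht.1])).2 ht.1

theorem StarShaped.sobolevInt_le (h : StarShaped Φ) (hpos : ∀ T, T ≠ 0 → Φ T ≠ 0) (hq : 1 < q)
    (T s : ℝ≥0) :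
    sobolevInt Φ q T ≤ ENNReal.ofReal (4 ^ q) * primitiveDiv (compl Φ) q (4 * s) +
      T * (s : ℝ≥0∞) ^ (1 - q) := by
  have hslope : ∀ τ ∈ Ioc (0 : ℝ) T, chordSlope Φ τ ≠ 0 := fun τ hτ =>
    ENNReal.div_ne_zero.2 ⟨hpos _ (Real.toNNReal_pos.2 hτ.1).ne', by simp⟩
  calc sobolevInt Φ q T
      ≤ ∫⁻ τ in Ioc (0 : ℝ) T, (ENNReal.ofReal (4 ^ q / 2) *
          ∫⁻ t in {t | 2 * chordSlope Φ τ < ENNReal.ofReal t}, ENNReal.ofReal (t ^ (-q))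
            ∂volume.restrict (Ioc (0 : ℝ) (4 * s)) + (s : ℝ≥0∞) ^ (1 - q)) :=
        setLIntegral_mono' measurableSet_Ioc fun τ hτ =>
          rpow_one_sub_le_lintegral_add (hslope τ hτ) hq s
    _ = ENNReal.ofReal (4 ^ q / 2) * (∫⁻ τ in Ioc (0 : ℝ) T,
          ∫⁻ t in {t | 2 * chordSlope Φ τ < ENNReal.ofReal t}, ENNReal.ofReal (t ^ (-q))
            ∂volume.restrict (Ioc (0 : ℝ) (4 * s))) + T * (s : ℝ≥0∞) ^ (1 - q) := by
        rw [lintegral_add_right _ measurable_const, lintegral_const_mul' _ _ (by simp),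
          setLIntegral_const, Real.volume_Ioc, sub_zero, ENNReal.ofReal_coe_nnreal,
          mul_comm (T : ℝ≥0∞)]
    _ ≤ ENNReal.ofReal (4 ^ q / 2) * (2 * primitiveDiv (compl Φ) q (4 * s)) +
          T * (s : ℝ≥0∞) ^ (1 - q) := by
        gcongr
        refine (lintegral_mono_set Ioc_subset_Ioi_self).trans ?_
        exact_mod_cast h.lintegral_two_mul_chordSlope_lt_le q (4 * s)
    _ = _ := by
        rw [← mul_assoc, ← ENNReal.ofReal_ofNat 2, ← ENNReal.ofReal_mul (by positivity),
          div_mul_cancel₀ _ two_ne_zero]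

theorem cianchiTransform_le (A : ℝ≥0 → ℝ≥0∞) (hq : 1 < q) (w : ℝ≥0) :
    cianchiTransform A q w ≤ (w * genInv (primitiveDiv A q) ((w : ℝ≥0∞) ^ q)) ^ q := by
  have hq0 : 0 ≤ q := by linarith
  calc cianchiTransform A q w ≤ ∫⁻ _ in Ioc (0 : ℝ) w, (w : ℝ≥0∞) ^ (q - 1) *
        genInv (primitiveDiv A q) ((w : ℝ≥0∞) ^ q) ^ q := by
        refine setLIntegral_mono' measurableSet_Ioc fun r hr => ?_
        have hrw : ENNReal.ofReal r ≤ w := by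
          simpa using ENNReal.ofReal_le_ofReal hr.2
        rw [← ENNReal.ofReal_rpow_of_pos hr.1, ← ENNReal.ofReal_rpow_of_pos hr.1]
        gcongr
        exact genInv_mono _ (ENNReal.rpow_le_rpow hrw hq0)
    _ = _ := by
        rw [setLIntegral_const, Real.volume_Ioc, sub_zero, ENNReal.ofReal_coe_nnreal,
          ENNReal.mul_rpow_of_nonneg _ _ hq0, mul_right_comm]
        congr 1
        nth_rewrite 2 [← ENNReal.rpow_one (w : ℝ≥0∞)]
        rw [← ENNReal.rpow_add_of_nonneg _ _ (by linarith) zero_le_one, sub_add_cancel]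

theorem ne_zero_of_primitiveDiv_compl_lt_top (hq : 1 < q)
    (hfin : primitiveDiv (compl Φ) q 1 < ∞) {T : ℝ≥0} (hT : T ≠ 0) : Φ T ≠ 0 := by
  intro hΦ
  have hcompl : ∀ t ∈ Ioc (0 : ℝ) 1, (T : ℝ≥0∞) * ENNReal.ofReal (t ^ (-q)) ≤
      compl Φ t.toNNReal / ENNReal.ofReal (t ^ (1 + q)) := by
    intro t ht
    have ht0 : 0 < t := ht.1
    have hYoung := coe_mul_le_compl_add Φ t.toNNReal T
    rw [hΦ, add_zero] at hYoung
    rwa [ENNReal.le_div_iff_mul_le (Or.inl (by simpa using by positivity)) (Or.inl (by simp)),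
      mul_assoc, ← ENNReal.ofReal_mul (by positivity), ← Real.rpow_add ht0, mul_comm,
      show -q + (1 + q) = 1 by ring, Real.rpow_one]
  have hlt : ∫⁻ t in Ioc (0 : ℝ) 1, ENNReal.ofReal (t ^ (-q)) < ∞ := by
    refine ENNReal.lt_top_of_mul_ne_top_right (a := (T : ℝ≥0∞)) ?_ (by simpa using hT)
    rw [← lintegral_const_mul' _ _ (by simp)]
    refine ((setLIntegral_mono' measurableSet_Ioc hcompl).trans_lt ?_).ne
    simpa [primitiveDiv] using hfin
  have hint : IntegrableOn (fun t : ℝ => t ^ (-q)) (Ioc 0 1) := by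
    refine ⟨by fun_prop, ?_⟩
    rwa [hasFiniteIntegral_iff_ofReal]
    filter_upwards [ae_restrict_mem measurableSet_Ioc] with t ht
    exact Real.rpow_nonneg ht.1.le _
  have := (intervalIntegral.integrableOn_Ioo_rpow_iff one_pos).1
    (hint.mono_set Ioo_subset_Ioc_self)
  linarith

theorem StarShaped.mul_rpow_chordSlope_le_sobolevInt (h : StarShaped Φ) (hq : 1 ≤ q) (T : ℝ≥0) :
    T * chordSlope Φ T ^ (1 - q) ≤ sobolevInt Φ q T := by
  calc T * chordSlope Φ T ^ (1 - q) = ∫⁻ _ in Ioc (0 : ℝ) T, chordSlope Φ T ^ (1 - q) := by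
        simp [mul_comm]
    _ ≤ _ := setLIntegral_mono' measurableSet_Ioc fun t ht =>
        rpow_one_sub_anti hq (h.chordSlope_mono ht.1 ht.2)

theorem StarShaped.sobolevInt_ne_top (h : StarShaped Φ) (hq : 1 < q)
    (hfin : primitiveDiv (compl Φ) q 1 < ∞) (T : ℝ≥0) : sobolevInt Φ q T ≠ ∞ := by
  have hle := h.sobolevInt_le (fun _ => ne_zero_of_primitiveDiv_compl_lt_top hq hfin) hq T 4⁻¹
  rw [mul_inv_cancel₀ four_ne_zero] at hle
  refine (hle.trans_lt (ENNReal.add_lt_top.2 ⟨ENNReal.mul_lt_top (by simp) hfin, ?_⟩)).ne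
  exact ENNReal.mul_lt_top (by simp)
    (lt_top_iff_ne_top.2 (ENNReal.rpow_ne_top_of_ne_zero (by simp) (by simp)))

theorem StarShaped.rpow_lt_primitiveDiv_compl (h : StarShaped Φ) (hq : 1 < q)
    (hfin : primitiveDiv (compl Φ) q 1 < ∞) {T s w : ℝ≥0} (hw0 : w ≠ 0)
    (hw : 4 * 4 ^ q * (w : ℝ≥0∞) ^ q ≤ sobolevInt Φ q T)
    (hs : 2 * T ≤ (s : ℝ≥0∞) ^ (q - 1) * sobolevInt Φ q T) :
    (w : ℝ≥0∞) ^ q < primitiveDiv (compl Φ) q (4 * s) := by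
  set L := sobolevInt Φ q T with hLdef
  have hs0 : (s : ℝ≥0∞) ≠ 0 := by
    intro hs0
    have hT : T = 0 := by
      simpa [hs0, ENNReal.zero_rpow_of_pos (by linarith : 0 < q - 1)] using hs
    simp [hLdef, hT, sobolevInt, hw0] at hw
  have hle : 4 * (4 ^ q * (w : ℝ≥0∞) ^ q) ≤ 2 * (4 ^ q * primitiveDiv (compl Φ) q (4 * s)) := by
    rw [← mul_assoc]
    refine hw.trans ?_
    have hT : 2 * (T * (s : ℝ≥0∞) ^ (1 - q)) ≤ L := by
      calc 2 * (T * (s : ℝ≥0∞) ^ (1 - q)) = 2 * T * (s : ℝ≥0∞) ^ (1 - q) := by ring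
        _ ≤ (s : ℝ≥0∞) ^ (q - 1) * L * (s : ℝ≥0∞) ^ (1 - q) := by gcongr
        _ = L := by
          rw [mul_right_comm, ← ENNReal.rpow_add _ _ hs0 (by simp), sub_add_sub_cancel, sub_self,
            ENNReal.rpow_zero, one_mul]
    have hL := h.sobolevInt_le (fun _ => ne_zero_of_primitiveDiv_compl_lt_top hq hfin) hq T s
    rw [← ENNReal.ofReal_rpow_of_pos four_pos, ENNReal.ofReal_ofNat] at hL
    rw [← ENNReal.add_le_add_iff_right (h.sobolevInt_ne_top hq hfin T), ← two_mul]
    calc 2 * L ≤ 2 * (4 ^ q * primitiveDiv (compl Φ) q (4 * s) + T * (s : ℝ≥0∞) ^ (1 - q)) := by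
          gcongr
      _ ≤ _ := by rw [mul_add]; gcongr
  by_contra! hcon
  have hne : (4 : ℝ≥0∞) ^ q * (w : ℝ≥0∞) ^ q ≠ 0 := mul_ne_zero (by simp) (by simp [hw0])
  have h42 : (4 : ℝ≥0∞) * (4 ^ q * (w : ℝ≥0∞) ^ q) ≤ 2 * (4 ^ q * (w : ℝ≥0∞) ^ q) :=
    hle.trans (by gcongr)
  rw [ENNReal.mul_le_mul_iff_left hne (by finiteness)] at h42
  norm_num at h42

theorem StarShaped.mul_le_of_rpow_mul_sobolevInt_le (h : StarShaped Φ) (hq : 1 < q) {T s : ℝ≥0}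
    (hT : Φ T ≠ 0) (hs : (s : ℝ≥0∞) ^ (q - 1) * sobolevInt Φ q T ≤ 2 * T) :
    (T * s : ℝ≥0∞) ≤ 2 ^ (1 / (q - 1)) * Φ T := by
  have hq1 : 0 < q - 1 := by linarith
  have hT0 : T ≠ 0 := fun h0 => hT (h0 ▸ h.map_zero)
  have hT0' : (T : ℝ≥0∞) ≠ 0 := by simpa using hT0
  rw [← chordSlope_coe_mul_self Φ hT0, mul_comm (T : ℝ≥0∞), ← mul_assoc]
  gcongr
  set b := chordSlope Φ T
  rcases eq_or_ne b ∞ with htop | htop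
  · simp [htop]
  have hb0 : b ≠ 0 := by
    intro hb
    rw [← chordSlope_coe_mul_self Φ hT0] at hT
    exact hT (by rw [show chordSlope Φ T = 0 from hb, zero_mul])
  rw [← ENNReal.rpow_le_rpow_iff hq1, ENNReal.mul_rpow_of_nonneg _ _ hq1.le,
    ← ENNReal.rpow_mul, one_div_mul_cancel hq1.ne', ENNReal.rpow_one,
    ← ENNReal.mul_le_mul_iff_right hT0' (by simp)]
  calc (T : ℝ≥0∞) * (s : ℝ≥0∞) ^ (q - 1)
      = (s : ℝ≥0∞) ^ (q - 1) * (T * b ^ (1 - q)) * b ^ (q - 1) := by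
        rw [mul_assoc, mul_assoc, ← ENNReal.rpow_add _ _ hb0 htop, sub_add_sub_cancel, sub_self,
          ENNReal.rpow_zero, mul_one, mul_comm]
    _ ≤ 2 * T * b ^ (q - 1) := by
        refine mul_le_mul_left (le_trans ?_ hs) _
        gcongr
        exact h.mul_rpow_chordSlope_le_sobolevInt hq.le T
    _ = _ := by ring

theorem StarShaped.cianchiTransform_compl_le (h : StarShaped Φ) (hq : 1 < q)
    (hfin : primitiveDiv (compl Φ) q 1 < ∞) {T w : ℝ≥0}
    (hw : 4 * 4 ^ q * (w : ℝ≥0∞) ^ q ≤ sobolevInt Φ q T) :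
    cianchiTransform (compl Φ) q w ≤ 2 ^ (1 / (q - 1)) * Φ T := by
  have hq1 : 0 < q - 1 := by linarith
  have hq0 : 0 ≤ q := by linarith
  rcases eq_or_ne w 0 with rfl | hw0
  · simp [cianchiTransform]
  set L := sobolevInt Φ q T with hLdef
  have hLtop : L ≠ ∞ := h.sobolevInt_ne_top hq hfin T
  have hL0 : L ≠ 0 :=
    ((pos_iff_ne_zero.2 (mul_ne_zero (by simp) (by simp [hw0]))).trans_le hw).ne'
  have hT : T ≠ 0 := by
    rintro rfl
    simp [hLdef, sobolevInt] at hL0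
  obtain ⟨s, hs⟩ := exists_coe_rpow_eq hq1 (x := 2 * T / L)
    (ENNReal.div_ne_top (by finiteness) hL0)
  have hsL : (s : ℝ≥0∞) ^ (q - 1) * L = 2 * T := by rw [hs, ENNReal.div_mul_cancel hL0 hLtop]
  calc cianchiTransform (compl Φ) q w ≤ (w * (4 * s : ℝ≥0)) ^ q := by
        refine (cianchiTransform_le _ hq w).trans ?_
        gcongr
        exact genInv_le (h.rpow_lt_primitiveDiv_compl hq hfin hw0 hw hsL.ge)
    _ = 4 ^ q * (w : ℝ≥0∞) ^ q * ((s : ℝ≥0∞) ^ (q - 1) * s) := by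
        have hsq : (s : ℝ≥0∞) ^ q = (s : ℝ≥0∞) ^ (q - 1) * s := by
          simpa using ENNReal.rpow_add_of_nonneg (x := (s : ℝ≥0∞)) _ _ hq1.le zero_le_one
        rw [← hsq, ENNReal.coe_mul, ENNReal.mul_rpow_of_nonneg _ _ hq0,
          ENNReal.mul_rpow_of_nonneg _ _ hq0, ENNReal.coe_ofNat]
        ring
    _ ≤ L / 4 * ((s : ℝ≥0∞) ^ (q - 1) * s) := by
        gcongr
        rw [ENNReal.le_div_iff_mul_le (by simp) (by simp), mul_comm, ← mul_assoc]
        exact hw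
    _ = 2 * T * s / 4 := by
        rw [← hsL]
        simp only [div_eq_mul_inv]
        ring
    _ ≤ T * s := by
        refine ENNReal.div_le_of_le_mul' ?_
        rw [mul_assoc]
        gcongr
        norm_num
    _ ≤ _ := h.mul_le_of_rpow_mul_sobolevInt_le hq
        (ne_zero_of_primitiveDiv_compl_lt_top hq hfin hT) hsL.le

theorem StarShaped.exists_sobolevDominated (hΦ : StarShaped Φ) (hΨ : StarShaped Ψ) (hq : 1 < q)
    (hfin : primitiveDiv (compl Φ) q 1 < ∞)
    (hdom : Dominates (cianchiTransform (compl Φ) q) Ψ) :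
    ∃ c : ℝ≥0, 0 < c ∧ SobolevDominated q c Φ Ψ := by
  obtain ⟨c₀, hc₀, hdom⟩ := hdom
  have hq0 : 0 < q := by linarith
  set c₁ : ℝ≥0 := (4 * 4 ^ q) ^ (-(1 / q)) with hc₁
  have hc₁0 : 0 < c₁ := by positivity
  have hc₁q : 4 * 4 ^ q * c₁ ^ q = 1 := by
    rw [hc₁, ← NNReal.rpow_mul, neg_mul, one_div_mul_cancel hq0.ne', NNReal.rpow_neg_one,
      mul_inv_cancel₀ (by positivity)]
  set K : ℝ≥0 := 2 ^ (1 / (q - 1)) with hK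
  have hK1 : 1 ≤ K := NNReal.one_le_rpow one_le_two (one_div_nonneg.2 (by linarith))
  refine ⟨c₁ / c₀ / K, by positivity, fun T z hz => ?_⟩
  have hw : 4 * 4 ^ q * ((c₁ * z : ℝ≥0) : ℝ≥0∞) ^ q ≤ sobolevInt Φ q T := by
    refine le_trans (le_of_eq ?_) hz
    rw [ENNReal.coe_mul, ENNReal.mul_rpow_of_nonneg _ _ hq0.le, ← mul_assoc,
      ← ENNReal.coe_rpow_of_nonneg c₁ hq0.le]
    rw [show (4 : ℝ≥0∞) * 4 ^ q = ((4 * 4 ^ q : ℝ≥0) : ℝ≥0∞) by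
      rw [ENNReal.coe_mul, ENNReal.coe_rpow_of_nonneg _ hq0.le, ENNReal.coe_ofNat],
      ← ENNReal.coe_mul, hc₁q, ENNReal.coe_one, one_mul]
  have hΨK : Ψ (c₁ * z / c₀) ≤ K * Φ T := by
    refine (hdom _).trans ?_
    rw [mul_div_cancel₀ _ hc₀.ne', hK, ENNReal.coe_rpow_of_nonneg _
      (one_div_nonneg.2 (by linarith))]
    exact hΦ.cianchiTransform_compl_le hq hfin hw
  convert hΨ.apply_div_le_of_le_mul hK1 hΨK using 2
  field_simp

theorem primitiveDiv_mono (h : ∀ s, Φ s ≤ Ψ s) (q : ℝ) (s : ℝ≥0) :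
    primitiveDiv Φ q s ≤ primitiveDiv Ψ q s :=
  lintegral_mono fun _ => ENNReal.div_le_div_right (h _) _

theorem cianchiTransform_anti (h : ∀ s, Φ s ≤ Ψ s) (hq : 0 ≤ q) (s : ℝ≥0) :
    cianchiTransform Ψ q s ≤ cianchiTransform Φ q s :=
  lintegral_mono fun _ => mul_le_mul_right
    (ENNReal.rpow_le_rpow (genInv_anti (primitiveDiv_mono h q) _) hq) _

theorem Dominates.compl (h : Dominates Φ Ψ) : Dominates (compl Ψ) (compl Φ) := by
  obtain ⟨c, hc, h⟩ := h
  refine ⟨c, hc, fun s => iSup_le fun r => le_trans ?_ (le_iSup _ (r / c))⟩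
  have hr := h (r / c)
  rw [mul_div_cancel₀ _ hc.ne'] at hr
  refine tsub_le_tsub (ENNReal.coe_le_coe.2 (le_of_eq ?_)) hr
  field_simp

theorem exists_sobolevDominated_compl (hq : 1 < q) (hfin : primitiveDiv Ψ q 1 < ∞)
    (hdom : Dominates Φ (compl (cianchiTransform Ψ q))) :
    ∃ c : ℝ≥0, 0 < c ∧ SobolevDominated q c (compl Ψ) (compl Φ) := by
  refine (starShaped_compl Ψ).exists_sobolevDominated (starShaped_compl Φ) hq
    ((primitiveDiv_mono (compl_compl_le Ψ) q 1).trans_lt hfin) ?_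
  obtain ⟨c, hc, h⟩ := hdom.compl
  exact ⟨c, hc, fun s => (h s).trans <| (compl_compl_le _ _).trans <|
    cianchiTransform_anti (compl_compl_le Ψ) (by linarith) _⟩

end Sobolev

/-! ### Distribution functions -/

section Distribution

variable {X : Type*} [MeasurableSpace X] {μ : Measure X} {F G : X → ℝ≥0} {Φ Ψ : ℝ≥0 → ℝ≥0∞}
  {p q θ : ℝ} {c : ℝ≥0} {v : ℝ≥0∞}

/-- The distribution function `t ↦ μ {F > t}`. -/
def distrib (μ : Measure X) (F : X → ℝ≥0) (t : ℝ) : ℝ≥0∞ := μ {x | t < F x}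

/-- `∫ μ{F > t}^θ dt` over the `t > 0` with `μ{F > t} ≥ v`: the contribution of the levels below the
decreasing rearrangement `F*(v)`. -/
def upperPart (μ : Measure X) (θ : ℝ) (F : X → ℝ≥0) (v : ℝ≥0∞) : ℝ≥0∞ :=
  ∫⁻ t in {t | v ≤ distrib μ F t} ∩ Ioi 0, distrib μ F t ^ θ

/-- `∫ μ{F > t} dt` over the `t > 0` with `μ{F > t} < v`: the contribution of the levels above the
decreasing rearrangement `F*(v)`. -/
def lowerPart (μ : Measure X) (F : X → ℝ≥0) (v : ℝ≥0∞) : ℝ≥0∞ :=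
  ∫⁻ t in {t | distrib μ F t < v} ∩ Ioi 0, distrib μ F t

theorem distrib_anti (μ : Measure X) (F : X → ℝ≥0) : Antitone (distrib μ F) :=
  fun _ _ h => measure_mono fun _ hx => lt_of_le_of_lt h hx

theorem measurable_distrib (μ : Measure X) (F : X → ℝ≥0) : Measurable (distrib μ F) :=
  (distrib_anti μ F).measurable

theorem upperPart_anti (μ : Measure X) (θ : ℝ) (F : X → ℝ≥0) : Antitone (upperPart μ θ F) :=
  fun _ _ h => lintegral_mono_set fun _ ht => ⟨h.trans ht.1, ht.2⟩

theorem lintegral_setLIntegral_lt_mul [SFinite μ] (hF : Measurable F) {W : X → ℝ≥0∞}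
    (hW : Measurable W) {H : ℝ → ℝ≥0∞} (hH : Measurable H) :
    ∫⁻ t in Ioi (0 : ℝ), (∫⁻ x in {x | t < F x}, W x ∂μ) * H t =
      ∫⁻ x, W x * (∫⁻ t in Ioo (0 : ℝ) (F x), H t) ∂μ := by
  have hm : MeasurableSet {p : ℝ × X | p.1 < F p.2} :=
    measurableSet_lt measurable_fst (by fun_prop)
  have hIoo (x : X) : volume.restrict (Ioo (0 : ℝ) (F x)) =
      (volume.restrict (Ioi (0 : ℝ))).restrict {t | t < F x} := by
    have hx : MeasurableSet {t : ℝ | t < F x} := measurableSet_Iio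
    rw [Measure.restrict_restrict hx, inter_comm]
    rfl
  simp_rw [hIoo, ← lintegral_mul_const _ hW, ← lintegral_const_mul _ hH]
  exact lintegral_setLIntegral_swap hm (by fun_prop)

theorem lintegral_distrib_mul [SFinite μ] (hF : Measurable F) {H : ℝ → ℝ≥0∞} (hH : Measurable H) :
    ∫⁻ t in Ioi (0 : ℝ), distrib μ F t * H t = ∫⁻ x, (∫⁻ t in Ioo (0 : ℝ) (F x), H t) ∂μ := by
  simpa [distrib] using lintegral_setLIntegral_lt_mul (μ := μ) hF (W := fun _ => 1)
    measurable_const hH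

theorem lintegral_distrib [SFinite μ] (hF : Measurable F) :
    ∫⁻ t in Ioi (0 : ℝ), distrib μ F t = ∫⁻ x, F x ∂μ := by
  simpa using lintegral_distrib_mul (μ := μ) hF (H := fun _ => 1) measurable_const

theorem lintegral_eq_lintegral_measure_ofReal_lt [SFinite μ] {f : X → ℝ≥0∞} (hf : Measurable f) :
    ∫⁻ x, f x ∂μ = ∫⁻ t in Ioi (0 : ℝ), μ {x | ENNReal.ofReal t < f x} := by
  have hm : MeasurableSet {p : ℝ × X | ENNReal.ofReal p.1 < f p.2} :=
    measurableSet_lt (by fun_prop) (by fun_prop)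
  have hswap := lintegral_setLIntegral_swap (μ := volume.restrict (Ioi (0 : ℝ))) (ν := μ)
    (R := fun t x => ENNReal.ofReal t < f x) hm (f := fun _ _ => 1) measurable_const
  simp only [lintegral_const, Measure.restrict_apply_univ, one_mul] at hswap
  rw [hswap]
  refine lintegral_congr fun x => ?_
  have hmx : MeasurableSet {t : ℝ | ENNReal.ofReal t < f x} := measurable_prodMk_right hm
  rw [Measure.restrict_apply hmx, volume_setOf_ofReal_lt]

theorem lintegral_le_of_measure_lt_le [SFinite μ] {f g : X → ℝ≥0∞} (hf : Measurable f)
    (hg : Measurable g)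
    (h : ∀ t : ℝ, 0 < t → μ {x | ENNReal.ofReal t < f x} ≤ μ {x | ENNReal.ofReal t < g x}) :
    ∫⁻ x, f x ∂μ ≤ ∫⁻ x, g x ∂μ := by
  rw [lintegral_eq_lintegral_measure_ofReal_lt hf, lintegral_eq_lintegral_measure_ofReal_lt hg]
  exact setLIntegral_mono' measurableSet_Ioi h

theorem lintegral_rpow_mul_lowerPart_le (μ : Measure X) (θ : ℝ) (F G : X → ℝ≥0) :
    ∫⁻ s in Ioi (0 : ℝ), distrib μ G s ^ θ * lowerPart μ F (distrib μ G s) ≤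
      ∫⁻ t in Ioi (0 : ℝ), distrib μ F t * upperPart μ θ G (distrib μ F t) := by
  have hdF := measurable_distrib μ F
  have hdG := measurable_distrib μ G
  have hm : MeasurableSet {p : ℝ × ℝ | distrib μ F p.2 < distrib μ G p.1} :=
    measurableSet_lt (by fun_prop) (by fun_prop)
  have hswap := lintegral_setLIntegral_swap (μ := volume.restrict (Ioi (0 : ℝ)))
    (ν := volume.restrict (Ioi (0 : ℝ))) (R := fun s t => distrib μ F t < distrib μ G s) hm
    (f := fun s t => distrib μ G s ^ θ * distrib μ F t) (by fun_prop)
  have hlower (s : ℝ) : distrib μ G s ^ θ * lowerPart μ F (distrib μ G s) =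
      ∫⁻ t in {t | distrib μ F t < distrib μ G s}, distrib μ G s ^ θ * distrib μ F t
        ∂volume.restrict (Ioi (0 : ℝ)) := by
    have hms : MeasurableSet {t | distrib μ F t < distrib μ G s} := measurable_prodMk_left hm
    rw [lintegral_const_mul _ hdF, Measure.restrict_restrict hms, lowerPart]
  simp_rw [hlower]
  rw [hswap]
  refine lintegral_mono fun t => ?_
  have hmt : MeasurableSet {s | distrib μ F t < distrib μ G s} := measurable_prodMk_right hm
  rw [lintegral_mul_const _ (hdG.pow_const θ), mul_comm, Measure.restrict_restrict hmt]
  gcongr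
  exact lintegral_mono_set fun s hs => ⟨le_of_lt (α := ℝ≥0∞) hs.1, hs.2⟩

theorem setLIntegral_le_of_forall_Ioc {S : Set ℝ} (hS0 : S ⊆ Ioi 0)
    (hS : ∀ t ∈ S, Ioc 0 t ⊆ S) {H : ℝ → ℝ≥0∞} {b : ℝ≥0∞}
    (hb : ∀ t ∈ S, ∫⁻ u in Ioc 0 t, H u ≤ b) : ∫⁻ u in S, H u ≤ b := by
  by_cases hmax : ∃ t ∈ S, ∀ u ∈ S, u ≤ t
  · obtain ⟨t, ht, h⟩ := hmax
    exact (lintegral_mono_set (show S ⊆ Ioc 0 t from fun u hu => ⟨hS0 hu, h u hu⟩)).trans (hb t ht)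
  push Not at hmax
  have hcover : S ⊆ ⋃ r : {r : ℚ // (r : ℝ) ∈ S}, Ioc (0 : ℝ) (r : ℚ) := by
    intro t ht
    obtain ⟨u, hu, htu⟩ := hmax t ht
    obtain ⟨r, htr, hru⟩ := exists_rat_btwn htu
    have ht0 : 0 < t := hS0 ht
    exact mem_iUnion.2 ⟨⟨r, hS u hu ⟨ht0.trans htr, hru.le⟩⟩, ht0, htr.le⟩
  have hdir : Monotone fun r : {r : ℚ // (r : ℝ) ∈ S} => Ioc (0 : ℝ) (r : ℚ) :=
    fun r r' h => Ioc_subset_Ioc_right (by exact_mod_cast h)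
  refine (lintegral_mono_set hcover).trans ?_
  rw [setLIntegral_iUnion_of_directed _ hdir.directed_le]
  exact iSup_le fun r => hb _ r.2

theorem upperPart_le {b : ℝ≥0∞}
    (h : ∀ T : ℝ≥0, v ≤ distrib μ F T → ∫⁻ t in Ioc (0 : ℝ) T, distrib μ F t ^ θ ≤ b) :
    upperPart μ θ F v ≤ b := by
  refine setLIntegral_le_of_forall_Ioc inter_subset_right
    (fun t ht u hu => ⟨ht.1.trans (distrib_anti μ F hu.2), hu.1⟩) fun t ht => ?_
  exact h ⟨t, le_of_lt ht.2⟩ ht.1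

/-! ### Distribution functions of functions with modular at most one -/

theorem StarShaped.lintegral_distrib_mul_chordSlope_le [SFinite μ] (h : StarShaped Φ)
    (hF : Measurable F) :
    ∫⁻ t in Ioi (0 : ℝ), distrib μ F t * chordSlope Φ t ≤ ∫⁻ x, Φ (F x) ∂μ := by
  rw [lintegral_distrib_mul hF h.measurable_chordSlope]
  refine lintegral_mono fun x => ?_
  calc ∫⁻ t in Ioo (0 : ℝ) (F x), chordSlope Φ t
      ≤ ∫⁻ _ in Ioo (0 : ℝ) (F x), chordSlope Φ (F x) :=
        setLIntegral_mono' measurableSet_Ioo fun t ht => h.chordSlope_mono ht.1 ht.2.le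
    _ = chordSlope Φ (F x) * F x := by simp
    _ ≤ Φ (F x) := by
        rcases eq_or_ne (F x) 0 with h0 | h0
        · simp [h0]
        · rw [chordSlope_coe_mul_self Φ h0]

theorem StarShaped.chordSlope_ne_zero (h : StarShaped Φ) (hq : 1 < q) {T : ℝ≥0}
    (hT : sobolevInt Φ q T ≠ ∞) {t : ℝ≥0} (ht : t ≠ 0) (htT : t ≤ T) : chordSlope Φ t ≠ 0 := by
  intro hzero
  have hle := h.mul_rpow_chordSlope_le_sobolevInt hq.le t
  rw [hzero, ENNReal.zero_rpow_of_neg (by linarith),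
    ENNReal.mul_top (ENNReal.coe_ne_zero.2 ht)] at hle
  exact hT (top_le_iff.1 (hle.trans (lintegral_mono_set (Ioc_subset_Ioc_right htT))))

-- Hölder's inequality for `(distrib * chordSlope)^(1/p) * chordSlope^(-1/p)`.
theorem StarShaped.rpow_lintegral_distrib_le [SFinite μ] (h : StarShaped Φ) (hF : Measurable F)
    (hF1 : ∫⁻ x, Φ (F x) ∂μ ≤ 1) (hpq : p.HolderConjugate q) {T : ℝ≥0} (hT : Φ T ≠ ∞) :
    (∫⁻ t in Ioc (0 : ℝ) T, distrib μ F t ^ (1 / p)) ^ q ≤ sobolevInt Φ q T := by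
  have hp := hpq.pos
  rcases eq_or_ne (sobolevInt Φ q T) ∞ with htop | hfin
  · exact htop ▸ le_top
  have hfactor : ∀ t ∈ Ioc (0 : ℝ) T, distrib μ F t ^ (1 / p) =
      ((fun t => (distrib μ F t * chordSlope Φ t) ^ (1 / p)) *
        fun t => chordSlope Φ t ^ (-(1 / p))) t := by
    intro t ht
    lift t to ℝ≥0 using ht.1.le
    have ht0 : t ≠ 0 := (NNReal.coe_pos.1 ht.1).ne'
    have hne_top : chordSlope Φ t ≠ ∞ :=
      ENNReal.div_ne_top (ne_top_of_le_ne_top hT (h.monotone (by simpa using ht.2)))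
        (by simpa using ht0)
    rw [Pi.mul_apply, ENNReal.mul_rpow_of_nonneg _ _ (by positivity), mul_assoc,
      ← ENNReal.rpow_add _ _ (h.chordSlope_ne_zero hpq.symm.lt hfin ht0 ht.2) hne_top]
    simp
  have hexp : -(1 / p) * q = 1 - q := by
    rw [neg_mul, one_div_mul_eq_div, hpq.symm.div_conj_eq_sub_one, neg_sub]
  have hmodular :
      ∫⁻ t in Ioc (0 : ℝ) T, ((distrib μ F t * chordSlope Φ t) ^ (1 / p)) ^ p ≤ 1 := by
    simp_rw [← ENNReal.rpow_mul, one_div_mul_cancel hp.ne', ENNReal.rpow_one]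
    exact (lintegral_mono_set Ioc_subset_Ioi_self).trans
      ((h.lintegral_distrib_mul_chordSlope_le hF).trans hF1)
  rw [← ENNReal.le_rpow_inv_iff hpq.symm.pos, ← one_div]
  calc ∫⁻ t in Ioc (0 : ℝ) T, distrib μ F t ^ (1 / p)
      ≤ (∫⁻ t in Ioc (0 : ℝ) T, ((distrib μ F t * chordSlope Φ t) ^ (1 / p)) ^ p) ^ (1 / p) *
          (∫⁻ t in Ioc (0 : ℝ) T, (chordSlope Φ t ^ (-(1 / p))) ^ q) ^ (1 / q) := by
        rw [setLIntegral_congr_fun measurableSet_Ioc hfactor]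
        exact ENNReal.lintegral_mul_le_Lp_mul_Lq _ hpq
          (((measurable_distrib μ F).mul h.measurable_chordSlope).pow_const _).aemeasurable
          (h.measurable_chordSlope.pow_const _).aemeasurable
    _ ≤ 1 * sobolevInt Φ q T ^ (1 / q) := by
        gcongr
        · exact ENNReal.rpow_le_one hmodular (by positivity)
        · exact one_div_nonneg.2 hpq.symm.nonneg
        · refine (lintegral_congr fun t => ?_).le
          rw [← ENNReal.rpow_mul, hexp]
    _ = sobolevInt Φ q T ^ (1 / q) := one_mul _

theorem SobolevDominated.apply_le [SFinite μ] (hd : SobolevDominated q c Φ Ψ)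
    (hpq : p.HolderConjugate q) (hΦ : StarShaped Φ) (hF : Measurable F)
    (hF1 : ∫⁻ x, Φ (F x) ∂μ ≤ 1) {T z : ℝ≥0}
    (hz : (z : ℝ≥0∞) ≤ ∫⁻ t in Ioc (0 : ℝ) T, distrib μ F t ^ (1 / p)) : Ψ (c * z) ≤ Φ T := by
  rcases eq_or_ne (Φ T) ∞ with h | h
  · exact h ▸ le_top
  · exact hd T z ((ENNReal.rpow_le_rpow hz hpq.symm.nonneg).trans
      (hΦ.rpow_lintegral_distrib_le hF hF1 hpq h))

theorem SobolevDominated.mul_apply_le_one_of_lt_upperPart [SFinite μ]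
    (hd : SobolevDominated q c Φ Ψ) (hpq : p.HolderConjugate q) (hΦ : StarShaped Φ)
    (hF : Measurable F) (hF1 : ∫⁻ x, Φ (F x) ∂μ ≤ 1) {z : ℝ≥0}
    (hz : (z : ℝ≥0∞) < upperPart μ (1 / p) F v) : v * Ψ (c * z) ≤ 1 := by
  obtain ⟨T, hv, hlt⟩ : ∃ T : ℝ≥0, v ≤ distrib μ F T ∧
      (z : ℝ≥0∞) < ∫⁻ t in Ioc (0 : ℝ) T, distrib μ F t ^ (1 / p) := by
    by_contra! hcon
    exact (upperPart_le hcon).not_gt hz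
  calc v * Ψ (c * z) ≤ distrib μ F T * Φ T := by
        gcongr
        exact hd.apply_le hpq hΦ hF hF1 hlt.le
    _ ≤ μ {x | Φ T ≤ Φ (F x)} * Φ T := by
        gcongr
        exact measure_mono fun x hx => hΦ.monotone (NNReal.coe_lt_coe.1 hx).le
    _ ≤ ∫⁻ x, Φ (F x) ∂μ := by
        rw [mul_comm]
        exact mul_meas_ge_le_lintegral (hΦ.measurable.comp hF) _
    _ ≤ 1 := hF1

/-- The supremum of `Φ(T)` over the `T` with `μ{G > s} ≤ μ{F > T}` for some `0 < s < r`: the value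
at level `r` of the rearrangement of `Φ ∘ F` along the level sets of `G`. -/
def comparisonSup (μ : Measure X) (Φ : ℝ≥0 → ℝ≥0∞) (F G : X → ℝ≥0) (r : ℝ≥0) : ℝ≥0∞ :=
  ⨆ (s : ℝ) (T : ℝ≥0) (_ : 0 < s ∧ s < r ∧ distrib μ G s ≤ distrib μ F T), Φ T

theorem comparisonSup_mono (μ : Measure X) (Φ : ℝ≥0 → ℝ≥0∞) (F G : X → ℝ≥0) :
    Monotone (comparisonSup μ Φ F G) := fun _ _ h =>
  iSup₂_mono fun _ _ => iSup_mono' fun hs =>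
    ⟨⟨hs.1, hs.2.1.trans_le (by exact_mod_cast h), hs.2.2⟩, le_rfl⟩

theorem exists_rat_of_lt_comparisonSup {b : ℝ≥0∞} {r : ℝ≥0} (h : b < comparisonSup μ Φ F G r) :
    ∃ s : ℚ, (s : ℝ) < r ∧ ∃ T : ℝ≥0, distrib μ G s ≤ distrib μ F T ∧ b < Φ T := by
  simp only [comparisonSup, lt_iSup_iff] at h
  obtain ⟨s, T, ⟨-, hsr, hd⟩, hb⟩ := h
  obtain ⟨s', hs, hs'⟩ := exists_rat_btwn hsr
  exact ⟨s', hs', T, (distrib_anti μ G hs.le).trans hd, hb⟩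

theorem StarShaped.lintegral_comparisonSup_le [SFinite μ] (hΦ : StarShaped Φ) (hF : Measurable F)
    (hG : Measurable G) : ∫⁻ y, comparisonSup μ Φ F G (G y) ∂μ ≤ ∫⁻ x, Φ (F x) ∂μ := by
  refine lintegral_le_of_measure_lt_le ((comparisonSup_mono μ Φ F G).measurable.comp hG)
    (hΦ.measurable.comp hF) fun τ _ => ?_
  let S : Set ℚ := {s | ∃ T : ℝ≥0, distrib μ G s ≤ distrib μ F T ∧ ENNReal.ofReal τ < Φ T}
  have hcover : {y | ENNReal.ofReal τ < comparisonSup μ Φ F G (G y)} ⊆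
      ⋃ s : S, {y | ((s : ℚ) : ℝ) < G y} := fun y hy =>
    let ⟨s, hs, hS⟩ := exists_rat_of_lt_comparisonSup hy
    mem_iUnion.2 ⟨⟨s, hS⟩, hs⟩
  have hdir : Antitone fun s : S => {y | ((s : ℚ) : ℝ) < G y} :=
    fun s s' h y hy => lt_of_le_of_lt (b := ((s' : ℚ) : ℝ)) (by exact_mod_cast h) hy
  refine (measure_mono hcover).trans ?_
  rw [hdir.directed_le.measure_iUnion]
  refine iSup_le fun s => ?_
  obtain ⟨T, hd, hlt⟩ := s.2
  refine hd.trans (measure_mono fun x hx => ?_)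
  exact hlt.trans_le (hΦ.monotone (NNReal.coe_lt_coe.1 hx).le)

theorem SobolevDominated.mul_upperPart_le [SFinite μ] (hd : SobolevDominated q c Φ Ψ)
    (hpq : p.HolderConjugate q) (hΦ : StarShaped Φ) (hF : Measurable F)
    (hF1 : ∫⁻ x, Φ (F x) ∂μ ≤ 1) (G : X → ℝ≥0) {r : ℝ≥0} {s : ℝ} (hs : s ∈ Ioo (0 : ℝ) r) :
    c * upperPart μ (1 / p) F (distrib μ G s) * r ≤ compl Ψ r + comparisonSup μ Φ F G r := by
  rcases eq_or_ne c 0 with rfl | hc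
  · simp
  have hr : r ≠ 0 := fun h0 => by simp [h0] at hs
  rw [mul_right_comm, mul_comm]
  refine ENNReal.mul_le_of_le_div (upperPart_le fun T hT =>
    ENNReal.le_of_forall_nnreal_lt fun z hz => ?_)
  rw [ENNReal.le_div_iff_mul_le (.inl (by simp [hc, hr])) (.inl (by finiteness))]
  calc (z : ℝ≥0∞) * (c * r) = r * (c * z : ℝ≥0) := by push_cast; ring
    _ ≤ compl Ψ r + Ψ (c * z) := coe_mul_le_compl_add _ _ _
    _ ≤ compl Ψ r + comparisonSup μ Φ F G r := by
        gcongr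
        exact (hd.apply_le hpq hΦ hF hF1 hz.le).trans
          (le_iSup₂_of_le s T (le_iSup_of_le ⟨hs.1, hs.2, hT⟩ le_rfl))

theorem SobolevDominated.mul_lintegral_distrib_mul_upperPart_le [SFinite μ]
    (hd : SobolevDominated q c Φ Ψ) (hpq : p.HolderConjugate q) (hΦ : StarShaped Φ)
    (hF : Measurable F) (hG : Measurable G) (hF1 : ∫⁻ x, Φ (F x) ∂μ ≤ 1) :
    c * ∫⁻ s in Ioi (0 : ℝ), distrib μ G s * upperPart μ (1 / p) F (distrib μ G s) ≤
      ∫⁻ y, compl Ψ (G y) ∂μ + ∫⁻ x, Φ (F x) ∂μ := by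
  have hmono : Monotone fun s => upperPart μ (1 / p) F (distrib μ G s) :=
    (upperPart_anti μ _ F).comp (distrib_anti μ G)
  have hlayer (y : X) : c * (∫⁻ s in Ioo (0 : ℝ) (G y), upperPart μ (1 / p) F (distrib μ G s)) ≤
      compl Ψ (G y) + comparisonSup μ Φ F G (G y) := by
    rcases eq_or_ne (G y) 0 with h0 | h0
    · simp [h0]
    rw [← lintegral_const_mul' _ _ (by simp)]
    calc ∫⁻ s in Ioo (0 : ℝ) (G y), c * upperPart μ (1 / p) F (distrib μ G s)
        ≤ ∫⁻ _ in Ioo (0 : ℝ) (G y), (compl Ψ (G y) + comparisonSup μ Φ F G (G y)) / G y :=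
          setLIntegral_mono' measurableSet_Ioo fun s hs =>
            (ENNReal.le_div_iff_mul_le (.inl (by simpa using h0)) (.inl (by simp))).2
              (hd.mul_upperPart_le hpq hΦ hF hF1 G hs)
      _ = compl Ψ (G y) + comparisonSup μ Φ F G (G y) := by
          simp [ENNReal.div_mul_cancel, h0]
  rw [lintegral_distrib_mul hG hmono.measurable, ← lintegral_const_mul' _ _ (by simp)]
  calc ∫⁻ y, c * (∫⁻ s in Ioo (0 : ℝ) (G y), upperPart μ (1 / p) F (distrib μ G s)) ∂μ
      ≤ ∫⁻ y, (compl Ψ (G y) + comparisonSup μ Φ F G (G y)) ∂μ := lintegral_mono hlayer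
    _ = ∫⁻ y, compl Ψ (G y) ∂μ + ∫⁻ y, comparisonSup μ Φ F G (G y) ∂μ :=
        lintegral_add_left ((starShaped_compl Ψ).measurable.comp hG) _
    _ ≤ _ := add_le_add_right (hΦ.lintegral_comparisonSup_le hF hG) _

theorem StarShaped.coe_le_mul_chordSlope (h : StarShaped Φ) {a b : ℝ≥0} (hb : (b : ℝ≥0∞) ≤ Φ a)
    (ha : a ≠ 0) {t : ℝ} (hat : a ≤ t) : (b : ℝ≥0∞) ≤ a * chordSlope Φ t :=
  calc (b : ℝ≥0∞) ≤ Φ a := hb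
    _ = a * chordSlope Φ a := by rw [mul_comm, chordSlope_coe_mul_self Φ ha]
    _ ≤ a * chordSlope Φ t := by
        gcongr
        exact h.chordSlope_mono (NNReal.coe_pos.2 (pos_iff_ne_zero.2 ha)) hat

theorem StarShaped.setLIntegral_Ioi_distrib_le [SFinite μ] (h : StarShaped Φ) (hF : Measurable F)
    (hF1 : ∫⁻ x, Φ (F x) ∂μ ≤ 1) {a v : ℝ≥0} (hv : v ≠ 0) (ha : (v : ℝ≥0∞)⁻¹ ≤ Φ a) :
    ∫⁻ t in Ioi (a : ℝ), distrib μ F t ≤ a * v := by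
  have ha0 : a ≠ 0 := by
    rintro rfl
    simp [h.map_zero] at ha
  have hslope : ∀ t ∈ Ioi (a : ℝ), 1 ≤ a * v * chordSlope Φ t := by
    intro t ht
    have hinv : ((v⁻¹ : ℝ≥0) : ℝ≥0∞) ≤ a * chordSlope Φ t :=
      h.coe_le_mul_chordSlope (by rwa [ENNReal.coe_inv hv]) ha0 (le_of_lt ht)
    calc (1 : ℝ≥0∞) = v * (v⁻¹ : ℝ≥0) := by
          rw [← ENNReal.coe_mul, mul_inv_cancel₀ hv, ENNReal.coe_one]
      _ ≤ v * (a * chordSlope Φ t) := by gcongr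
      _ = a * v * chordSlope Φ t := by ring
  calc ∫⁻ t in Ioi (a : ℝ), distrib μ F t
      ≤ ∫⁻ t in Ioi (a : ℝ), a * v * (distrib μ F t * chordSlope Φ t) :=
        setLIntegral_mono' measurableSet_Ioi fun t ht => by
          rw [mul_left_comm]
          exact le_mul_of_one_le_right' (hslope t ht)
    _ = a * v * ∫⁻ t in Ioi (a : ℝ), distrib μ F t * chordSlope Φ t :=
        lintegral_const_mul' _ _ (by finiteness)
    _ ≤ a * v * 1 := by
        gcongr
        exact (lintegral_mono_set (Ioi_subset_Ioi a.2)).trans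
          ((h.lintegral_distrib_mul_chordSlope_le hF).trans hF1)
    _ = a * v := mul_one _

theorem StarShaped.lintegral_min_distrib_le [SFinite μ] (h : StarShaped Φ) (hF : Measurable F)
    (hF1 : ∫⁻ x, Φ (F x) ∂μ ≤ 1) {v : ℝ≥0} (hv : v ≠ 0) :
    ∫⁻ t in Ioi (0 : ℝ), min (v : ℝ≥0∞) (distrib μ F t) ≤ 2 * v * genInv Φ (v : ℝ≥0∞)⁻¹ := by
  have h2v : 2 * (v : ℝ≥0∞) ≠ 0 := by simp [hv]
  have h2v' : 2 * (v : ℝ≥0∞) ≠ ∞ := by finiteness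
  rw [mul_comm, ← ENNReal.div_le_iff h2v h2v']
  refine le_of_forall_coe_gt fun a ha => ?_
  rw [ENNReal.div_le_iff h2v h2v']
  have hΦa := (lt_apply_of_genInv_lt h.monotone ha).le
  calc ∫⁻ t in Ioi (0 : ℝ), min (v : ℝ≥0∞) (distrib μ F t)
      ≤ (∫⁻ t in Ioc (0 : ℝ) a, min (v : ℝ≥0∞) (distrib μ F t)) +
        ∫⁻ t in Ioi (a : ℝ), min (v : ℝ≥0∞) (distrib μ F t) := by
        rw [← Ioc_union_Ioi_eq_Ioi (show (0 : ℝ) ≤ a from a.2)]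
        exact lintegral_union_le _ _ _
    _ ≤ (∫⁻ _ in Ioc (0 : ℝ) a, (v : ℝ≥0∞)) + ∫⁻ t in Ioi (a : ℝ), distrib μ F t := by
        gcongr
        · exact min_le_left _ _
        · exact min_le_right _ _
    _ ≤ a * v + a * v := by
        gcongr
        · simp [mul_comm]
        · exact h.setLIntegral_Ioi_distrib_le hF hF1 hv hΦa
    _ = a * (2 * v) := by ring

theorem StarShaped.lowerPart_le [SFinite μ] (h : StarShaped Φ) (hF : Measurable F)
    (hF1 : ∫⁻ x, Φ (F x) ∂μ ≤ 1) {v : ℝ≥0} (hv : v ≠ 0) :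
    lowerPart μ F v ≤ 2 * v * genInv Φ (v : ℝ≥0∞)⁻¹ := by
  have hm : MeasurableSet ({t : ℝ | distrib μ F t < v} ∩ Ioi 0) :=
    (measurableSet_lt (measurable_distrib μ F) measurable_const).inter measurableSet_Ioi
  refine le_trans ?_ (h.lintegral_min_distrib_le hF hF1 hv)
  exact (setLIntegral_mono' hm fun t ht => le_min ht.1.le le_rfl).trans
    (lintegral_mono_set inter_subset_right)

theorem StarShaped.setLIntegral_le [SFinite μ] (h : StarShaped Φ) (hF : Measurable F) {B : Set X}
    (hB : MeasurableSet B) (hF1 : ∫⁻ x, Φ (B.indicator F x) ∂μ ≤ 1) {v : ℝ≥0} (hv : v ≠ 0)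
    (hBv : μ B ≤ v) : ∫⁻ x in B, F x ∂μ ≤ 2 * v * genInv Φ (v : ℝ≥0∞)⁻¹ := by
  refine le_trans (le_of_eq ?_) (h.lintegral_min_distrib_le (hF.indicator hB) hF1 hv)
  calc ∫⁻ x in B, F x ∂μ = ∫⁻ x, (B.indicator F x : ℝ≥0) ∂μ := by
        rw [← lintegral_indicator hB]
        refine lintegral_congr fun x => ?_
        by_cases hx : x ∈ B <;> simp [hx]
    _ = ∫⁻ t in Ioi (0 : ℝ), distrib μ (B.indicator F) t :=
        (lintegral_distrib (hF.indicator hB)).symm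
    _ = ∫⁻ t in Ioi (0 : ℝ), min (v : ℝ≥0∞) (distrib μ (B.indicator F) t) := by
        refine setLIntegral_congr_fun measurableSet_Ioi fun t ht => (min_eq_right ?_).symm
        refine (measure_mono fun x hx => ?_).trans hBv
        by_contra hxB
        rw [mem_ofPred_eq, indicator_of_notMem hxB] at hx
        exact hx.not_ge (le_of_lt ht)

theorem coe_rpow_le_mul_chordSlope (hpq : p.HolderConjugate q) {v a : ℝ≥0}
    (ha : Φ a ≤ (v : ℝ≥0∞)⁻¹) :
    ((v ^ (1 / p) * a : ℝ≥0) : ℝ≥0∞) ^ q ≤ a * chordSlope Φ a ^ (1 - q) := by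
  rcases eq_or_ne a 0 with rfl | _
  · simp [hpq.symm.pos]
  have hslope : chordSlope Φ a ≤ ((v * a : ℝ≥0) : ℝ≥0∞)⁻¹ := by
    rw [chordSlope, Real.toNNReal_coe, ENNReal.ofReal_coe_nnreal, ENNReal.coe_mul,
      ENNReal.mul_inv (by simp) (by simp), div_eq_mul_inv]
    gcongr
  have hexp : 1 / p * q = q - 1 := by
    rw [one_div_mul_eq_div, hpq.symm.div_conj_eq_sub_one]
  calc ((v ^ (1 / p) * a : ℝ≥0) : ℝ≥0∞) ^ q = a * ((v * a : ℝ≥0) : ℝ≥0∞) ^ (q - 1) := by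
        rw [← ENNReal.coe_rpow_of_nonneg _ hpq.symm.nonneg,
          ← ENNReal.coe_rpow_of_nonneg _ hpq.symm.sub_one_pos.le, ← ENNReal.coe_mul,
          NNReal.mul_rpow, ← NNReal.rpow_mul, hexp, NNReal.mul_rpow, mul_left_comm,
          ← NNReal.rpow_one_add' (by linarith [hpq.symm.pos]), add_sub_cancel]
    _ = a * (((v * a : ℝ≥0) : ℝ≥0∞)⁻¹) ^ (1 - q) := by
        rw [← neg_sub q 1, ENNReal.inv_rpow, ENNReal.rpow_neg, inv_inv]
    _ ≤ a * chordSlope Φ a ^ (1 - q) := by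
        exact mul_le_mul_right (rpow_one_sub_anti hpq.symm.lt.le hslope) _

theorem SobolevDominated.mul_apply_le_one (hd : SobolevDominated q c Φ Ψ)
    (hpq : p.HolderConjugate q) (hΦ : StarShaped Φ) {v a : ℝ≥0}
    (ha : (a : ℝ≥0∞) < genInv Φ (v : ℝ≥0∞)⁻¹) : v * Ψ (c * (v ^ (1 / p) * a)) ≤ 1 := by
  have hΦa := apply_le_of_lt_genInv ha
  have hH := (coe_rpow_le_mul_chordSlope hpq hΦa).trans
    (hΦ.mul_rpow_chordSlope_le_sobolevInt hpq.symm.lt.le a)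
  calc v * Ψ (c * (v ^ (1 / p) * a)) ≤ v * (v : ℝ≥0∞)⁻¹ := by
        gcongr
        exact (hd a _ hH).trans hΦa
    _ ≤ 1 := ENNReal.mul_inv_le_one _

theorem SobolevDominated.genInv_le (hd : SobolevDominated q c Φ Ψ) (hpq : p.HolderConjugate q)
    (hΦ : StarShaped Φ) (hΨ : Monotone Ψ) (v : ℝ≥0) :
    (c * v ^ (1 / p) : ℝ≥0) * genInv Φ (v : ℝ≥0∞)⁻¹ ≤ genInv Ψ (v : ℝ≥0∞)⁻¹ := by
  refine ENNReal.mul_le_of_forall_lt fun k hk a ha => ?_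
  lift a to ℝ≥0 using ha.ne_top
  calc k * a ≤ ((c * (v ^ (1 / p) * a) : ℝ≥0) : ℝ≥0∞) := by
        rw [← mul_assoc, ENNReal.coe_mul _ a]
        gcongr
    _ ≤ genInv Ψ (v : ℝ≥0∞)⁻¹ := le_genInv hΨ <|
        (ENNReal.le_inv_iff_mul_le).2 (mul_comm (v : ℝ≥0∞) _ ▸ hd.mul_apply_le_one hpq hΦ ha)

end Distribution

/-! ### The Riesz potential of a nonnegative function -/

section Potential

variable {n : ℕ} {α : ℝ}

/-- The kernel `|x|^(α - n)` of the Riesz potential. At `x = 0` the real inverse gives the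
value `0` instead of `∞`, which does not affect integrals. -/
def rieszKernel (α : ℝ) (x : EuclideanSpace ℝ (Fin n)) : ℝ≥0∞ :=
  ENNReal.ofReal ((‖x‖ ^ ((n : ℝ) - α))⁻¹)

/-- The Riesz potential of a nonnegative function, with values in `[0,∞]`. -/
def potential (α : ℝ) (F : EuclideanSpace ℝ (Fin n) → ℝ≥0) (x : EuclideanSpace ℝ (Fin n)) :
    ℝ≥0∞ :=
  ∫⁻ y, rieszKernel α (x - y) * F y

@[fun_prop]
theorem measurable_rieszKernel (α : ℝ) : Measurable (rieszKernel (n := n) α) := by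
  unfold rieszKernel
  fun_prop

theorem rieszKernel_sub_comm (α : ℝ) (x y : EuclideanSpace ℝ (Fin n)) :
    rieszKernel α (x - y) = rieszKernel α (y - x) := by
  simp only [rieszKernel, norm_sub_rev]

theorem rieszKernel_smul (α : ℝ) {ρ : ℝ} (hρ : 0 ≤ ρ) (x : EuclideanSpace ℝ (Fin n)) :
    rieszKernel α (ρ • x) = ENNReal.ofReal ((ρ ^ ((n : ℝ) - α))⁻¹) * rieszKernel α x := by
  rw [rieszKernel, rieszKernel, ← ENNReal.ofReal_mul (by positivity), norm_smul,
    Real.norm_of_nonneg hρ, Real.mul_rpow hρ (norm_nonneg _), mul_inv]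

theorem rieszKernel_le_of_le_norm (hαn : α ≤ n) {ρ : ℝ} (hρ : 0 < ρ)
    {x : EuclideanSpace ℝ (Fin n)} (hx : ρ ≤ ‖x‖) :
    rieszKernel α x ≤ ENNReal.ofReal ((ρ ^ ((n : ℝ) - α))⁻¹) :=
  ENNReal.ofReal_le_ofReal <| inv_anti₀ (by positivity) <|
    Real.rpow_le_rpow hρ.le hx (sub_nonneg.2 hαn)

theorem measurable_potential (α : ℝ) {F : EuclideanSpace ℝ (Fin n) → ℝ≥0} (hF : Measurable F) :
    Measurable (potential α F) := by
  refine Measurable.lintegral_prod_right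
    (f := fun x y : EuclideanSpace ℝ (Fin n) => rieszKernel α (x - y) * (F y : ℝ≥0∞)) ?_
  fun_prop

theorem lintegral_ball_rieszKernel (α : ℝ) {ρ : ℝ} (hρ : 0 < ρ) :
    ∫⁻ x in Metric.ball (0 : EuclideanSpace ℝ (Fin n)) ρ, rieszKernel α x =
      ENNReal.ofReal (ρ ^ α) *
        ∫⁻ x in Metric.ball (0 : EuclideanSpace ℝ (Fin n)) 1, rieszKernel α x := by
  have hpre : (ρ • ·) ⁻¹' Metric.ball (0 : EuclideanSpace ℝ (Fin n)) ρ = Metric.ball 0 1 := by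
    ext x
    simp only [mem_preimage, mem_ball_zero_iff, norm_smul, Real.norm_of_nonneg hρ.le]
    exact mul_lt_iff_lt_one_right hρ
  have hscale : ENNReal.ofReal ((ρ ^ n)⁻¹) *
        ∫⁻ x in Metric.ball (0 : EuclideanSpace ℝ (Fin n)) ρ, rieszKernel α x =
      ENNReal.ofReal ((ρ ^ ((n : ℝ) - α))⁻¹) *
        ∫⁻ x in Metric.ball (0 : EuclideanSpace ℝ (Fin n)) 1, rieszKernel α x := by
    have h := setLIntegral_map (μ := (volume : Measure (EuclideanSpace ℝ (Fin n))))
      (measurableSet_ball (x := 0) (ε := ρ)) (measurable_rieszKernel α) (measurable_const_smul ρ)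
    simp_rw [hpre, rieszKernel_smul α hρ.le] at h
    rw [lintegral_const_mul _ (measurable_rieszKernel α), Measure.map_addHaar_smul _ hρ.ne',
      Measure.restrict_smul, lintegral_smul_measure, finrank_euclideanSpace_fin,
      abs_of_pos (by positivity), smul_eq_mul] at h
    exact h
  have hcancel : ENNReal.ofReal (ρ ^ n) * ENNReal.ofReal ((ρ ^ n)⁻¹) = 1 := by
    rw [← ENNReal.ofReal_mul (by positivity), mul_inv_cancel₀ (by positivity), ENNReal.ofReal_one]
  rw [← one_mul (∫⁻ x in Metric.ball _ ρ, _), ← hcancel, mul_assoc, hscale, ← mul_assoc,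
    ← ENNReal.ofReal_mul (by positivity), Real.rpow_sub hρ, Real.rpow_natCast]
  congr 2
  field_simp

theorem lintegral_ball_sub_rieszKernel (α : ℝ) (y : EuclideanSpace ℝ (Fin n)) {ρ : ℝ}
    (hρ : 0 < ρ) :
    ∫⁻ x in Metric.ball y ρ, rieszKernel α (x - y) = ENNReal.ofReal (ρ ^ α) *
      ∫⁻ x in Metric.ball (0 : EuclideanSpace ℝ (Fin n)) 1, rieszKernel α x := by
  rw [← lintegral_ball_rieszKernel α hρ, ← lintegral_indicator measurableSet_ball,
    ← lintegral_indicator measurableSet_ball,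
    ← lintegral_sub_right_eq_self ((Metric.ball 0 ρ).indicator (rieszKernel α)) y]
  refine lintegral_congr fun x => ?_
  simp only [indicator, Metric.mem_ball, dist_eq_norm, sub_zero]

theorem lintegral_unitBall_rieszKernel_lt_top (hα : 0 < α) (hn : n ≠ 0) :
    ∫⁻ x in Metric.ball (0 : EuclideanSpace ℝ (Fin n)) 1, rieszKernel α x < ∞ := by
  have h : IntegrableOn (fun x : EuclideanSpace ℝ (Fin n) => (‖x‖ ^ ((n : ℝ) - α))⁻¹)
      (Metric.ball 0 1) := by
    refine integrableOn_ball_of_norm_le_rpow (C := 1) (α := n - α) (r := 1)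
      (by simpa using Nat.one_le_iff_ne_zero.2 hn) (by simp [hα])
      (Eventually.of_forall fun x => ?_) (Measurable.aestronglyMeasurable (by fun_prop))
    rw [Real.norm_of_nonneg (by positivity), Real.rpow_neg (norm_nonneg _), one_mul]
  exact (hasFiniteIntegral_iff_ofReal (Eventually.of_forall fun x => by positivity)).1 h.2

theorem setLIntegral_rieszKernel_le (hαn : α ≤ n) {ρ : ℝ} (hρ : 0 < ρ)
    (S : Set (EuclideanSpace ℝ (Fin n))) (y : EuclideanSpace ℝ (Fin n)) :
    ∫⁻ x in S, rieszKernel α (x - y) ≤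
      ENNReal.ofReal (ρ ^ α) *
        (∫⁻ x in Metric.ball (0 : EuclideanSpace ℝ (Fin n)) 1, rieszKernel α x) +
      ENNReal.ofReal ((ρ ^ ((n : ℝ) - α))⁻¹) * volume S := by
  calc ∫⁻ x in S, rieszKernel α (x - y)
      ≤ ∫⁻ x in S, ((Metric.ball y ρ).indicator (fun x => rieszKernel α (x - y)) x +
        ENNReal.ofReal ((ρ ^ ((n : ℝ) - α))⁻¹)) := by
        refine lintegral_mono fun x => ?_
        by_cases h : x ∈ Metric.ball y ρ
        · rw [indicator_of_mem h]
          exact le_add_right le_rfl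
        · refine le_add_left (rieszKernel_le_of_le_norm hαn hρ ?_)
          simpa only [Metric.mem_ball, dist_eq_norm, not_lt] using h
    _ = (∫⁻ x in S, (Metric.ball y ρ).indicator (fun x => rieszKernel α (x - y)) x) +
        ENNReal.ofReal ((ρ ^ ((n : ℝ) - α))⁻¹) * volume S := by
        rw [lintegral_add_right _ measurable_const, setLIntegral_const]
    _ ≤ _ := by
        gcongr
        rw [← lintegral_ball_sub_rieszKernel α y hρ, ← lintegral_indicator measurableSet_ball]
        exact setLIntegral_le_lintegral _ _

/-- Choosing `ρ = |S|^(1/n)` in `setLIntegral_rieszKernel_le` balances its two terms. -/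
theorem exists_setLIntegral_rieszKernel_le (hα : 0 < α) (hαn : α < n) :
    ∃ C : ℝ≥0, 0 < C ∧ ∀ (S : Set (EuclideanSpace ℝ (Fin n))) (y : EuclideanSpace ℝ (Fin n)),
      ∫⁻ x in S, rieszKernel α (x - y) ≤ C * volume S ^ (α / n) := by
  have hn : (0 : ℝ) < n := hα.trans hαn
  obtain ⟨C₁, hC₁⟩ := WithTop.ne_top_iff_exists.1
    (lintegral_unitBall_rieszKernel_lt_top hα (Nat.cast_pos.1 hn).ne').ne
  replace hC₁ : (C₁ : ℝ≥0∞) = _ := hC₁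
  refine ⟨C₁ + 1, by positivity, fun S y => ?_⟩
  rcases eq_or_ne (volume S) 0 with h0 | h0
  · rw [Measure.restrict_eq_zero.2 h0, lintegral_zero_measure]
    exact zero_le
  rcases eq_or_ne (volume S) ∞ with ht | ht
  · rw [ht, ENNReal.top_rpow_of_pos (by positivity), ENNReal.mul_top (by simp)]
    exact le_top
  set v := (volume S).toReal
  have hv0 : 0 < v := ENNReal.toReal_pos h0 ht
  have hSv : volume S = ENNReal.ofReal v := (ENNReal.ofReal_toReal ht).symm
  set ρ := v ^ (1 / (n : ℝ)) with hρ
  have hρ0 : 0 < ρ := by positivity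
  have hρα : ρ ^ α = v ^ (α / n) := by
    rw [hρ, ← Real.rpow_mul hv0.le, one_div_mul_eq_div]
  have hρn : (ρ ^ ((n : ℝ) - α))⁻¹ * v = v ^ (α / n) := by
    rw [Real.rpow_sub hρ0, hρα, hρ, ← Real.rpow_mul hv0.le, one_div_mul_cancel hn.ne',
      Real.rpow_one]
    field_simp
  refine (setLIntegral_rieszKernel_le hαn.le hρ0 S y).trans_eq ?_
  rw [← hC₁, hρα, hSv, ← ENNReal.ofReal_mul (by positivity), hρn, ENNReal.ofReal_rpow_of_pos hv0,
    ENNReal.coe_add, ENNReal.coe_one]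
  ring

theorem setLIntegral_potential_eq (α : ℝ) {F : EuclideanSpace ℝ (Fin n) → ℝ≥0}
    (hF : Measurable F) (S : Set (EuclideanSpace ℝ (Fin n))) :
    ∫⁻ x in S, potential α F x =
      ∫⁻ t in Ioi (0 : ℝ), ∫⁻ y in {y | t < F y}, ∫⁻ x in S, rieszKernel α (x - y) := by
  have hW : Measurable fun y => ∫⁻ x in S, rieszKernel α (x - y) := by
    refine Measurable.lintegral_prod_left
      (f := fun x y : EuclideanSpace ℝ (Fin n) => rieszKernel α (x - y)) ?_
    fun_prop
  have hlayer := lintegral_setLIntegral_lt_mul (μ := volume) hF hW (H := fun _ => 1)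
    measurable_const
  simp only [mul_one, setLIntegral_const, Real.volume_Ioo, sub_zero, one_mul,
    ENNReal.ofReal_coe_nnreal] at hlayer
  rw [hlayer]
  simp only [potential]
  rw [lintegral_lintegral_swap (Measurable.aemeasurable (by fun_prop))]
  exact lintegral_congr fun y => lintegral_mul_const _ (by fun_prop)

section

variable {C : ℝ≥0} (hC : ∀ (S : Set (EuclideanSpace ℝ (Fin n))) (y : EuclideanSpace ℝ (Fin n)),
  ∫⁻ x in S, rieszKernel α (x - y) ≤ C * volume S ^ (α / n))
include hC

theorem setLIntegral_setLIntegral_rieszKernel_le (S T : Set (EuclideanSpace ℝ (Fin n))) :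
    ∫⁻ y in T, ∫⁻ x in S, rieszKernel α (x - y) ≤ C * (volume S ^ (α / n) * volume T) := by
  refine (lintegral_mono fun y => hC S y).trans_eq ?_
  rw [setLIntegral_const, mul_assoc]

theorem setLIntegral_setLIntegral_rieszKernel_le' (S T : Set (EuclideanSpace ℝ (Fin n))) :
    ∫⁻ y in T, ∫⁻ x in S, rieszKernel α (x - y) ≤ C * (volume S * volume T ^ (α / n)) := by
  rw [lintegral_lintegral_swap (Measurable.aemeasurable (by fun_prop)), mul_comm (volume S)]
  refine le_trans (lintegral_mono fun x => lintegral_mono fun y => ?_)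
    (setLIntegral_setLIntegral_rieszKernel_le hC T S)
  exact (rieszKernel_sub_comm α x y).le

theorem setLIntegral_potential_le {F : EuclideanSpace ℝ (Fin n) → ℝ≥0} (hF : Measurable F)
    (S : Set (EuclideanSpace ℝ (Fin n))) :
    ∫⁻ x in S, potential α F x ≤ C * (volume S * upperPart volume (α / n) F (volume S) +
      volume S ^ (α / n) * lowerPart volume F (volume S)) := by
  have hd := measurable_distrib volume F
  have hset : Ioi (0 : ℝ) = {t | volume S ≤ distrib volume F t} ∩ Ioi 0 ∪
      {t | distrib volume F t < volume S} ∩ Ioi 0 := by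
    rw [← union_inter_distrib_right]
    ext t
    simp [le_or_gt]
  rw [setLIntegral_potential_eq α hF, hset]
  refine (lintegral_union_le _ _ _).trans ?_
  rw [mul_add]
  refine add_le_add ?_ ?_
  · refine (lintegral_mono fun t => setLIntegral_setLIntegral_rieszKernel_le' hC S _).trans_eq ?_
    rw [lintegral_const_mul' _ _ ENNReal.coe_ne_top, upperPart,
      ← lintegral_const_mul (volume S) (hd.pow_const (α / n))]
    rfl
  · refine (lintegral_mono fun t => setLIntegral_setLIntegral_rieszKernel_le hC S _).trans_eq ?_
    rw [lintegral_const_mul' _ _ ENNReal.coe_ne_top, lowerPart,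
      ← lintegral_const_mul _ hd]
    rfl

theorem setLIntegral_potential_le_mul_lintegral {F : EuclideanSpace ℝ (Fin n) → ℝ≥0}
    (hF : Measurable F) (S : Set (EuclideanSpace ℝ (Fin n))) :
    ∫⁻ x in S, potential α F x ≤ C * volume S ^ (α / n) * ∫⁻ y, F y := by
  rw [setLIntegral_potential_eq α hF, ← lintegral_distrib hF,
    ← lintegral_const_mul _ (measurable_distrib volume F)]
  refine lintegral_mono fun t => (setLIntegral_setLIntegral_rieszKernel_le hC S _).trans_eq ?_
  rw [← mul_assoc]
  rfl

end

end Potential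

/-! ### Modular estimates for the Riesz potential -/

section Modular

variable {X : Type*} [MeasurableSpace X] {μ : Measure X} {Φ Ψ : ℝ≥0 → ℝ≥0∞}

theorem ae_lt_top_of_forall_mul_measure_le (hΨ : Tendsto Ψ atTop (𝓝 ∞)) {K : ℝ≥0}
    {u : X → ℝ≥0∞} (h : ∀ t : ℝ≥0, Ψ t * μ {x | ((K * t : ℝ≥0) : ℝ≥0∞) < u x} ≤ 1) :
    ∀ᵐ x ∂μ, u x < ∞ := by
  rw [ae_iff]
  by_contra h0
  have hbound (t : ℝ≥0) : Ψ t ≤ 1 / μ {x | ¬ u x < ∞} := by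
    rw [ENNReal.le_div_iff_mul_le (Or.inl h0) (Or.inr ENNReal.one_ne_top)]
    refine le_trans (mul_le_mul_right (measure_mono fun x hx => ?_) _) (h t)
    exact ENNReal.coe_lt_top.trans_le (not_lt.1 hx)
  have htop : ∞ ≤ 1 / μ {x | ¬ u x < ∞} := le_of_tendsto' hΨ hbound
  exact htop.not_gt (ENNReal.div_lt_top ENNReal.one_ne_top h0)

theorem StarShaped.min_mul (h : StarShaped Ψ) (k : ℝ≥0) :
    StarShaped fun s => min (Ψ s) (k * s) := by
  intro a ha s
  rw [_root_.mul_min]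
  refine min_le_min (h a ha s) (le_of_eq ?_)
  push_cast
  ring

/-- The test function `Ψ(w) / w`, normalized by the modular of `w`, is the one for which Young's
inequality is an equality. -/
theorem StarShaped.lintegral_apply_le_one (h : StarShaped Ψ) {w : X → ℝ≥0} (hw : Measurable w)
    (hfin : ∀ x, Ψ (w x) ≠ ∞) (hI : ∫⁻ x, Ψ (w x) ∂μ ≠ ∞)
    (hdual : ∀ G : X → ℝ≥0, Measurable G → ∫⁻ x, compl Ψ (G x) ∂μ ≤ 1 →
      ∫⁻ x, (w x : ℝ≥0∞) * G x ∂μ < 1) : ∫⁻ x, Ψ (w x) ∂μ ≤ 1 := by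
  by_contra! hI1
  lift ∫⁻ x, Ψ (w x) ∂μ to ℝ≥0 using hI with I hIeq
  have hI0 : I ≠ 0 := by rintro rfl; simp at hI1
  have hI0' : (I : ℝ≥0∞) ≠ 0 := by simpa using hI0
  have hdiv : ∫⁻ x, Ψ (w x) / I ∂μ = 1 := by
    simp only [div_eq_mul_inv]
    rw [lintegral_mul_const' _ _ (by simpa using hI0'), ← hIeq,
      ENNReal.mul_inv_cancel hI0' ENNReal.coe_ne_top]
  set g : X → ℝ≥0 := fun x => (Ψ (w x) / w x).toNNReal with hg
  have hgm : Measurable g := ((h.measurable.comp hw).div (by fun_prop)).ennreal_toNNReal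
  have hgw (x : X) : (g x : ℝ≥0∞) * w x = Ψ (w x) := by
    rcases eq_or_ne (w x) 0 with h0 | h0
    · simp [h0, h.map_zero]
    have h0' : (w x : ℝ≥0∞) ≠ 0 := by simpa using h0
    rw [hg, ENNReal.coe_toNNReal (ENNReal.div_ne_top (hfin x) h0'),
      ENNReal.div_mul_cancel h0' ENNReal.coe_ne_top]
  have hcompl (x : X) : compl Ψ (g x) ≤ Ψ (w x) := by
    rcases eq_or_ne (w x) 0 with h0 | h0
    · simp [hg, h0, h.map_zero, (starShaped_compl Ψ).map_zero]
    · exact h.compl_le_apply (hgw x).le h0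
  refine (hdual (fun x => g x / I) (by fun_prop) ?_).ne ?_
  · refine le_trans (lintegral_mono fun x => ?_) hdiv.le
    refine ((starShaped_compl Ψ).apply_div_le (by exact_mod_cast hI1.le) _).trans ?_
    exact ENNReal.div_le_div_right (hcompl x) _
  · refine Eq.trans (lintegral_congr fun x => ?_) hdiv
    rw [ENNReal.coe_div hI0, ← mul_div_assoc, mul_comm, hgw]

theorem StarShaped.tendsto_min_mul (h : StarShaped Ψ) {a : ℝ≥0} {b : ℕ → ℝ≥0}
    (hb : ∀ᶠ N in atTop, b N = a) :
    Tendsto (fun N : ℕ => min (Ψ (b N)) ((N : ℝ≥0) * b N)) atTop (𝓝 (Ψ a)) := by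
  refine Tendsto.congr' (f₁ := fun N : ℕ => min (Ψ a) ((N : ℝ≥0) * a))
    (hb.mono fun N hN => by simp only [hN]) ?_
  rcases eq_or_ne a 0 with rfl | ha
  · simp [h.map_zero]
  have hmul : Tendsto (fun N : ℕ => ((N : ℝ≥0) : ℝ≥0∞) * a) atTop (𝓝 ∞) := by
    have := ENNReal.Tendsto.mul_const (b := (a : ℝ≥0∞))
      ENNReal.tendsto_nat_nhds_top (Or.inl ENNReal.top_ne_zero)
    rw [ENNReal.top_mul (by exact_mod_cast ha)] at this
    exact this
  simpa using (tendsto_const_nhds (x := Ψ a)).min hmul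

/-- The truncations of a function in height and support that exhaust it, each of them bounded and
supported in a set of finite measure. -/
def truncation (μ : Measure X) [SigmaFinite μ] (w : X → ℝ≥0) (N : ℕ) : X → ℝ≥0 :=
  (spanningSets μ N).indicator fun x => min (w x) N

section Truncation

variable [SigmaFinite μ] {w : X → ℝ≥0}

theorem measurable_truncation (hw : Measurable w) (N : ℕ) : Measurable (truncation μ w N) :=
  Measurable.indicator (by fun_prop) (measurableSet_spanningSets μ N)

theorem truncation_le (w : X → ℝ≥0) (N : ℕ) (x : X) : truncation μ w N x ≤ w x :=
  (indicator_le_self' (fun _ _ => zero_le) x).trans (min_le_left _ _)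

theorem eventually_truncation_eq (w : X → ℝ≥0) (x : X) :
    ∀ᶠ N in atTop, truncation μ w N x = w x := by
  filter_upwards [eventually_ge_atTop (spanningSetsIndex μ x), eventually_ge_atTop ⌈w x⌉₊]
    with N hxN hwxN
  rw [truncation, indicator_of_mem (mem_spanningSets_of_index_le μ x hxN),
    min_eq_left (Nat.ceil_le.1 hwxN)]

theorem lintegral_mul_truncation_lt_top (w : X → ℝ≥0) (k : ℝ≥0) (N : ℕ) :
    ∫⁻ x, k * truncation μ w N x ∂μ < ∞ := by
  calc ∫⁻ x, k * truncation μ w N x ∂μ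
      ≤ ∫⁻ x, (spanningSets μ N).indicator (fun _ => (k * N : ℝ≥0∞)) x ∂μ := by
        refine lintegral_mono fun x => ?_
        by_cases hx : x ∈ spanningSets μ N
        · simp only [truncation, indicator_of_mem hx]
          gcongr
          exact_mod_cast min_le_right (w x) N
        · simp [truncation, hx]
    _ = k * N * μ (spanningSets μ N) :=
        lintegral_indicator_const (measurableSet_spanningSets μ N) _
    _ < ∞ := ENNReal.mul_lt_top (by finiteness) (measure_spanningSets_lt_top μ N)

theorem StarShaped.lintegral_apply_le_one_of_sigmaFinite (h : StarShaped Ψ) (hw : Measurable w)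
    (hdual : ∀ G : X → ℝ≥0, Measurable G → ∫⁻ x, compl Ψ (G x) ∂μ ≤ 1 →
      ∫⁻ x, (w x : ℝ≥0∞) * G x ∂μ < 1) : ∫⁻ x, Ψ (w x) ∂μ ≤ 1 := by
  set ψ : ℕ → X → ℝ≥0∞ := fun N x =>
    min (Ψ (truncation μ w N x)) ((N : ℝ≥0) * truncation μ w N x)
  have hψ_le (N : ℕ) : ∫⁻ x, ψ N x ∂μ ≤ 1 := by
    refine (h.min_mul N).lintegral_apply_le_one (measurable_truncation hw N)
      (fun x => ((min_le_right _ _).trans_lt (by finiteness)).ne) (ne_of_lt ?_) fun G hG hG1 => ?_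
    · exact (lintegral_mono fun x => min_le_right _ _).trans_lt
        (lintegral_mul_truncation_lt_top w N N)
    · refine (lintegral_mono fun x => ?_).trans_lt (hdual G hG <| le_trans
        (lintegral_mono fun x => compl_anti (fun s => min_le_left (Ψ s) _) _) hG1)
      gcongr
      exact truncation_le w N x
  calc ∫⁻ x, Ψ (w x) ∂μ
      = ∫⁻ x, liminf (fun N => ψ N x) atTop ∂μ := lintegral_congr fun x =>
        (h.tendsto_min_mul (eventually_truncation_eq w x)).liminf_eq.symm
    _ ≤ liminf (fun N => ∫⁻ x, ψ N x ∂μ) atTop :=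
        lintegral_liminf_le fun N => (h.min_mul N).measurable.comp (measurable_truncation hw N)
    _ ≤ 1 := liminf_le_of_le (h := fun b hb => (hb.exists.choose_spec).trans (hψ_le _))

end Truncation

theorem SobolevDominated.map_zero {q : ℝ} {c : ℝ≥0} (hd : SobolevDominated q c Φ Ψ) (hq : 0 < q)
    (hΦ : StarShaped Φ) : Ψ 0 = 0 := by
  have h := hd 0 0 (by simp [hq])
  rwa [mul_zero, hΦ.map_zero, nonpos_iff_eq_zero] at h

variable {n : ℕ} {α q : ℝ} {c c' C : ℝ≥0} {F G : EuclideanSpace ℝ (Fin n) → ℝ≥0}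

theorem StarShaped.setLIntegral_potential_le
    (hC : ∀ (S : Set (EuclideanSpace ℝ (Fin n))) (y : EuclideanSpace ℝ (Fin n)),
      ∫⁻ x in S, rieszKernel α (x - y) ≤ C * volume S ^ (α / n))
    (h : StarShaped Φ) (hF : Measurable F) (hF1 : ∫⁻ x, Φ (F x) ≤ 1) {v : ℝ≥0} (hv : v ≠ 0)
    {S : Set (EuclideanSpace ℝ (Fin n))} (hS : volume S = v) {z : ℝ≥0∞}
    (hupper : upperPart volume (α / n) F v ≤ z)
    (hgenInv : (v : ℝ≥0∞) ^ (α / n) * genInv Φ (v : ℝ≥0∞)⁻¹ ≤ z) :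
    ∫⁻ x in S, potential α F x ≤ 3 * C * z * v := by
  have hsplit := OrliczMorrey.setLIntegral_potential_le hC hF S
  rw [hS] at hsplit
  calc ∫⁻ x in S, potential α F x
      ≤ C * (v * upperPart volume (α / n) F v + (v : ℝ≥0∞) ^ (α / n) * lowerPart volume F v) :=
        hsplit
    _ ≤ C * (v * z + (v : ℝ≥0∞) ^ (α / n) * (2 * v * genInv Φ (v : ℝ≥0∞)⁻¹)) := by
        gcongr
        exact h.lowerPart_le hF hF1 hv
    _ = C * (v * z + 2 * v * ((v : ℝ≥0∞) ^ (α / n) * genInv Φ (v : ℝ≥0∞)⁻¹)) := by ring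
    _ ≤ C * (v * z + 2 * v * z) := by gcongr
    _ = 3 * C * z * v := by ring

theorem SobolevDominated.mul_volume_le_one (hd : SobolevDominated q c Φ Ψ)
    (hpq : ((n : ℝ) / α).HolderConjugate q) (hc : 0 < c) (hC0 : 0 < C)
    (hC : ∀ (S : Set (EuclideanSpace ℝ (Fin n))) (y : EuclideanSpace ℝ (Fin n)),
      ∫⁻ x in S, rieszKernel α (x - y) ≤ C * volume S ^ (α / n))
    (hΦ : StarShaped Φ) (hF : Measurable F) (hF1 : ∫⁻ x, Φ (F x) ≤ 1) {t : ℝ≥0}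
    {S : Set (EuclideanSpace ℝ (Fin n))} (hS : MeasurableSet S) (hSfin : volume S ≠ ∞)
    (hSt : ∀ x ∈ S, ((4 * C * (t / c) : ℝ≥0) : ℝ≥0∞) < potential α F x) :
    volume S * Ψ t ≤ 1 := by
  rcases eq_or_ne t 0 with rfl | ht
  · simp [hd.map_zero hpq.symm.pos hΦ]
  lift volume S to ℝ≥0 using hSfin with v hv
  rcases eq_or_ne v 0 with rfl | hv0
  · simp
  have hθ : 1 / ((n : ℝ) / α) = α / n := one_div_div _ _
  set z : ℝ≥0 := t / c
  have hcz : c * z = t := mul_div_cancel₀ _ hc.ne'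
  have : z ≠ 0 := by positivity
  rcases lt_or_ge (z : ℝ≥0∞) (upperPart volume (α / n) F v) with hupper | hupper
  · rw [← hθ] at hupper
    simpa only [hcz] using hd.mul_apply_le_one_of_lt_upperPart hpq hΦ hF hF1 hupper
  rcases lt_or_ge (z : ℝ≥0∞) ((v : ℝ≥0∞) ^ (α / n) * genInv Φ (v : ℝ≥0∞)⁻¹)
    with hgenInv | hgenInv
  · have hlt : ((z / v ^ (α / n) : ℝ≥0) : ℝ≥0∞) < genInv Φ (v : ℝ≥0∞)⁻¹ := by
      rw [ENNReal.coe_div (by positivity), ENNReal.coe_rpow_of_ne_zero hv0]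
      exact ENNReal.div_lt_of_lt_mul' hgenInv
    have := hd.mul_apply_le_one hpq hΦ hlt
    rwa [hθ, mul_div_cancel₀ _ (by positivity), hcz] at this
  have hle : ((4 * C * z : ℝ≥0) : ℝ≥0∞) * v ≤ 3 * C * z * v := by
    refine le_trans ?_ (hΦ.setLIntegral_potential_le hC hF hF1 hv0 hv.symm hupper hgenInv)
    rw [hv, ← setLIntegral_const]
    exact setLIntegral_mono' hS fun x hx => (hSt x hx).le
  have hlt : 3 * C * z * v < 4 * C * z * v := by
    have : 0 < C * z * v := by positivity
    linarith
  exact absurd hle (not_le.2 (by exact_mod_cast hlt))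

theorem SobolevDominated.exists_mul_volume_potential_le (hd : SobolevDominated q c Φ Ψ)
    (hpq : ((n : ℝ) / α).HolderConjugate q) (hα : 0 < α) (hαn : α < n) (hc : 0 < c)
    (hΦ : StarShaped Φ) :
    ∃ K : ℝ≥0, 1 ≤ K ∧ ∀ F : EuclideanSpace ℝ (Fin n) → ℝ≥0, Measurable F →
      ∫⁻ x, Φ (F x) ≤ 1 → ∀ t : ℝ≥0,
        Ψ t * volume {x | ((K * t : ℝ≥0) : ℝ≥0∞) < potential α F x} ≤ 1 := by
  obtain ⟨C, hC0, hC⟩ := exists_setLIntegral_rieszKernel_le hα hαn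
  refine ⟨4 * C / c + 1, le_add_left le_rfl, fun F hF hF1 t => ?_⟩
  have hm : MeasurableSet {x | (((4 * C / c + 1) * t : ℝ≥0) : ℝ≥0∞) < potential α F x} :=
    measurableSet_lt measurable_const (measurable_potential α hF)
  rw [mul_comm]
  refine ENNReal.mul_le_of_forall_lt fun v hv a ha => ?_
  obtain ⟨S, hS, hSsub, hvS, hSfin⟩ := Measure.exists_subset_measure_lt_top hm hv
  refine (mul_le_mul' hvS.le ha.le).trans
    (hd.mul_volume_le_one hpq hc hC0 hC hΦ hF hF1 hS hSfin.ne fun x hx => ?_)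
  refine lt_of_le_of_lt (ENNReal.coe_le_coe.2 ?_) (hSsub hx)
  rw [← mul_div_assoc, mul_div_right_comm]
  gcongr
  exact le_add_right le_rfl

theorem lintegral_potential_mul_le
    (hC : ∀ (S : Set (EuclideanSpace ℝ (Fin n))) (y : EuclideanSpace ℝ (Fin n)),
      ∫⁻ x in S, rieszKernel α (x - y) ≤ C * volume S ^ (α / n))
    (hF : Measurable F) (hG : Measurable G) :
    ∫⁻ x, potential α F x * G x ≤ C *
      ((∫⁻ s in Ioi (0 : ℝ), distrib volume G s *
          upperPart volume (α / n) F (distrib volume G s)) +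
        ∫⁻ t in Ioi (0 : ℝ), distrib volume F t *
          upperPart volume (α / n) G (distrib volume F t)) := by
  have hlayer := lintegral_setLIntegral_lt_mul (μ := volume) hG (measurable_potential α hF)
    (H := fun _ => 1) measurable_const
  simp only [mul_one, setLIntegral_const, Real.volume_Ioo, sub_zero, one_mul,
    ENNReal.ofReal_coe_nnreal] at hlayer
  have hmono : Monotone fun s => upperPart volume (α / n) F (distrib volume G s) :=
    (upperPart_anti volume _ F).comp (distrib_anti volume G)
  rw [← hlayer]
  refine (lintegral_mono fun s => setLIntegral_potential_le hC hF _).trans ?_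
  rw [lintegral_const_mul' _ _ ENNReal.coe_ne_top]
  refine mul_le_mul_right ?_ _
  refine (lintegral_add_left ((measurable_distrib volume G).mul hmono.measurable) _).trans_le ?_
  exact add_le_add le_rfl (lintegral_rpow_mul_lowerPart_le volume (α / n) F G)

theorem SobolevDominated.lintegral_potential_mul_le (hd : SobolevDominated q c Φ Ψ)
    (hd' : SobolevDominated q c' (compl Ψ) (compl Φ)) (hpq : ((n : ℝ) / α).HolderConjugate q)
    (hc : 0 < c) (hc' : 0 < c')
    (hC : ∀ (S : Set (EuclideanSpace ℝ (Fin n))) (y : EuclideanSpace ℝ (Fin n)),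
      ∫⁻ x in S, rieszKernel α (x - y) ≤ C * volume S ^ (α / n))
    (hΦ : StarShaped Φ) (hF : Measurable F) (hG : Measurable G) (hF1 : ∫⁻ x, Φ (F x) ≤ 1)
    (hG1 : ∫⁻ x, compl Ψ (G x) ≤ 1) :
    ∫⁻ x, potential α F x * G x ≤ (C * (2 / c + 2 / c') : ℝ≥0) := by
  have hF1' : ∫⁻ x, compl (compl Φ) (F x) ≤ 1 :=
    (lintegral_mono fun x => compl_compl_le Φ (F x)).trans hF1
  have hFG := hd.mul_lintegral_distrib_mul_upperPart_le hpq hΦ hF hG hF1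
  have hGF := hd'.mul_lintegral_distrib_mul_upperPart_le hpq (starShaped_compl Ψ) hG hF hG1
  rw [one_div_div] at hFG hGF
  have le_div {k : ℝ≥0} {x : ℝ≥0∞} (hk : 0 < k) (hx : k * x ≤ 1 + 1) :
      x ≤ ((2 / k : ℝ≥0) : ℝ≥0∞) := by
    rw [ENNReal.coe_div hk.ne', ENNReal.le_div_iff_mul_le (by simp [hk.ne']) (by simp), mul_comm]
    exact hx.trans_eq one_add_one_eq_two
  refine (OrliczMorrey.lintegral_potential_mul_le hC hF hG).trans ?_
  rw [ENNReal.coe_mul, ENNReal.coe_add]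
  exact mul_le_mul_right (add_le_add (le_div hc (hFG.trans (add_le_add hG1 hF1)))
    (le_div hc' (hGF.trans (add_le_add hF1' hG1)))) _

theorem SobolevDominated.exists_lintegral_apply_potential_le (hd : SobolevDominated q c Φ Ψ)
    (hd' : SobolevDominated q c' (compl Ψ) (compl Φ)) (hpq : ((n : ℝ) / α).HolderConjugate q)
    (hα : 0 < α) (hαn : α < n) (hc : 0 < c) (hc' : 0 < c') (hΦ : StarShaped Φ)
    (hΨ : StarShaped Ψ) :
    ∃ K : ℝ≥0, 1 ≤ K ∧ ∀ F : EuclideanSpace ℝ (Fin n) → ℝ≥0, Measurable F →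
      ∫⁻ x, Φ (F x) ≤ 1 → ∫⁻ x, Ψ ((potential α F x).toNNReal / K) ≤ 1 := by
  obtain ⟨C, hC0, hC⟩ := exists_setLIntegral_rieszKernel_le hα hαn
  set D : ℝ≥0 := C * (2 / c + 2 / c')
  have hD (x : ℝ≥0∞) (hx : x ≤ D) : x / (D + 1 : ℝ≥0) < 1 := by
    refine ENNReal.div_lt_of_lt_mul (hx.trans_lt ?_)
    rw [one_mul]
    exact ENNReal.coe_lt_coe.2 (lt_add_one D)
  refine ⟨D + 1, le_add_left le_rfl, fun F hF hF1 => ?_⟩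
  have hu := (measurable_potential α hF).ennreal_toNNReal
  refine hΨ.lintegral_apply_le_one_of_sigmaFinite (hu.div_const _) fun G hG hG1 => ?_
  refine lt_of_le_of_lt ?_
    (hD _ (hd.lintegral_potential_mul_le hd' hpq hc hc' hC hΦ hF hG hF1 hG1))
  rw [div_eq_mul_inv, ← lintegral_mul_const' _ _ (by simp)]
  refine lintegral_mono fun x => ?_
  rw [ENNReal.coe_div (by positivity), div_eq_mul_inv, mul_right_comm]
  gcongr
  exact ENNReal.coe_toNNReal_le_self

end Modular

/-! ### Orlicz norms on balls -/

section Orlicz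

variable {n : ℕ} {𝕜 : Type*} [RCLike 𝕜] {Φ Ψ : ℝ≥0 → ℝ≥0∞}
  {f g : EuclideanSpace ℝ (Fin n) → 𝕜}

theorem orliczNorm_le {l : ℝ≥0} (hl : 0 < l) (h : ∫⁻ x, Φ (‖f x‖₊ / l) ≤ 1) :
    orliczNorm Φ f ≤ l :=
  iInf_le_of_le l (iInf_le_of_le hl (iInf_le _ h))

theorem weakOrliczNorm_le {l : ℝ≥0} (hl : 0 < l)
    (h : ∀ t : ℝ≥0, 0 < t → Φ t * volume {x | t < ‖f x‖₊ / l} ≤ 1) : weakOrliczNorm Φ f ≤ l :=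
  iInf_le_of_le l (iInf_le_of_le hl (iInf_le _ (iSup₂_le h)))

theorem exists_lintegral_le_one_of_orliczNorm_lt {b : ℝ≥0∞} (h : orliczNorm Φ f < b) :
    ∃ l : ℝ≥0, 0 < l ∧ (l : ℝ≥0∞) < b ∧ ∫⁻ x, Φ (‖f x‖₊ / l) ≤ 1 := by
  simp only [orliczNorm, iInf_lt_iff] at h
  obtain ⟨l, hl, h1, h2⟩ := h
  exact ⟨l, hl, h2, h1⟩

theorem lintegral_le_one_of_orliczNorm_lt (hΦ : Monotone Φ) {l : ℝ≥0} (h : orliczNorm Φ f < l) :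
    ∫⁻ x, Φ (‖f x‖₊ / l) ≤ 1 := by
  obtain ⟨k, hk, hkl, hk1⟩ := exists_lintegral_le_one_of_orliczNorm_lt h
  have hkl : k ≤ l := by exact_mod_cast hkl.le
  exact (lintegral_mono fun x => hΦ (by gcongr)).trans hk1

theorem orliczNorm_mono (hΦ : Monotone Φ) (h : ∀ x, ‖f x‖₊ ≤ ‖g x‖₊) :
    orliczNorm Φ f ≤ orliczNorm Φ g :=
  iInf_mono fun _ => iInf_mono fun _ => iInf_mono' fun hg =>
    ⟨(lintegral_mono fun x => hΦ (by have := h x; gcongr)).trans hg, le_rfl⟩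

theorem orliczNorm_congr_ae (h : f =ᵐ[volume] g) : orliczNorm Φ f = orliczNorm Φ g := by
  have hint (l : ℝ≥0) : ∫⁻ x, Φ (‖f x‖₊ / l) = ∫⁻ x, Φ (‖g x‖₊ / l) :=
    lintegral_congr_ae (h.mono fun x hx => by simp only [hx])
  simp only [orliczNorm, hint]

theorem nnnorm_indicator_div (B : Set (EuclideanSpace ℝ (Fin n)))
    (f : EuclideanSpace ℝ (Fin n) → 𝕜) (l : ℝ≥0) (x : EuclideanSpace ℝ (Fin n)) :
    ‖B.indicator f x‖₊ / l = B.indicator (fun y => ‖f y‖₊ / l) x := by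
  by_cases hx : x ∈ B <;> simp [hx]

theorem IsStarYoung.setLIntegral_nnnorm_le (hΦ : IsStarYoung Φ) (hf : StronglyMeasurable f)
    {B : Set (EuclideanSpace ℝ (Fin n))} (hB : MeasurableSet B) (hB0 : volume B ≠ 0)
    (hBtop : volume B ≠ ∞) :
    ∫⁻ y in B, ‖f y‖₊ ≤ 2 * volume B * genInv Φ (volume B)⁻¹ * orliczNorm Φ (B.indicator f) := by
  obtain ⟨v, hv⟩ : ∃ v : ℝ≥0, (v : ℝ≥0∞) = volume B := ⟨_, ENNReal.coe_toNNReal hBtop⟩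
  have hinv0 : genInv Φ (volume B)⁻¹ ≠ 0 := hΦ.genInv_ne_zero (by simpa using hBtop)
  have hinvtop : genInv Φ (volume B)⁻¹ ≠ ∞ := hΦ.genInv_ne_top (by simpa using hB0)
  have ha0 : 2 * volume B * genInv Φ (volume B)⁻¹ ≠ 0 := by simp [hB0, hinv0]
  have hatop : 2 * volume B * genInv Φ (volume B)⁻¹ ≠ ∞ := by finiteness
  rw [mul_comm, ← ENNReal.div_le_iff ha0 hatop]
  refine le_of_forall_coe_gt fun l hl => ?_
  have hl0 : l ≠ 0 := fun h => by simp [h] at hl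
  have hmodular : ∫⁻ y, Φ (B.indicator (fun y => ‖f y‖₊ / l) y) ≤ 1 := by
    simpa only [nnnorm_indicator_div] using
      lintegral_le_one_of_orliczNorm_lt hΦ.starShaped.monotone hl
  have hholder := hΦ.starShaped.setLIntegral_le (hf.measurable.nnnorm.div_const l) hB hmodular
    (fun h => hB0 (by simp [← hv, h])) hv.ge
  rw [hv] at hholder
  rw [ENNReal.div_le_iff ha0 hatop]
  calc ∫⁻ y in B, (‖f y‖₊ : ℝ≥0∞) = l * ∫⁻ y in B, ((‖f y‖₊ / l : ℝ≥0) : ℝ≥0∞) := by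
        rw [← lintegral_const_mul' _ _ ENNReal.coe_ne_top]
        refine lintegral_congr fun y => ?_
        rw [← ENNReal.coe_mul, mul_div_cancel₀ _ hl0]
    _ ≤ l * (2 * volume B * genInv Φ (volume B)⁻¹) := by gcongr

theorem exists_volume_ball_comparable (n : ℕ) :
    ∃ K : ℝ≥0, 1 ≤ K ∧ ∀ (x : EuclideanSpace ℝ (Fin n)) (t : ℝ), 0 < t →
      volume (Metric.ball x t) ≤ K * ENNReal.ofReal (t ^ n) ∧
      ENNReal.ofReal (t ^ n) ≤ K * volume (Metric.ball x t) := by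
  obtain ⟨κ, hκ⟩ : ∃ κ : ℝ≥0, (κ : ℝ≥0∞) = volume (Metric.ball (0 : EuclideanSpace ℝ (Fin n)) 1) :=
    ⟨_, ENNReal.coe_toNNReal measure_ball_lt_top.ne⟩
  have hκ0 : κ ≠ 0 := fun h =>
    (Metric.measure_ball_pos volume (0 : EuclideanSpace ℝ (Fin n)) one_pos).ne' (by simp [← hκ, h])
  refine ⟨max 1 (max κ κ⁻¹), le_max_left _ _, fun x t ht => ?_⟩
  have hvol : volume (Metric.ball x t) = κ * ENNReal.ofReal (t ^ n) := by
    rw [Measure.addHaar_ball_of_pos _ x ht, ← hκ, finrank_euclideanSpace_fin, mul_comm]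
  rw [hvol]
  refine ⟨?_, ?_⟩
  · gcongr
    exact (le_max_left _ _).trans (le_max_right _ _)
  · calc ENNReal.ofReal (t ^ n) = (κ⁻¹ : ℝ≥0) * (κ * ENNReal.ofReal (t ^ n)) := by
          rw [← mul_assoc, ← ENNReal.coe_mul, inv_mul_cancel₀ hκ0, ENNReal.coe_one, one_mul]
      _ ≤ _ := by
          gcongr
          exact (le_max_right _ _).trans (le_max_right _ _)

theorem StarShaped.genInv_inv_le (hΦ : StarShaped Φ) {K : ℝ≥0} (hK : 1 ≤ K) {x y : ℝ≥0∞}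
    (hxy : x ≤ K * y) : genInv Φ y⁻¹ ≤ K * genInv Φ x⁻¹ := by
  have hK0 : (K : ℝ≥0∞) ≠ 0 := by simpa using (zero_lt_one.trans_le hK).ne'
  refine (genInv_mono Φ ?_).trans (hΦ.genInv_mul_le hK _)
  calc y⁻¹ = K * (K * y)⁻¹ := by
        rw [ENNReal.mul_inv (.inl hK0) (.inl ENNReal.coe_ne_top), ← mul_assoc,
          ENNReal.mul_inv_cancel hK0 ENNReal.coe_ne_top, one_mul]
    _ ≤ K * x⁻¹ := by gcongr

end Orlicz

/-! ### The tail of the potential -/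

section Tail

variable {n : ℕ} {𝕜 : Type*} [RCLike 𝕜] {α : ℝ} {Φ Ψ : ℝ≥0 → ℝ≥0∞}

theorem rieszKernel_le_lintegral_Ioi (hαn : α < n) {ρ : ℝ} (hρ : 0 < ρ)
    {x : EuclideanSpace ℝ (Fin n)} (hx : ρ / 2 ≤ ‖x‖) :
    rieszKernel α x ≤ ENNReal.ofReal (4 ^ ((n : ℝ) - α + 1) / 2) *
      ∫⁻ t in Ioi ρ, ENNReal.ofReal (t ^ (-((n : ℝ) - α + 1))) := by
  have hρ2 : 0 < ρ / 2 := half_pos hρ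
  calc rieszKernel α x ≤ ENNReal.ofReal (((ρ / 2) ^ ((n : ℝ) - α))⁻¹) :=
        rieszKernel_le_of_le_norm hαn.le hρ2 hx
    _ = ENNReal.ofReal (ρ / 2) ^ (1 - ((n : ℝ) - α + 1)) := by
        rw [ENNReal.ofReal_rpow_of_pos hρ2, ← Real.rpow_neg hρ2.le]
        ring_nf
    _ ≤ _ := rpow_one_sub_le_lintegral hρ2 (by linarith)
    _ ≤ _ := by
        gcongr
        exact fun t ht => (by linarith [ht.1] : ρ < t)

theorem potential_compl_ball_le (hαn : α < n) {F : EuclideanSpace ℝ (Fin n) → ℝ≥0}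
    (hF : Measurable F) {x₀ x : EuclideanSpace ℝ (Fin n)} {r : ℝ} (hx : x ∈ Metric.ball x₀ r) :
    potential α ((Metric.ball x₀ (2 * r))ᶜ.indicator F) x ≤
      ENNReal.ofReal (4 ^ ((n : ℝ) - α + 1) / 2) *
        ∫⁻ t in Ioi (2 * r), ENNReal.ofReal (t ^ (-((n : ℝ) - α + 1))) *
          ∫⁻ y in Metric.ball x₀ t, F y := by
  set A := ENNReal.ofReal (4 ^ ((n : ℝ) - α + 1) / 2)
  set k : ℝ → ℝ≥0∞ := fun t => ENNReal.ofReal (t ^ (-((n : ℝ) - α + 1))) with hk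
  have hkernel (y : EuclideanSpace ℝ (Fin n)) :
      rieszKernel α (x - y) * ((Metric.ball x₀ (2 * r))ᶜ.indicator F y : ℝ≥0) ≤
        A * ∫⁻ t in {t | dist y x₀ < t}, k t * F y ∂volume.restrict (Ioi (2 * r)) := by
    by_cases hy : y ∈ Metric.ball x₀ (2 * r)
    · simp [hy]
    have hxr : dist x x₀ < r := hx
    have hyr : 2 * r ≤ dist y x₀ := by simpa using hy
    have hdist : dist y x₀ / 2 ≤ ‖x - y‖ := by
      rw [← dist_eq_norm, dist_comm x y]
      linarith [dist_triangle y x x₀]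
    have hpos : 0 < dist y x₀ := by linarith [dist_nonneg (x := x) (y := x₀)]
    rw [indicator_of_mem (show y ∈ (Metric.ball x₀ (2 * r))ᶜ from hy),
      Measure.restrict_restrict_of_subset (show {t | dist y x₀ < t} ⊆ Ioi (2 * r) from
        fun t ht => hyr.trans_lt ht),
      lintegral_mul_const' _ _ ENNReal.coe_ne_top, ← mul_assoc]
    gcongr
    exact rieszKernel_le_lintegral_Ioi hαn hpos hdist
  calc potential α ((Metric.ball x₀ (2 * r))ᶜ.indicator F) x
      ≤ ∫⁻ y, A * ∫⁻ t in {t | dist y x₀ < t}, k t * F y ∂volume.restrict (Ioi (2 * r)) :=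
        lintegral_mono hkernel
    _ = A * ∫⁻ t in Ioi (2 * r), ∫⁻ y in Metric.ball x₀ t, k t * F y := by
        rw [lintegral_const_mul' _ _ ENNReal.ofReal_ne_top, lintegral_setLIntegral_swap
          (R := fun y t => dist y x₀ < t) (measurableSet_lt (by fun_prop) (by fun_prop))
          (by fun_prop)]
        rfl
    _ = _ := by simp only [hk, lintegral_const_mul' _ _ ENNReal.ofReal_ne_top]

/-- The integral `∫_r^∞ N(t) Ψ⁻¹(t⁻ⁿ) dt/t` that controls the part of the Riesz potential coming
from outside a ball; `N` is the Orlicz norm over concentric balls, or an upper bound for it. -/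
def tailInt (n : ℕ) (Ψ : ℝ≥0 → ℝ≥0∞) (N : ℝ → ℝ≥0∞) (r : ℝ) : ℝ≥0∞ :=
  ∫⁻ t in Ioi r, N t * genInv Ψ (ENNReal.ofReal ((t ^ n)⁻¹)) / ENNReal.ofReal t

/-- The Luxemburg norm of `f` over the ball of centre `x` and radius `t`. -/
def ballNorm (Φ : ℝ≥0 → ℝ≥0∞) (f : EuclideanSpace ℝ (Fin n) → 𝕜) (x : EuclideanSpace ℝ (Fin n))
    (t : ℝ) : ℝ≥0∞ := orliczNorm Φ ((Metric.ball x t).indicator f)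

theorem ballNorm_mono (hΦ : Monotone Φ) (f : EuclideanSpace ℝ (Fin n) → 𝕜)
    (x : EuclideanSpace ℝ (Fin n)) : Monotone (ballNorm Φ f x) := fun s t hst =>
  orliczNorm_mono hΦ fun y => by
    by_cases hy : y ∈ Metric.ball x s
    · rw [indicator_of_mem hy, indicator_of_mem (Metric.ball_subset_ball hst hy)]
    · simp [hy]

theorem StarShaped.genInv_inv_pow_le (hΨ : StarShaped Ψ) {K : ℝ≥0} (hK : 1 ≤ K) {r t : ℝ}
    (hr : 0 < r) (ht : 0 < t) (htr : t ≤ K * r) :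
    genInv Ψ (ENNReal.ofReal ((r ^ n)⁻¹)) ≤ K ^ n * genInv Ψ (ENNReal.ofReal ((t ^ n)⁻¹)) := by
  rw [ENNReal.ofReal_inv_of_pos (pow_pos hr n), ENNReal.ofReal_inv_of_pos (pow_pos ht n),
    ← ENNReal.coe_pow]
  refine hΨ.genInv_inv_le (one_le_pow₀ hK) ?_
  rw [← ENNReal.ofReal_coe_nnreal, ← ENNReal.ofReal_mul (by positivity), NNReal.coe_pow, ← mul_pow]
  gcongr

theorem StarShaped.genInv_mul_le_tailInt (hΨ : StarShaped Ψ) {N : ℝ → ℝ≥0∞} (hN : Monotone N)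
    {r : ℝ} (hr : 0 < r) :
    genInv Ψ (ENNReal.ofReal ((r ^ n)⁻¹)) * N (2 * r) ≤ 2 * 4 ^ n * tailInt n Ψ N r := by
  have hmono : ∀ t ∈ Ioc (2 * r) (4 * r),
      genInv Ψ (ENNReal.ofReal ((r ^ n)⁻¹)) * N (2 * r) / ENNReal.ofReal (4 * r) ≤
        4 ^ n * (N t * genInv Ψ (ENNReal.ofReal ((t ^ n)⁻¹)) / ENNReal.ofReal t) := by
    intro t ht
    have hinv := hΨ.genInv_inv_pow_le (n := n) (K := 4) (by norm_num) hr (by linarith [ht.1]) ht.2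
    rw [← mul_div_assoc, mul_left_comm, mul_comm (genInv _ _)]
    push_cast at hinv
    gcongr
    exacts [hN ht.1.le, ht.2]
  have hlength : (ENNReal.ofReal (4 * r))⁻¹ * ENNReal.ofReal (4 * r - 2 * r) = 2⁻¹ := by
    rw [← ENNReal.ofReal_inv_of_pos (by positivity), ← ENNReal.ofReal_mul (by positivity),
      show (4 * r)⁻¹ * (4 * r - 2 * r) = 2⁻¹ by field_simp; norm_num,
      ENNReal.ofReal_inv_of_pos two_pos, ENNReal.ofReal_ofNat]
  have htail : genInv Ψ (ENNReal.ofReal ((r ^ n)⁻¹)) * N (2 * r) * 2⁻¹ ≤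
      4 ^ n * tailInt n Ψ N r := by
    calc _ = ∫⁻ _ in Ioc (2 * r) (4 * r),
          genInv Ψ (ENNReal.ofReal ((r ^ n)⁻¹)) * N (2 * r) / ENNReal.ofReal (4 * r) := by
          rw [setLIntegral_const, Real.volume_Ioc, div_eq_mul_inv, mul_assoc _ _⁻¹, hlength]
      _ ≤ ∫⁻ t in Ioc (2 * r) (4 * r),
          4 ^ n * (N t * genInv Ψ (ENNReal.ofReal ((t ^ n)⁻¹)) / ENNReal.ofReal t) :=
          setLIntegral_mono' measurableSet_Ioc hmono
      _ ≤ 4 ^ n * tailInt n Ψ N r := by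
          rw [lintegral_const_mul' _ _ (by finiteness), tailInt]
          gcongr
          exact fun t ht => (by linarith [ht.1] : r < t)
  rw [← div_eq_mul_inv, ENNReal.div_le_iff two_ne_zero ENNReal.ofNat_ne_top] at htail
  exact htail.trans_eq (by ring)

theorem SobolevDominated.mul_genInv_inv_pow_le {q : ℝ} {c : ℝ≥0} (hd : SobolevDominated q c Φ Ψ)
    (hpq : ((n : ℝ) / α).HolderConjugate q) (hΦ : StarShaped Φ) (hΨ : Monotone Ψ)
    {t : ℝ} (ht : 0 < t) :
    c * (ENNReal.ofReal (t ^ α) * genInv Φ (ENNReal.ofReal ((t ^ n)⁻¹))) ≤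
      genInv Ψ (ENNReal.ofReal ((t ^ n)⁻¹)) := by
  have hn : (n : ℝ) ≠ 0 := fun h => hpq.pos.ne' (by simp [h])
  have hpow : (((t ^ n).toNNReal ^ (1 / ((n : ℝ) / α)) : ℝ≥0) : ℝ≥0∞) = ENNReal.ofReal (t ^ α) := by
    rw [ENNReal.ofReal, ← Real.toNNReal_rpow_of_nonneg (by positivity), ← Real.rpow_natCast,
      ← Real.rpow_mul ht.le, one_div_div, mul_div_cancel₀ _ hn]
  rw [ENNReal.ofReal_inv_of_pos (pow_pos ht n), ← mul_assoc, ← hpow, ← ENNReal.coe_mul]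
  exact hd.genInv_le hpq hΦ hΨ _

theorem ofReal_rpow_neg_mul_pow {t : ℝ} (ht : 0 < t) (n : ℕ) (α : ℝ) :
    ENNReal.ofReal (t ^ (-((n : ℝ) - α + 1))) * ENNReal.ofReal (t ^ n) =
      ENNReal.ofReal (t ^ α) / ENNReal.ofReal t := by
  rw [div_eq_mul_inv, ← ENNReal.ofReal_mul (by positivity), ← ENNReal.ofReal_inv_of_pos ht,
    ← ENNReal.ofReal_mul (by positivity), ← Real.rpow_natCast, ← Real.rpow_add ht,
    ← Real.rpow_neg_one t, ← Real.rpow_add ht]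
  congr 2
  ring

theorem IsStarYoung.setLIntegral_ball_le (hΦ : IsStarYoung Φ) {K : ℝ≥0} (hK1 : 1 ≤ K)
    {f : EuclideanSpace ℝ (Fin n) → 𝕜} (hf : StronglyMeasurable f)
    {x : EuclideanSpace ℝ (Fin n)} {t : ℝ} (ht : 0 < t)
    (hvol : volume (Metric.ball x t) ≤ K * ENNReal.ofReal (t ^ n))
    (hvol' : ENNReal.ofReal (t ^ n) ≤ K * volume (Metric.ball x t)) :
    ∫⁻ y in Metric.ball x t, ‖f y‖₊ ≤ 2 * K * K *
      (ENNReal.ofReal (t ^ n) * genInv Φ (ENNReal.ofReal ((t ^ n)⁻¹)) * ballNorm Φ f x t) :=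
  calc _ ≤ 2 * volume (Metric.ball x t) * genInv Φ (volume (Metric.ball x t))⁻¹ *
          ballNorm Φ f x t :=
        hΦ.setLIntegral_nnnorm_le hf measurableSet_ball
          (Metric.measure_ball_pos volume x ht).ne' measure_ball_lt_top.ne
    _ ≤ 2 * (K * ENNReal.ofReal (t ^ n)) * (K * genInv Φ (ENNReal.ofReal ((t ^ n)⁻¹))) *
          ballNorm Φ f x t := by
        gcongr
        rw [ENNReal.ofReal_inv_of_pos (pow_pos ht n)]
        exact hΦ.starShaped.genInv_inv_le hK1 hvol'
    _ = _ := by ring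

theorem exists_potential_compl_ball_le_tailInt (hαn : α < n) {q : ℝ}
    (hpq : ((n : ℝ) / α).HolderConjugate q) {c : ℝ≥0} (hc : 0 < c) (hΦ : IsStarYoung Φ)
    (hΨ : Monotone Ψ) (hd : SobolevDominated q c Φ Ψ) :
    ∃ A : ℝ≥0, ∀ f : EuclideanSpace ℝ (Fin n) → 𝕜, StronglyMeasurable f →
      ∀ (x₀ : EuclideanSpace ℝ (Fin n)) (r : ℝ), 0 < r → ∀ x ∈ Metric.ball x₀ r,
        potential α ((Metric.ball x₀ (2 * r))ᶜ.indicator fun y => ‖f y‖₊) x ≤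
          A * tailInt n Ψ (ballNorm Φ f x₀) r := by
  obtain ⟨K, hK1, hK⟩ := exists_volume_ball_comparable n
  have hc0 : (c : ℝ≥0∞) ≠ 0 := by simpa using hc.ne'
  refine ⟨(4 ^ ((n : ℝ) - α + 1) / 2 : ℝ).toNNReal * (2 * K * K * c⁻¹), fun f hf x₀ r hr x hx => ?_⟩
  refine (potential_compl_ball_le hαn hf.measurable.nnnorm hx).trans ?_
  rw [ENNReal.coe_mul, mul_assoc, tailInt, ← lintegral_const_mul' _ _ ENNReal.coe_ne_top]
  refine mul_le_mul_right ((lintegral_mono_set (Ioi_subset_Ioi (by linarith))).trans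
    (setLIntegral_mono' measurableSet_Ioi fun t ht => ?_)) _
  have ht0 : 0 < t := hr.trans ht
  set g := genInv Φ (ENNReal.ofReal ((t ^ n)⁻¹))
  have hgΨ : ENNReal.ofReal (t ^ α) * g ≤
      (c : ℝ≥0∞)⁻¹ * genInv Ψ (ENNReal.ofReal ((t ^ n)⁻¹)) := by
    rw [mul_comm _⁻¹, ← div_eq_mul_inv,
      ENNReal.le_div_iff_mul_le (.inl hc0) (.inl ENNReal.coe_ne_top), mul_comm]
    exact hd.mul_genInv_inv_pow_le hpq hΦ.starShaped hΨ ht0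
  calc ENNReal.ofReal (t ^ (-((n : ℝ) - α + 1))) * ∫⁻ y in Metric.ball x₀ t, (‖f y‖₊ : ℝ≥0∞)
      ≤ ENNReal.ofReal (t ^ (-((n : ℝ) - α + 1))) *
          (2 * K * K * (ENNReal.ofReal (t ^ n) * g * ballNorm Φ f x₀ t)) := by
        gcongr
        exact hΦ.setLIntegral_ball_le hK1 hf ht0 (hK x₀ t ht0).1 (hK x₀ t ht0).2
    _ = 2 * K * K * (ENNReal.ofReal (t ^ (-((n : ℝ) - α + 1))) * ENNReal.ofReal (t ^ n) *
          g * ballNorm Φ f x₀ t) := by ring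
    _ = 2 * K * K * (ENNReal.ofReal (t ^ α) * g * ballNorm Φ f x₀ t / ENNReal.ofReal t) := by
        rw [ofReal_rpow_neg_mul_pow ht0, div_eq_mul_inv, div_eq_mul_inv]
        ring
    _ ≤ 2 * K * K * ((c : ℝ≥0∞)⁻¹ * genInv Ψ (ENNReal.ofReal ((t ^ n)⁻¹)) *
          ballNorm Φ f x₀ t / ENNReal.ofReal t) := by gcongr
    _ = _ := by
        push_cast [ENNReal.coe_inv hc.ne']
        rw [div_eq_mul_inv, div_eq_mul_inv]
        ring

end Tail

/-! ### The Zygmund condition -/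

section Zygmund

variable {n : ℕ} {𝕜 : Type*} [RCLike 𝕜] {Φ Ψ : ℝ≥0 → ℝ≥0∞}
  {φ φ₁ φ₂ : EuclideanSpace ℝ (Fin n) → ℝ → ℝ}

theorem morreyNorm_congr_ae {f g : EuclideanSpace ℝ (Fin n) → 𝕜} (h : f =ᵐ[volume] g) :
    morreyNorm Φ φ f = morreyNorm Φ φ g := by
  have hball (x : EuclideanSpace ℝ (Fin n)) (r : ℝ) :
      orliczNorm Φ ((Metric.ball x r).indicator f) = orliczNorm Φ ((Metric.ball x r).indicator g) :=
    orliczNorm_congr_ae (h.mono fun y hy => by simp only [indicator, hy])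
  simp only [morreyNorm, hball]

theorem ballNorm_le_morreyNorm (hΦ : IsStarYoung Φ) {K : ℝ≥0} (hK1 : 1 ≤ K)
    (f : EuclideanSpace ℝ (Fin n) → 𝕜) {x : EuclideanSpace ℝ (Fin n)} {s : ℝ} (hs : 0 < s)
    (hφ : 0 < φ x s) (hvol : volume (Metric.ball x s) ≤ K * ENNReal.ofReal (s ^ n)) :
    ballNorm Φ f x s ≤ ENNReal.ofReal (φ x s) / genInv Φ (ENNReal.ofReal ((s ^ n)⁻¹)) *
      (K * morreyNorm Φ φ f) := by
  have hmorrey : (ENNReal.ofReal (φ x s))⁻¹ * (genInv Φ (volume (Metric.ball x s))⁻¹ *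
      ballNorm Φ f x s) ≤ morreyNorm Φ φ f := by
    rw [← mul_assoc]
    exact le_iSup_of_le x (le_iSup₂_of_le s hs le_rfl)
  have hφ0 : ENNReal.ofReal (φ x s) ≠ 0 := by simpa using hφ
  have hg0 : genInv Φ (ENNReal.ofReal ((s ^ n)⁻¹)) ≠ 0 :=
    hΦ.genInv_ne_zero (by rw [ne_eq, ENNReal.ofReal_eq_zero, not_le]; positivity)
  have hgtop : genInv Φ (ENNReal.ofReal ((s ^ n)⁻¹)) ≠ ∞ := hΦ.genInv_ne_top ENNReal.ofReal_ne_top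
  rw [ENNReal.inv_mul_le_iff hφ0 ENNReal.ofReal_ne_top] at hmorrey
  rw [mul_comm, ← mul_div_assoc, ENNReal.le_div_iff_mul_le (.inl hg0) (.inl hgtop)]
  calc ballNorm Φ f x s * genInv Φ (ENNReal.ofReal ((s ^ n)⁻¹))
      ≤ ballNorm Φ f x s * (K * genInv Φ (volume (Metric.ball x s))⁻¹) := by
        gcongr
        rw [ENNReal.ofReal_inv_of_pos (pow_pos hs n)]
        exact hΦ.starShaped.genInv_inv_le hK1 hvol
    _ = K * (genInv Φ (volume (Metric.ball x s))⁻¹ * ballNorm Φ f x s) := by ring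
    _ ≤ K * (ENNReal.ofReal (φ x s) * morreyNorm Φ φ f) := by gcongr
    _ = _ := by ring

theorem le_essInf_mul_of_monotone {N w : ℝ → ℝ≥0∞} (hN : Monotone N) {b : ℝ≥0∞} (hb : b ≠ ∞)
    {t : ℝ} (h : ∀ s, t ≤ s → N s ≤ w s * b) :
    N t ≤ essInf w (volume.restrict (Ioi t)) * b := by
  rcases eq_or_ne b 0 with rfl | hb0
  · simpa using h t le_rfl
  rw [← ENNReal.div_le_iff hb0 hb]
  refine le_essInf_of_ae_le _ ?_
  filter_upwards [ae_restrict_mem measurableSet_Ioi] with s hs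
  rw [ENNReal.div_le_iff hb0 hb]
  exact (hN (le_of_lt hs)).trans (h s (le_of_lt hs))

theorem exists_tailInt_le (hΦ : IsStarYoung Φ) (hφ₁ : ∀ x, ∀ r > 0, 0 < φ₁ x r)
    (hZ : ZygmundCond φ₁ φ₂ Φ Ψ) :
    ∃ A : ℝ≥0, ∀ f : EuclideanSpace ℝ (Fin n) → 𝕜, morreyNorm Φ φ₁ f < ∞ →
      ∀ (x : EuclideanSpace ℝ (Fin n)) (r : ℝ), 0 < r →
        tailInt n Ψ (ballNorm Φ f x) r ≤ A * ENNReal.ofReal (φ₂ x r) * morreyNorm Φ φ₁ f := by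
  obtain ⟨K, hK1, hK⟩ := exists_volume_ball_comparable n
  obtain ⟨C, hZ⟩ := hZ
  refine ⟨K * C, fun f hfin x r hr => ?_⟩
  set b := K * morreyNorm Φ φ₁ f with hb
  have hbtop : b ≠ ∞ := ENNReal.mul_ne_top ENNReal.coe_ne_top hfin.ne
  set e : ℝ → ℝ≥0∞ := fun t =>
    essInf (fun s : ℝ => ENNReal.ofReal (φ₁ x s) / genInv Φ (ENNReal.ofReal ((s ^ n)⁻¹)))
      (volume.restrict (Ioi t))
  have hess : ∀ t ∈ Ioi r, ballNorm Φ f x t ≤ e t * b := fun t ht =>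
    le_essInf_mul_of_monotone (ballNorm_mono hΦ.starShaped.monotone f x) hbtop fun s hts =>
      have hs : 0 < s := (hr.trans ht).trans_le hts
      ballNorm_le_morreyNorm hΦ hK1 f hs (hφ₁ x s hs) (hK x s hs).1
  calc tailInt n Ψ (ballNorm Φ f x) r
      ≤ ∫⁻ t in Ioi r, b * (e t * genInv Ψ (ENNReal.ofReal ((t ^ n)⁻¹)) / ENNReal.ofReal t) := by
        refine setLIntegral_mono' measurableSet_Ioi fun t ht => ?_
        rw [← mul_div_assoc, ← mul_assoc, mul_comm b]
        gcongr
        exact hess t ht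
    _ = b * ∫⁻ t in Ioi r, e t * genInv Ψ (ENNReal.ofReal ((t ^ n)⁻¹)) / ENNReal.ofReal t :=
        lintegral_const_mul' _ _ hbtop
    _ ≤ b * (C * ENNReal.ofReal (φ₂ x r)) := by
        gcongr
        exact hZ x r hr
    _ = _ := by
        rw [hb]
        push_cast
        ring

end Zygmund

/-! ### Local estimates -/

section Local

variable {n : ℕ} {𝕜 : Type*} [RCLike 𝕜] {α : ℝ} {Φ Ψ : ℝ≥0 → ℝ≥0∞}
  {f : EuclideanSpace ℝ (Fin n) → 𝕜}

theorem enorm_rieszIntegrand (α : ℝ) (f : EuclideanSpace ℝ (Fin n) → 𝕜)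
    (x y : EuclideanSpace ℝ (Fin n)) :
    ‖rieszIntegrand α f x y‖ₑ = rieszKernel α (x - y) * ‖f y‖₊ := by
  rw [rieszIntegrand, enorm_smul, rieszKernel, Real.enorm_of_nonneg (by positivity)]
  rfl

theorem nnnorm_rieszPotential_le (α : ℝ) (f : EuclideanSpace ℝ (Fin n) → 𝕜)
    (x : EuclideanSpace ℝ (Fin n)) :
    (‖rieszPotential α f x‖₊ : ℝ≥0∞) ≤ potential α (fun y => ‖f y‖₊) x :=
  (enorm_integral_le_lintegral_enorm _).trans_eq
    (lintegral_congr fun y => enorm_rieszIntegrand α f x y)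

theorem stronglyMeasurable_rieszIntegrand (α : ℝ) (hf : StronglyMeasurable f)
    (x : EuclideanSpace ℝ (Fin n)) : StronglyMeasurable (rieszIntegrand α f x) :=
  StronglyMeasurable.smul (Measurable.stronglyMeasurable (by fun_prop)) hf

theorem stronglyMeasurable_rieszPotential (α : ℝ) (hf : StronglyMeasurable f) :
    StronglyMeasurable (rieszPotential α f) :=
  StronglyMeasurable.integral_prod_right
    (f := fun x y : EuclideanSpace ℝ (Fin n) => rieszIntegrand α f x y) <|
    StronglyMeasurable.smul (Measurable.stronglyMeasurable (by fun_prop))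
      (hf.comp_measurable measurable_snd)

theorem integrable_rieszIntegrand (hf : StronglyMeasurable f) {x : EuclideanSpace ℝ (Fin n)}
    (h : potential α (fun y => ‖f y‖₊) x < ∞) : Integrable (rieszIntegrand α f x) :=
  ⟨(stronglyMeasurable_rieszIntegrand α hf x).aestronglyMeasurable,
    (lintegral_congr fun y => enorm_rieszIntegrand α f x y).trans_lt h⟩

theorem potential_eq_add_compl (α : ℝ) {F : EuclideanSpace ℝ (Fin n) → ℝ≥0} (hF : Measurable F)
    {B : Set (EuclideanSpace ℝ (Fin n))} (hB : MeasurableSet B) (x : EuclideanSpace ℝ (Fin n)) :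
    potential α F x = potential α (B.indicator F) x + potential α (Bᶜ.indicator F) x := by
  have := hF.indicator hB
  rw [potential, potential, potential, ← lintegral_add_left (by fun_prop)]
  refine lintegral_congr fun y => ?_
  by_cases hy : y ∈ B <;> simp [hy]

theorem potential_eq_mul_div (α : ℝ) (F : EuclideanSpace ℝ (Fin n) → ℝ≥0) {l : ℝ≥0} (hl : l ≠ 0)
    (x : EuclideanSpace ℝ (Fin n)) :
    potential α F x = l * potential α (fun y => F y / l) x := by
  rw [potential, potential, ← lintegral_const_mul' _ _ ENNReal.coe_ne_top]
  refine lintegral_congr fun y => ?_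
  rw [mul_left_comm, ← ENNReal.coe_mul, mul_div_cancel₀ _ hl]

theorem StarShaped.orliczNorm_indicator_le (hΨ : StarShaped Ψ) {K l b : ℝ≥0} (hK : 1 ≤ K)
    (hl : 0 < l) {B : Set (EuclideanSpace ℝ (Fin n))} (hB : MeasurableSet B)
    {w : EuclideanSpace ℝ (Fin n) → ℝ≥0} (hmod : ∫⁻ x, Ψ (w x / K) ≤ 1)
    (hb : Ψ b * volume B ≤ 1) (h : ∀ᵐ x, x ∈ B → ‖f x‖₊ ≤ l * (w x + b)) :
    orliczNorm Ψ (B.indicator f) ≤ ((4 * K * l : ℝ≥0) : ℝ≥0∞) := by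
  have hK0 : 0 < K := one_pos.trans_le hK
  have hpointwise : ∀ᵐ x, Ψ (‖B.indicator f x‖₊ / (4 * K * l)) ≤
      (Ψ (w x / K) + B.indicator (fun _ => Ψ b) x) * 2⁻¹ := by
    filter_upwards [h] with x hx
    by_cases hxB : x ∈ B
    swap
    · simp [hxB, hΨ.map_zero]
    rw [indicator_of_mem hxB, indicator_of_mem hxB]
    have hmax : ‖f x‖₊ / (4 * K * l) ≤ max (w x / K) b / 2 := by
      rw [div_le_iff₀ (by positivity)]
      calc ‖f x‖₊ ≤ l * (w x / K * K + b * 1) := by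
            rw [div_mul_cancel₀ _ hK0.ne', mul_one]
            exact hx hxB
        _ ≤ l * (max (w x / K) b * K + max (w x / K) b * K) := by
            gcongr
            exacts [le_max_left _ _, le_max_right _ _]
        _ = max (w x / K) b / 2 * (4 * K * l) := by ring
    calc Ψ (‖f x‖₊ / (4 * K * l)) ≤ Ψ (max (w x / K) b) / 2 :=
          (hΨ.monotone hmax).trans (by simpa using hΨ.apply_div_le (K := 2) one_le_two _)
      _ ≤ (Ψ (w x / K) + Ψ b) * 2⁻¹ := by
          rw [div_eq_mul_inv, hΨ.monotone.map_max]
          gcongr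
          exact max_le_add_of_nonneg zero_le zero_le
  refine orliczNorm_le (by positivity) ((lintegral_mono_ae hpointwise).trans ?_)
  rw [lintegral_mul_const' _ _ (by simp), lintegral_add_right _ (measurable_const.indicator hB),
    lintegral_indicator_const hB]
  calc _ ≤ (1 + 1) * (2⁻¹ : ℝ≥0∞) := by gcongr
    _ = 1 := by rw [one_add_one_eq_two, ENNReal.mul_inv_cancel two_ne_zero ENNReal.ofNat_ne_top]

theorem StarShaped.weakOrliczNorm_indicator_le (hΨ : StarShaped Ψ) {K l b : ℝ≥0} (hK : 1 ≤ K)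
    (hl : 0 < l) {B : Set (EuclideanSpace ℝ (Fin n))} {w : EuclideanSpace ℝ (Fin n) → ℝ≥0∞}
    (hmod : ∀ t : ℝ≥0, Ψ t * volume {x | ((K * t : ℝ≥0) : ℝ≥0∞) < w x} ≤ 1)
    (hb : Ψ b * volume B ≤ 1) (h : ∀ x ∈ B, (‖f x‖₊ : ℝ≥0∞) ≤ l * (w x + b)) :
    weakOrliczNorm Ψ (B.indicator f) ≤ ((4 * K * l : ℝ≥0) : ℝ≥0∞) := by
  have : 0 < K := one_pos.trans_le hK
  refine weakOrliczNorm_le (by positivity) fun t _ => ?_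
  have hsub : {x | t < ‖B.indicator f x‖₊ / (4 * K * l)} ⊆
      {x | ((K * (2 * t) : ℝ≥0) : ℝ≥0∞) < w x} ∪ {x | x ∈ B ∧ 2 * t < b} := by
    intro x hx
    have hxB : x ∈ B := by
      by_contra hxB
      simp [hxB] at hx
    rw [mem_ofPred_eq, indicator_of_mem hxB, lt_div_iff₀ (by positivity)] at hx
    by_contra hout
    simp only [mem_union, mem_ofPred_eq, not_or, not_lt, not_and] at hout
    refine hx.not_ge (ENNReal.coe_le_coe.1 ((h x hxB).trans ?_))
    have hbt : b ≤ K * (2 * t) := (hout.2 hxB).trans (le_mul_of_one_le_left zero_le hK)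
    calc (l : ℝ≥0∞) * (w x + b) ≤ l * ((K * (2 * t) : ℝ≥0) + (K * (2 * t) : ℝ≥0)) := by
          gcongr
          exact hout.1
      _ = ((t * (4 * K * l) : ℝ≥0) : ℝ≥0∞) := by
          push_cast
          ring
  have hsecond : Ψ (2 * t) * volume {x | x ∈ B ∧ 2 * t < b} ≤ 1 := by
    by_cases htb : 2 * t < b
    · simpa [htb] using (mul_le_mul_left (hΨ.monotone htb.le) _).trans hb
    · simp [htb]
  have hhalf : Ψ t ≤ Ψ (2 * t) * 2⁻¹ := by
    simpa only [mul_div_cancel_left₀ t two_ne_zero, div_eq_mul_inv, ENNReal.coe_ofNat] using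
      hΨ.apply_div_le (K := 2) one_le_two (2 * t)
  calc _ ≤ Ψ (2 * t) * 2⁻¹ * (volume {x | ((K * (2 * t) : ℝ≥0) : ℝ≥0∞) < w x} +
          volume {x | x ∈ B ∧ 2 * t < b}) := by
        gcongr
        exact (measure_mono hsub).trans (measure_union_le _ _)
    _ = (Ψ (2 * t) * volume {x | ((K * (2 * t) : ℝ≥0) : ℝ≥0∞) < w x} +
          Ψ (2 * t) * volume {x | x ∈ B ∧ 2 * t < b}) * 2⁻¹ := by ring
    _ ≤ (1 + 1) * 2⁻¹ := by
        gcongr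
        exact hmod _
    _ = 1 := by rw [one_add_one_eq_two, ENNReal.mul_inv_cancel two_ne_zero ENNReal.ofNat_ne_top]

theorem mul_le_mul_of_forall_eq_mul {g a P N : ℝ≥0∞} {C : ℝ≥0} (hg0 : g ≠ 0) (hgtop : g ≠ ∞)
    (hC : C ≠ 0) (ha : g * a ≤ P)
    (h : ∀ l b : ℝ≥0, 0 < l → a < l → P = l * b → (b : ℝ≥0∞) < g → N ≤ C * l) :
    g * N ≤ C * P := by
  have hC0 : (C : ℝ≥0∞) ≠ 0 := by simpa using hC
  suffices hdiv : N / C ≤ P / g by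
    rw [ENNReal.div_le_iff hC0 ENNReal.coe_ne_top] at hdiv
    calc g * N ≤ g * (P / g * C) := by gcongr
      _ = C * P := by rw [← mul_assoc, ENNReal.mul_div_cancel hg0 hgtop, mul_comm]
  refine le_of_forall_coe_gt fun l hl => ?_
  have hl0 : 0 < l := by exact_mod_cast zero_le.trans_lt hl
  have hl0' : (l : ℝ≥0∞) ≠ 0 := by simpa using hl0.ne'
  have hPl : P < g * l := by
    rwa [ENNReal.div_lt_iff (.inl hg0) (.inl hgtop), mul_comm] at hl
  have hal : a < l := lt_of_mul_lt_mul_left' (ha.trans_lt hPl)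
  have hbg : P / l < g := by
    rwa [ENNReal.div_lt_iff (.inl hl0') (.inl ENNReal.coe_ne_top)]
  lift P / l to ℝ≥0 using hbg.ne_top with b hb
  rw [ENNReal.div_le_iff hC0 ENNReal.coe_ne_top, mul_comm]
  exact h l b hl0 hal (by rw [hb, ENNReal.mul_div_cancel hl0' ENNReal.coe_ne_top]) hbg

theorem lintegral_indicator_div_le_one (hΦ : Monotone Φ) {x₀ : EuclideanSpace ℝ (Fin n)} {r : ℝ}
    {l : ℝ≥0} (h : ballNorm Φ f x₀ r < l) :
    ∫⁻ y, Φ ((Metric.ball x₀ r).indicator (fun y => ‖f y‖₊ / l) y) ≤ 1 := by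
  simpa only [nnnorm_indicator_div] using lintegral_le_one_of_orliczNorm_lt hΦ h

theorem nnnorm_rieszPotential_le_mul_add (hf : StronglyMeasurable f)
    {B : Set (EuclideanSpace ℝ (Fin n))} (hB : MeasurableSet B) {l b : ℝ≥0} (hl : 0 < l)
    {x : EuclideanSpace ℝ (Fin n)} (h : potential α (Bᶜ.indicator fun y => ‖f y‖₊) x ≤ l * b) :
    (‖rieszPotential α f x‖₊ : ℝ≥0∞) ≤
      l * (potential α (B.indicator fun y => ‖f y‖₊ / l) x + b) := by
  have hdiv : (fun y => B.indicator (fun y => ‖f y‖₊) y / l) = B.indicator fun y => ‖f y‖₊ / l := by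
    ext y
    by_cases hy : y ∈ B <;> simp [hy]
  calc (‖rieszPotential α f x‖₊ : ℝ≥0∞) ≤ potential α (fun y => ‖f y‖₊) x :=
        nnnorm_rieszPotential_le α f x
    _ ≤ l * potential α (B.indicator fun y => ‖f y‖₊ / l) x + l * b := by
        rw [potential_eq_add_compl α hf.measurable.nnnorm hB, potential_eq_mul_div α _ hl.ne', hdiv]
        gcongr
    _ = _ := (mul_add _ _ _).symm

theorem genInv_mul_orliczNorm_rieszPotential_le (hΦ : Monotone Φ) (hΨ : IsStarYoung Ψ) {K : ℝ≥0}
    (hK : 1 ≤ K)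
    (hstrong : ∀ F : EuclideanSpace ℝ (Fin n) → ℝ≥0, Measurable F → ∫⁻ x, Φ (F x) ≤ 1 →
      (∀ᵐ x, potential α F x < ∞) ∧ ∫⁻ x, Ψ ((potential α F x).toNNReal / K) ≤ 1)
    (hf : StronglyMeasurable f) {x₀ : EuclideanSpace ℝ (Fin n)} {r : ℝ} (hr : 0 < r) {P : ℝ≥0∞}
    (hnear : genInv Ψ (volume (Metric.ball x₀ r))⁻¹ * ballNorm Φ f x₀ (2 * r) ≤ P)
    (hfar : ∀ x ∈ Metric.ball x₀ r,
      potential α ((Metric.ball x₀ (2 * r))ᶜ.indicator fun y => ‖f y‖₊) x ≤ P) :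
    genInv Ψ (volume (Metric.ball x₀ r))⁻¹ *
      orliczNorm Ψ ((Metric.ball x₀ r).indicator (rieszPotential α f)) ≤ (4 * K : ℝ≥0) * P := by
  have hvtop : volume (Metric.ball x₀ r) ≠ ∞ := measure_ball_lt_top.ne
  have hv0 : volume (Metric.ball x₀ r) ≠ 0 := (Metric.measure_ball_pos volume x₀ hr).ne'
  refine mul_le_mul_of_forall_eq_mul (hΨ.genInv_ne_zero (by simpa using hvtop))
    (hΨ.genInv_ne_top (by simpa using hv0)) (by simpa using (one_pos.trans_le hK).ne') hnear
    fun l b hl hal hP hb => ?_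
  have hF : Measurable ((Metric.ball x₀ (2 * r)).indicator fun y => ‖f y‖₊ / l) :=
    (hf.measurable.nnnorm.div_const l).indicator measurableSet_ball
  obtain ⟨hfin, hmod⟩ := hstrong _ hF (lintegral_indicator_div_le_one hΦ hal)
  rw [← ENNReal.coe_mul]
  refine hΨ.starShaped.orliczNorm_indicator_le hK hl measurableSet_ball hmod
    (ENNReal.le_inv_iff_mul_le.1 (apply_le_of_lt_genInv hb)) ?_
  filter_upwards [hfin] with x hx hxB
  rw [← ENNReal.coe_le_coe, ENNReal.coe_mul, ENNReal.coe_add, ENNReal.coe_toNNReal hx.ne]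
  exact nnnorm_rieszPotential_le_mul_add hf measurableSet_ball hl ((hfar x hxB).trans_eq hP)

theorem genInv_mul_weakOrliczNorm_rieszPotential_le (hΦ : Monotone Φ) (hΨ : IsStarYoung Ψ)
    {K : ℝ≥0} (hK : 1 ≤ K)
    (hweak : ∀ F : EuclideanSpace ℝ (Fin n) → ℝ≥0, Measurable F → ∫⁻ x, Φ (F x) ≤ 1 →
      ∀ t : ℝ≥0, Ψ t * volume {x | ((K * t : ℝ≥0) : ℝ≥0∞) < potential α F x} ≤ 1)
    (hf : StronglyMeasurable f) {x₀ : EuclideanSpace ℝ (Fin n)} {r : ℝ} (hr : 0 < r) {P : ℝ≥0∞}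
    (hnear : genInv Ψ (volume (Metric.ball x₀ r))⁻¹ * ballNorm Φ f x₀ (2 * r) ≤ P)
    (hfar : ∀ x ∈ Metric.ball x₀ r,
      potential α ((Metric.ball x₀ (2 * r))ᶜ.indicator fun y => ‖f y‖₊) x ≤ P) :
    genInv Ψ (volume (Metric.ball x₀ r))⁻¹ *
      weakOrliczNorm Ψ ((Metric.ball x₀ r).indicator (rieszPotential α f)) ≤ (4 * K : ℝ≥0) * P := by
  have hvtop : volume (Metric.ball x₀ r) ≠ ∞ := measure_ball_lt_top.ne
  have hv0 : volume (Metric.ball x₀ r) ≠ 0 := (Metric.measure_ball_pos volume x₀ hr).ne'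
  refine mul_le_mul_of_forall_eq_mul (hΨ.genInv_ne_zero (by simpa using hvtop))
    (hΨ.genInv_ne_top (by simpa using hv0)) (by simpa using (one_pos.trans_le hK).ne') hnear
    fun l b hl hal hP hb => ?_
  rw [← ENNReal.coe_mul]
  exact hΨ.starShaped.weakOrliczNorm_indicator_le hK hl
    (hweak _ ((hf.measurable.nnnorm.div_const l).indicator measurableSet_ball)
      (lintegral_indicator_div_le_one hΦ hal))
    (ENNReal.le_inv_iff_mul_le.1 (apply_le_of_lt_genInv hb)) fun x hxB =>
      nnnorm_rieszPotential_le_mul_add hf measurableSet_ball hl ((hfar x hxB).trans_eq hP)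

end Local

/-! ### Boundedness on Morrey spaces -/

section Morrey

variable {n : ℕ} {𝕜 : Type*} [RCLike 𝕜] {α q : ℝ} {c c' : ℝ≥0} {Φ Ψ : ℝ≥0 → ℝ≥0∞}
  {φ φ₁ φ₂ : EuclideanSpace ℝ (Fin n) → ℝ → ℝ} {f : EuclideanSpace ℝ (Fin n) → 𝕜}

theorem SobolevDominated.exists_near_far_le (hd : SobolevDominated q c Φ Ψ)
    (hpq : ((n : ℝ) / α).HolderConjugate q) (hαn : α < n) (hc : 0 < c) (hΦ : IsStarYoung Φ)
    (hΨ : StarShaped Ψ) (hφ₁ : ∀ x, ∀ r > 0, 0 < φ₁ x r) (hZ : ZygmundCond φ₁ φ₂ Φ Ψ) :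
    ∃ A : ℝ≥0, ∀ f : EuclideanSpace ℝ (Fin n) → 𝕜, StronglyMeasurable f → morreyNorm Φ φ₁ f < ∞ →
      ∀ (x₀ : EuclideanSpace ℝ (Fin n)) (r : ℝ), 0 < r →
        genInv Ψ (volume (Metric.ball x₀ r))⁻¹ * ballNorm Φ f x₀ (2 * r) ≤
          ENNReal.ofReal (φ₂ x₀ r) * (A * morreyNorm Φ φ₁ f) ∧
        ∀ x ∈ Metric.ball x₀ r,
          potential α ((Metric.ball x₀ (2 * r))ᶜ.indicator fun y => ‖f y‖₊) x ≤
            ENNReal.ofReal (φ₂ x₀ r) * (A * morreyNorm Φ φ₁ f) := by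
  obtain ⟨K, hK1, hK⟩ := exists_volume_ball_comparable n
  obtain ⟨A₁, hA₁⟩ := exists_potential_compl_ball_le_tailInt (𝕜 := 𝕜) hαn hpq hc hΦ hΨ.monotone hd
  obtain ⟨A₂, hA₂⟩ := exists_tailInt_le (𝕜 := 𝕜) hΦ hφ₁ hZ
  refine ⟨(K * (2 * 4 ^ n) + A₁) * A₂, fun f hf hfin x₀ r hr => ?_⟩
  set J := tailInt n Ψ (ballNorm Φ f x₀) r
  have htail : (K * (2 * 4 ^ n) + A₁ : ℝ≥0) * J ≤
      ENNReal.ofReal (φ₂ x₀ r) * (((K * (2 * 4 ^ n) + A₁) * A₂ : ℝ≥0) * morreyNorm Φ φ₁ f) :=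
    (mul_le_mul_right (hA₂ f hfin x₀ r hr) _).trans_eq (by rw [ENNReal.coe_mul]; ring)
  refine ⟨le_trans ?_ htail, fun x hx => (hA₁ f hf x₀ r hr x hx).trans (le_trans ?_ htail)⟩
  · calc genInv Ψ (volume (Metric.ball x₀ r))⁻¹ * ballNorm Φ f x₀ (2 * r)
        ≤ K * genInv Ψ (ENNReal.ofReal ((r ^ n)⁻¹)) * ballNorm Φ f x₀ (2 * r) := by
          gcongr
          rw [ENNReal.ofReal_inv_of_pos (pow_pos hr n)]
          exact hΨ.genInv_inv_le hK1 (hK x₀ r hr).2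
      _ = K * (genInv Ψ (ENNReal.ofReal ((r ^ n)⁻¹)) * ballNorm Φ f x₀ (2 * r)) := mul_assoc _ _ _
      _ ≤ K * (2 * 4 ^ n * J) :=
          mul_le_mul_right
            (hΨ.genInv_mul_le_tailInt (ballNorm_mono hΦ.starShaped.monotone f x₀) hr) _
      _ = (K * (2 * 4 ^ n) : ℝ≥0) * J := by push_cast; ring
      _ ≤ _ := by
          gcongr
          exact le_self_add
  · gcongr
    exact le_add_self

theorem IsStarYoung.setLIntegral_ball_lt_top (hΦ : IsStarYoung Φ) (hf : StronglyMeasurable f)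
    {x : EuclideanSpace ℝ (Fin n)} {r : ℝ} (hr : 0 < r) (h : ballNorm Φ f x r < ∞) :
    ∫⁻ y in Metric.ball x r, (‖f y‖₊ : ℝ≥0∞) < ∞ := by
  have hv0 : volume (Metric.ball x r) ≠ 0 := (Metric.measure_ball_pos volume x hr).ne'
  have hvtop : volume (Metric.ball x r) ≠ ∞ := measure_ball_lt_top.ne
  have hg : genInv Φ (volume (Metric.ball x r))⁻¹ ≠ ∞ := hΦ.genInv_ne_top (by simpa using hv0)
  refine (hΦ.setLIntegral_nnnorm_le hf measurableSet_ball hv0 hvtop).trans_lt ?_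
  exact ENNReal.mul_lt_top (by finiteness) h

theorem setLIntegral_ball_potential_lt_top (hα : 0 < α) (hαn : α < n) (hΦ : IsStarYoung Φ)
    (hf : StronglyMeasurable f) {x₀ : EuclideanSpace ℝ (Fin n)} {r : ℝ} (hr : 0 < r) {P : ℝ≥0∞}
    (hP : P < ∞) (hnear : ballNorm Φ f x₀ (2 * r) < ∞)
    (hfar : ∀ x ∈ Metric.ball x₀ r,
      potential α ((Metric.ball x₀ (2 * r))ᶜ.indicator fun y => ‖f y‖₊) x ≤ P) :
    ∫⁻ x in Metric.ball x₀ r, potential α (fun y => ‖f y‖₊) x < ∞ := by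
  obtain ⟨C, -, hC⟩ := exists_setLIntegral_rieszKernel_le hα hαn
  have hF : Measurable ((Metric.ball x₀ (2 * r)).indicator fun y => ‖f y‖₊) :=
    hf.measurable.nnnorm.indicator measurableSet_ball
  have hvtop : volume (Metric.ball x₀ r) ≠ ∞ := measure_ball_lt_top.ne
  simp_rw [potential_eq_add_compl α hf.measurable.nnnorm
    (measurableSet_ball (x := x₀) (ε := 2 * r))]
  rw [lintegral_add_left (measurable_potential α hF)]
  refine ENNReal.add_lt_top.2 ⟨?_, ?_⟩
  · refine (setLIntegral_potential_le_mul_lintegral hC hF _).trans_lt (ENNReal.mul_lt_top ?_ ?_)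
    · exact ENNReal.mul_lt_top ENNReal.coe_lt_top
        (ENNReal.rpow_lt_top_of_nonneg (by positivity) hvtop)
    · simp only [ENNReal.coe_indicator, lintegral_indicator measurableSet_ball]
      exact hΦ.setLIntegral_ball_lt_top hf (by linarith) hnear
  · calc _ ≤ ∫⁻ _ in Metric.ball x₀ r, P := setLIntegral_mono' measurableSet_ball hfar
      _ = P * volume (Metric.ball x₀ r) := setLIntegral_const _ _
      _ < ∞ := ENNReal.mul_lt_top hP hvtop.lt_top

theorem ae_integrable_rieszIntegrand (hf : StronglyMeasurable f)
    (h : ∀ r : ℝ, 0 < r → ∫⁻ x in Metric.ball 0 r, potential α (fun y => ‖f y‖₊) x < ∞) :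
    ∀ᵐ x, Integrable (rieszIntegrand α f x) := by
  have hfin : ∀ᵐ x, potential α (fun y => ‖f y‖₊) x < ∞ := by
    rw [← Measure.restrict_univ (μ := volume), ← Metric.iUnion_ball_nat_succ 0,
      ae_restrict_iUnion_iff]
    exact fun N => ae_lt_top (measurable_potential α hf.measurable.nnnorm)
      (h (N + 1) (by positivity)).ne
  exact hfin.mono fun x hx => integrable_rieszIntegrand hf hx

theorem locallyIntegrable_indicator_rieszPotential (hf : StronglyMeasurable f)
    {B : Set (EuclideanSpace ℝ (Fin n))} (hB : MeasurableSet B)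
    (h : ∫⁻ x in B, potential α (fun y => ‖f y‖₊) x < ∞) :
    LocallyIntegrable (B.indicator (rieszPotential α f)) := by
  refine Integrable.locallyIntegrable ((integrable_indicator_iff hB).2
    ⟨(stronglyMeasurable_rieszPotential α hf).aestronglyMeasurable, ?_⟩)
  exact (lintegral_mono fun x => nnnorm_rieszPotential_le α f x).trans_lt h

theorem MemMorrey.aestronglyMeasurable (hf : MemMorrey Φ φ f) : AEStronglyMeasurable f := by
  rw [← Measure.restrict_univ (μ := volume), ← Metric.iUnion_ball_nat_succ 0,
    aestronglyMeasurable_iUnion_iff]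
  intro N
  rw [← aestronglyMeasurable_indicator_iff measurableSet_ball]
  exact (hf.1 0 (N + 1) (by positivity)).1.aestronglyMeasurable

theorem rieszIntegrand_congr_ae (α : ℝ) {g : EuclideanSpace ℝ (Fin n) → 𝕜} (h : f =ᵐ[volume] g)
    (x : EuclideanSpace ℝ (Fin n)) : rieszIntegrand α f x =ᵐ[volume] rieszIntegrand α g x :=
  h.mono fun y hy => by simp only [rieszIntegrand, hy]

theorem rieszPotential_congr_ae (α : ℝ) {g : EuclideanSpace ℝ (Fin n) → 𝕜}
    (h : f =ᵐ[volume] g) : rieszPotential α f = rieszPotential α g :=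
  funext fun x => integral_congr_ae (rieszIntegrand_congr_ae α h x)

theorem MemMorrey.of_forall_ball_le (hΨ : IsStarYoung Ψ) (hφ : ∀ x, ∀ r > 0, 0 < φ x r)
    {M : ℝ≥0∞} (hM : M < ∞) (hloc : ∀ x r, 0 < r →
      LocallyIntegrable ((Metric.ball x r).indicator f))
    (h : ∀ x r, 0 < r → genInv Ψ (volume (Metric.ball x r))⁻¹ *
      orliczNorm Ψ ((Metric.ball x r).indicator f) ≤ ENNReal.ofReal (φ x r) * M) :
    MemMorrey Ψ φ f ∧ morreyNorm Ψ φ f ≤ M := by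
  have hnorm : morreyNorm Ψ φ f ≤ M := iSup_le fun x => iSup₂_le fun r hr => by
    rw [mul_assoc, ENNReal.inv_mul_le_iff (by simpa using hφ x r hr) ENNReal.ofReal_ne_top]
    exact h x r hr
  refine ⟨⟨fun x r hr => ⟨hloc x r hr, ?_⟩, hnorm.trans_lt hM⟩, hnorm⟩
  have hfin : orliczNorm Ψ ((Metric.ball x r).indicator f) < ∞ :=
    ENNReal.lt_top_of_mul_ne_top_right
      ((h x r hr).trans_lt (ENNReal.mul_lt_top ENNReal.ofReal_lt_top hM)).ne
      (hΨ.genInv_ne_zero (by simpa using measure_ball_lt_top.ne))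
  obtain ⟨l, hl, -, hl1⟩ := exists_lintegral_le_one_of_orliczNorm_lt hfin
  refine ⟨l⁻¹, by positivity, lt_of_le_of_lt ?_ ENNReal.one_lt_top⟩
  simpa only [div_eq_inv_mul] using hl1

theorem MemWeakMorrey.of_forall_ball_le (hΨ : IsStarYoung Ψ) (hφ : ∀ x, ∀ r > 0, 0 < φ x r)
    {M : ℝ≥0∞} (hM : M < ∞) (hloc : ∀ x r, 0 < r →
      LocallyIntegrable ((Metric.ball x r).indicator f))
    (h : ∀ x r, 0 < r → genInv Ψ (volume (Metric.ball x r))⁻¹ *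
      weakOrliczNorm Ψ ((Metric.ball x r).indicator f) ≤ ENNReal.ofReal (φ x r) * M) :
    MemWeakMorrey Ψ φ f ∧ weakMorreyNorm Ψ φ f ≤ M := by
  have hnorm : weakMorreyNorm Ψ φ f ≤ M := iSup_le fun x => iSup₂_le fun r hr => by
    rw [mul_assoc, ENNReal.inv_mul_le_iff (by simpa using hφ x r hr) ENNReal.ofReal_ne_top]
    exact h x r hr
  refine ⟨⟨fun x r hr => ⟨hloc x r hr, ?_⟩, hnorm.trans_lt hM⟩, hnorm⟩
  exact ENNReal.lt_top_of_mul_ne_top_right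
    ((h x r hr).trans_lt (ENNReal.mul_lt_top ENNReal.ofReal_lt_top hM)).ne
    (hΨ.genInv_ne_zero (by simpa using measure_ball_lt_top.ne))

theorem SobolevDominated.exists_rieszPotential_bounds (hd : SobolevDominated q c Φ Ψ)
    (hpq : ((n : ℝ) / α).HolderConjugate q) (hα : 0 < α) (hαn : α < n) (hc : 0 < c)
    (hΦ : IsStarYoung Φ) (hΨ : IsStarYoung Ψ) (hφ₁ : ∀ x, ∀ r > 0, 0 < φ₁ x r)
    (hZ : ZygmundCond φ₁ φ₂ Φ Ψ) :
    ∃ A : ℝ≥0, ∀ f : EuclideanSpace ℝ (Fin n) → 𝕜, MemMorrey Φ φ₁ f →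
      (∀ᵐ x, Integrable (rieszIntegrand α f x)) ∧
      ∃ g : EuclideanSpace ℝ (Fin n) → 𝕜, StronglyMeasurable g ∧
        rieszPotential α g = rieszPotential α f ∧
        ∀ x₀ r, 0 < r →
          LocallyIntegrable ((Metric.ball x₀ r).indicator (rieszPotential α f)) ∧
          genInv Ψ (volume (Metric.ball x₀ r))⁻¹ * ballNorm Φ g x₀ (2 * r) ≤
            ENNReal.ofReal (φ₂ x₀ r) * (A * morreyNorm Φ φ₁ f) ∧
          ∀ x ∈ Metric.ball x₀ r,
            potential α ((Metric.ball x₀ (2 * r))ᶜ.indicator fun y => ‖g y‖₊) x ≤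
              ENNReal.ofReal (φ₂ x₀ r) * (A * morreyNorm Φ φ₁ f) := by
  obtain ⟨A, hA⟩ := hd.exists_near_far_le (𝕜 := 𝕜) hpq hαn hc hΦ hΨ.starShaped hφ₁ hZ
  refine ⟨A, fun f hf => ?_⟩
  obtain ⟨g, hg, hfg⟩ := hf.aestronglyMeasurable
  have hnorm : morreyNorm Φ φ₁ g = morreyNorm Φ φ₁ f := (morreyNorm_congr_ae hfg).symm
  have hbounds := hA g hg (hnorm.trans_lt hf.2)
  rw [hnorm] at hbounds
  have hfin (x : EuclideanSpace ℝ (Fin n)) (r : ℝ) :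
      ENNReal.ofReal (φ₂ x r) * (A * morreyNorm Φ φ₁ f) < ∞ :=
    ENNReal.mul_lt_top ENNReal.ofReal_lt_top (ENNReal.mul_lt_top ENNReal.coe_lt_top hf.2)
  have hpot (x : EuclideanSpace ℝ (Fin n)) (r : ℝ) (hr : 0 < r) :
      ∫⁻ y in Metric.ball x r, potential α (fun y => ‖g y‖₊) y < ∞ :=
    setLIntegral_ball_potential_lt_top hα hαn hΦ hg hr (hfin x r)
      (ENNReal.lt_top_of_mul_ne_top_right ((hbounds x r hr).1.trans_lt (hfin x r)).ne
        (hΨ.genInv_ne_zero (by simpa using measure_ball_lt_top.ne))) (hbounds x r hr).2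
  refine ⟨?_, g, hg, rieszPotential_congr_ae α hfg.symm, fun x r hr => ⟨?_, hbounds x r hr⟩⟩
  · filter_upwards [ae_integrable_rieszIntegrand hg (hpot 0)] with x hx
    exact hx.congr (rieszIntegrand_congr_ae α hfg.symm x)
  · rw [rieszPotential_congr_ae α hfg]
    exact locallyIntegrable_indicator_rieszPotential hg measurableSet_ball (hpot x r hr)

theorem SobolevDominated.exists_morreyNorm_rieszPotential_le (hd : SobolevDominated q c Φ Ψ)
    (hd' : SobolevDominated q c' (compl Ψ) (compl Φ)) (hpq : ((n : ℝ) / α).HolderConjugate q)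
    (hα : 0 < α) (hαn : α < n) (hc : 0 < c) (hc' : 0 < c') (hΦ : IsStarYoung Φ)
    (hΨ : IsStarYoung Ψ) (hφ₁ : ∀ x, ∀ r > 0, 0 < φ₁ x r)
    (hφ₂ : ∀ x, ∀ r > 0, 0 < φ₂ x r) (hZ : ZygmundCond φ₁ φ₂ Φ Ψ) :
    ∃ C : ℝ≥0, ∀ f : EuclideanSpace ℝ (Fin n) → 𝕜, MemMorrey Φ φ₁ f →
      (∀ᵐ x, Integrable (rieszIntegrand α f x) volume) ∧
      MemMorrey Ψ φ₂ (rieszPotential α f) ∧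
      morreyNorm Ψ φ₂ (rieszPotential α f) ≤ C * morreyNorm Φ φ₁ f := by
  obtain ⟨_, -, hweak⟩ := hd.exists_mul_volume_potential_le hpq hα hαn hc hΦ.starShaped
  obtain ⟨K, hK, hstrong⟩ :=
    hd.exists_lintegral_apply_potential_le hd' hpq hα hαn hc hc' hΦ.starShaped hΨ.starShaped
  obtain ⟨A, hA⟩ := hd.exists_rieszPotential_bounds (𝕜 := 𝕜) hpq hα hαn hc hΦ hΨ hφ₁ hZ
  refine ⟨4 * K * A, fun f hf => ?_⟩
  obtain ⟨hint, g, hg, hgf, hball⟩ := hA f hf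
  refine ⟨hint, MemMorrey.of_forall_ball_le hΨ hφ₂
    (ENNReal.mul_lt_top ENNReal.coe_lt_top hf.2) (fun x r hr => (hball x r hr).1) fun x r hr => ?_⟩
  rw [← hgf, ENNReal.coe_mul, mul_assoc, mul_left_comm]
  exact genInv_mul_orliczNorm_rieszPotential_le hΦ.starShaped.monotone hΨ hK
    (fun F hF h => ⟨ae_lt_top_of_forall_mul_measure_le hΨ.tendsto_top (hweak F hF h),
      hstrong F hF h⟩) hg hr (hball x r hr).2.1 (hball x r hr).2.2

theorem SobolevDominated.exists_weakMorreyNorm_rieszPotential_le (hd : SobolevDominated q c Φ Ψ)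
    (hpq : ((n : ℝ) / α).HolderConjugate q) (hα : 0 < α) (hαn : α < n) (hc : 0 < c)
    (hΦ : IsStarYoung Φ) (hΨ : IsStarYoung Ψ) (hφ₁ : ∀ x, ∀ r > 0, 0 < φ₁ x r)
    (hφ₂ : ∀ x, ∀ r > 0, 0 < φ₂ x r) (hZ : ZygmundCond φ₁ φ₂ Φ Ψ) :
    ∃ C : ℝ≥0, ∀ f : EuclideanSpace ℝ (Fin n) → 𝕜, MemMorrey Φ φ₁ f →
      (∀ᵐ x, Integrable (rieszIntegrand α f x) volume) ∧
      MemWeakMorrey Ψ φ₂ (rieszPotential α f) ∧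
      weakMorreyNorm Ψ φ₂ (rieszPotential α f) ≤ C * morreyNorm Φ φ₁ f := by
  obtain ⟨K, hK, hweak⟩ := hd.exists_mul_volume_potential_le hpq hα hαn hc hΦ.starShaped
  obtain ⟨A, hA⟩ := hd.exists_rieszPotential_bounds (𝕜 := 𝕜) hpq hα hαn hc hΦ hΨ hφ₁ hZ
  refine ⟨4 * K * A, fun f hf => ?_⟩
  obtain ⟨hint, g, hg, hgf, hball⟩ := hA f hf
  refine ⟨hint, MemWeakMorrey.of_forall_ball_le hΨ hφ₂
    (ENNReal.mul_lt_top ENNReal.coe_lt_top hf.2) (fun x r hr => (hball x r hr).1) fun x r hr => ?_⟩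
  rw [← hgf, ENNReal.coe_mul, mul_assoc, mul_left_comm]
  exact genInv_mul_weakOrliczNorm_rieszPotential_le hΦ.starShaped.monotone hΨ hK hweak hg hr
    (hball x r hr).2.1 (hball x r hr).2.2

end Morrey

theorem div_div_sub_one {n α : ℝ} (hα : α ≠ 0) : n / α / (n / α - 1) = n / (n - α) := by
  field_simp

theorem holderConjugate_div_div_sub {n α : ℝ} (hα : 0 < α) (hαn : α < n) :
    (n / α).HolderConjugate (n / (n - α)) := by
  have : 0 < n - α := sub_pos.2 hαn
  rw [← div_div_sub_one hα.ne']
  exact .conjExponent ((one_lt_div hα).2 hαn)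

theorem CondWeak.exists_sobolevDominated {n : ℕ} {α : ℝ} {Φ Ψ : ℝ≥0 → ℝ≥0∞} (hα : 0 < α)
    (hαn : α < n) (hΦ : StarShaped Φ) (hΨ : StarShaped Ψ) (h : CondWeak n α Φ Ψ) :
    ∃ c, 0 < c ∧ SobolevDominated (n / (n - α)) c Φ Ψ := by
  obtain ⟨hfin, hdom⟩ := h
  rw [upperConj, div_div_sub_one hα.ne'] at hdom
  exact hΦ.exists_sobolevDominated hΨ (holderConjugate_div_div_sub hα hαn).symm.lt hfin hdom

theorem CondStrong.exists_sobolevDominated_compl {n : ℕ} {α : ℝ} {Φ Ψ : ℝ≥0 → ℝ≥0∞} (hα : 0 < α)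
    (hαn : α < n) (h : CondStrong n α Φ Ψ) :
    ∃ c, 0 < c ∧ SobolevDominated (n / (n - α)) c (compl Ψ) (compl Φ) := by
  obtain ⟨-, hfin, hdom, -⟩ := h
  rw [lowerConj, div_div_sub_one hα.ne'] at hdom
  exact OrliczMorrey.exists_sobolevDominated_compl (holderConjugate_div_div_sub hα hαn).symm.lt
    hfin hdom

theorem CondStrong.condWeak {n : ℕ} {α : ℝ} {Φ Ψ : ℝ≥0 → ℝ≥0∞} (h : CondStrong n α Φ Ψ) :
    CondWeak n α Φ Ψ :=
  ⟨h.1, h.2.2.2⟩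

end OrliczMorrey

end

open OrliczMorrey in
theorem mainTheorem1_general {𝕜 : Type*} [RCLike 𝕜] (n : ℕ) (α : ℝ) (hα : 0 < α) (hαn : α < n)
    (Φ Ψ : ℝ≥0 → ℝ≥0∞) (hΦ : IsStarYoung Φ) (hΨ : IsStarYoung Ψ)
    (φ₁ φ₂ : EuclideanSpace ℝ (Fin n) → ℝ → ℝ)
    (hφ₁ : ∀ x, ∀ r > 0, 0 < φ₁ x r) (hφ₂ : ∀ x, ∀ r > 0, 0 < φ₂ x r)
    (hZ : ZygmundCond φ₁ φ₂ Φ Ψ) :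
    (CondStrong n α Φ Ψ →
      ∃ C : ℝ≥0, ∀ f : EuclideanSpace ℝ (Fin n) → 𝕜, MemMorrey Φ φ₁ f →
        (∀ᵐ x, Integrable (rieszIntegrand α f x) volume) ∧
        MemMorrey Ψ φ₂ (rieszPotential α f) ∧
        morreyNorm Ψ φ₂ (rieszPotential α f) ≤ C * morreyNorm Φ φ₁ f) ∧
    (CondWeak n α Φ Ψ →
      ∃ C : ℝ≥0, ∀ f : EuclideanSpace ℝ (Fin n) → 𝕜, MemMorrey Φ φ₁ f →
        (∀ᵐ x, Integrable (rieszIntegrand α f x) volume) ∧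
        MemWeakMorrey Ψ φ₂ (rieszPotential α f) ∧
        weakMorreyNorm Ψ φ₂ (rieszPotential α f) ≤ C * morreyNorm Φ φ₁ f) := by
  have hpq := holderConjugate_div_div_sub hα hαn
  refine ⟨fun h => ?_, fun h => ?_⟩
  · obtain ⟨c, hc, hd⟩ := h.condWeak.exists_sobolevDominated hα hαn hΦ.starShaped hΨ.starShaped
    obtain ⟨c', hc', hd'⟩ := h.exists_sobolevDominated_compl hα hαn
    exact hd.exists_morreyNorm_rieszPotential_le hd' hpq hα hαn hc hc' hΦ hΨ hφ₁ hφ₂ hZ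
  · obtain ⟨c, hc, hd⟩ := h.exists_sobolevDominated hα hαn hΦ.starShaped hΨ.starShaped
    exact hd.exists_weakMorreyNorm_rieszPotential_le hpq hα hαn hc hΦ hΨ hφ₁ hφ₂ hZ

theorem mainTheorem1 {𝕜 : Type*} [RCLike 𝕜] (n : ℕ) (α : ℝ) (hα : 0 < α) (hαn : α < n)
    (Φ Ψ : ℝ≥0 → ℝ≥0∞) (hΦ : OrliczMorrey.IsYoung Φ) (hΨ : OrliczMorrey.IsYoung Ψ)
    (φ₁ φ₂ : EuclideanSpace ℝ (Fin n) → ℝ → ℝ)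
    (hφ₁ : OrliczMorrey.IsMorreyWeight φ₁) (hφ₂ : OrliczMorrey.IsMorreyWeight φ₂)
    (hZ : OrliczMorrey.ZygmundCond φ₁ φ₂ Φ Ψ) :
    (OrliczMorrey.CondStrong n α Φ Ψ →
      ∃ C : ℝ≥0, ∀ f : EuclideanSpace ℝ (Fin n) → 𝕜, OrliczMorrey.MemMorrey Φ φ₁ f →
        (∀ᵐ x, Integrable (OrliczMorrey.rieszIntegrand α f x) volume) ∧
        OrliczMorrey.MemMorrey Ψ φ₂ (OrliczMorrey.rieszPotential α f) ∧
        OrliczMorrey.morreyNorm Ψ φ₂ (OrliczMorrey.rieszPotential α f)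
          ≤ C * OrliczMorrey.morreyNorm Φ φ₁ f) ∧
    (OrliczMorrey.CondWeak n α Φ Ψ →
      ∃ C : ℝ≥0, ∀ f : EuclideanSpace ℝ (Fin n) → 𝕜, OrliczMorrey.MemMorrey Φ φ₁ f →
        (∀ᵐ x, Integrable (OrliczMorrey.rieszIntegrand α f x) volume) ∧
        OrliczMorrey.MemWeakMorrey Ψ φ₂ (OrliczMorrey.rieszPotential α f) ∧
        OrliczMorrey.weakMorreyNorm Ψ φ₂ (OrliczMorrey.rieszPotential α f)
          ≤ C * OrliczMorrey.morreyNorm Φ φ₁ f) :=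
  mainTheorem1_general n α hα hαn Φ Ψ hΦ.isStarYoung hΨ.isStarYoung φ₁ φ₂ hφ₁.1 hφ₂.1 hZ
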